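/- **Setting.** Let $\mathbb T=\mathbb Z_+$ or $\mathbb T=\mathbb R_+$, and let $\mathcal B\subseteq B(G)$ be a von Neumann algebra on a Hilbert space $G$. A Hilbert $\mathcal B$-module $E$ is regarded as a subset of $B(G,E\odot G)$, $x\mapsto (g\mapsto x\odot g)$; it is a *von Neumann $\mathcal B$-$\mathcal B$-module* if it is strongly closed there and carries a unital left action of $\mathcal B$ whose representation on $E\odot G$ is normal. Tensor products $E\odot F$ of such modules are interior tensor products, closed strongly in $B(G,E\odot F\odot G)$. An *inclusion system* $(E,\beta)$ of von Neumann $\mathcal B$-$\mathcal B$-modules is a family $(E_t)_{t\in\mathbb T}$ of such modules with $E_0=\mathcal B$ and bilinear isometries $\beta_{s,t}:E_{s+t}\to E_s\odot E_t$ such that $$(\beta_{r,s}\odot \mathrm{id}_{E_t})\,\beta_{r+s,t}=(\mathrm{id}_{E_r}\odot\beta_{s,t})\,\beta_{r,s+t}\qquad(r,s,t\in\mathbb T)$$ and such that $\beta_{0,t}$ and $\beta_{t,0}$ are the canonical identifications $x\mapsto 1\odot x$ and $x\mapsto x\odot 1$. It is a *product system* if all $\beta_{s,t}$ are unitary. A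 *(weak) morphism* $(E,\beta)\to(F,\gamma)$ is a family of adjointable bilinear maps $T_t:E_t\to F_t$ with $\|T_t\|\le e^{tk}$ for all $t$ and some $k\in\mathbb R$, such that every $\gamma_{s,t}$ is adjointable and $T_{s+t}=\gamma_{s,t}^*(T_s\odot T_t)\beta_{s,t}$ for all $s,t\in\mathbb T$. For $t>0$ let $\mathbb J_t$ be the set of tuples $\mathfrak t=(t_n,\dots,t_1)$, $n\ge1$, with $t_i\in\mathbb T$, $t_i>0$ and $t_n+\dots+t_1=t$; let $\mathbb J_0=\{()\}$. Write $\mathfrak s\smile\mathfrak t$ for the concatenation. For $\mathfrak s=(s_m,\dots,s_1)$ in $\mathbb J_t$ let $\mathfrak t\ge\mathfrak s$ mean $\mathfrak t=\mathfrak s_m\smile\dots\smile\mathfrak s_1$ with $\mathfrak s_j\in\mathbb J_{s_j}$. Put $E_{\mathfrak t}=E_{t_n}\odot\dots\odot E_{t_1}$ and $E_{()}=\mathcal B$. For $\mathfrak t\ge\mathfrak s$ let $\beta_{\mathfrak t\mathfrak s}:E_{\mathfrak s}\to E_{\mathfrak t}$ be the bilinear isometry obtained by splitting every factor $E_{s_j}$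 into the tensor product $E_{\mathfrak s_j}$ with the maps $\beta$. The *product system $(\mathcal E,B)$ generated by $(E,\beta)$* consists of the inductive limits $\mathcal E_t=\varinjlim_{\mathfrak t\in\mathbb J_t}E_{\mathfrak t}$ (strongly closed), with canonical isometries $i_{\mathfrak t}:E_{\mathfrak t}\to\mathcal E_t$, and the unitaries $$B_{s,t}:\mathcal E_s\odot\mathcal E_t\to\mathcal E_{s+t},\qquad B_{s,t}(i_{\mathfrak s}x\odot i_{\mathfrak t}y)=i_{\mathfrak s\smile\mathfrak t}(x\odot y).$$ As a system with structure maps in the above direction it is $(\mathcal E,B^*)$; so a morphism $S:(\mathcal E,B)\to(\mathcal F,C)$ satisfies $S_{s+t}=C_{s,t}(S_s\odot S_t)B_{s,t}^*$. The *inclusion map* is $i_t=i_{(t)}:E_t\to\mathcal E_t$ for $t>0$, and $i_0=i_{()}$. **Theorem.** Let $(E,\beta)$ and $(F,\gamma)$ be inclusion systems of von Neumann $\mathcal B$-$\mathcal B$-modules, let $(\mathcal E,B)$ and $(\mathcal F,C)$ be the product systems generated by them, and let $i$ and $j$ be the respective inclusion maps. Let $T:(E,\beta)\to(F,\gamma)$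 be a (weak) morphism. Then there is exactly one morphism of product systems $\hat T:(\mathcal E,B)\to(\mathcal F,C)$ with $$T_s=j_s^*\,\hat T_s\,i_s\qquad\text{for all }s\in\mathbb T .$$ Moreover, for every $s>0$, $\hat T_s$ is the strong limit of the net $\big(j_{\mathfrak s}T_{\mathfrak s}i_{\mathfrak s}^*\big)_{\mathfrak s\in\mathbb J_s}$, where $T_{\mathfrak s}=T_{s_n}\odot\dots\odot T_{s_1}$ for $\mathfrak s=(s_n,\dots,s_1)$; that is, $j_{\mathfrak s}T_{\mathfrak s}i_{\mathfrak s}^*\,\xi\to\hat T_s\,\xi$ for every $\xi\in\mathcal E_s\odot G$, all maps being extended to the Hilbert spaces by $\odot\,\mathrm{id}_G$. -/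

import Mathlib

open scoped InnerProductSpace NNReal
open Filter Topology

universe u

/-- A positive semidefinite complex kernel on a set `ι`. -/
structure PDKernel (ι : Type*) where
  κ : ι → ι → ℂ
  conj_symm : ∀ i j, star (κ i j) = κ j i
  nonneg : ∀ (s : Finset ι) (c : ι → ℂ), 0 ≤ (∑ i ∈ s, ∑ j ∈ s, star (c i) * c j * κ i j).re

namespace PDKernel

variable {ι : Type*}

/-- The vector space of formal finite linear combinations of elements of `ι`. -/
def Pre (_ : PDKernel ι) : Type _ := ι →₀ ℂ

noncomputable instance (k : PDKernel ι) : AddCommGroup k.Pre := inferInstanceAs (AddCommGroup (ι →₀ ℂ))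
noncomputable instance (k : PDKernel ι) : Module ℂ k.Pre := inferInstanceAs (Module ℂ (ι →₀ ℂ))

/-- The semi-inner product `⟨∑ aᵢ i, ∑ bⱼ j⟩ = ∑ āᵢ bⱼ κ i j` on formal linear combinations. -/
@[reducible] noncomputable def core (k : PDKernel ι) : PreInnerProductSpace.Core ℂ (ι →₀ ℂ) where
  inner f g := f.sum fun i z => g.sum fun j w => star z * w * k.κ i j
  conj_inner_symm f g := by
    rw [Finsupp.sum_comm]
    simp only [map_finsuppSum]
    congr! 4
    funext j w
    rw [← k.conj_symm]
    simp [mul_comm]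
  add_left f g h := by
    rw [Finsupp.sum_add_index'] <;> simp [← Finsupp.sum_add, add_mul]
  smul_left f g r := by
    rw [Finsupp.sum_smul_index] <;> simp [Finsupp.mul_sum, ← mul_assoc]
  re_inner_nonneg f := k.nonneg _ _

noncomputable instance (k : PDKernel ι) : PreInnerProductSpace.Core ℂ k.Pre := k.core

noncomputable instance (k : PDKernel ι) : SeminormedAddCommGroup k.Pre :=
  InnerProductSpace.Core.toSeminormedAddCommGroup (𝕜 := ℂ)

noncomputable instance (k : PDKernel ι) : InnerProductSpace ℂ k.Pre := .ofCore _

/-- The Hilbert space of a positive semidefinite kernel: divide out the null vectors of the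
semi-inner product on the formal linear combinations and complete. -/
abbrev Space (k : PDKernel ι) := UniformSpace.Completion k.Pre

/-- The vector of the Hilbert space given by `i : ι`. -/
noncomputable def vec (k : PDKernel ι) (i : ι) : k.Space :=
  UniformSpace.Completion.coe' (show k.Pre from Finsupp.single i (1 : ℂ))

theorem inner_vec (k : PDKernel ι) (i j : ι) : ⟪k.vec i, k.vec j⟫_ℂ = k.κ i j := by
  rw [vec, vec, UniformSpace.Completion.inner_coe]
  change Finsupp.sum _ _ = _
  rw [Finsupp.sum_single_index (by simp), Finsupp.sum_single_index (by simp)]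
  simp

theorem linearCombination_vec (k : PDKernel ι) (c : ι →₀ ℂ) :
    Finsupp.linearCombination ℂ k.vec c = UniformSpace.Completion.coe' (show k.Pre from c) := by
  induction c using Finsupp.induction_linear with
  | zero => rw [map_zero]; exact (UniformSpace.Completion.coe_zero).symm
  | add f g hf hg => rw [map_add, hf, hg]; exact (UniformSpace.Completion.coe_add _ _).symm
  | single i a =>
    rw [Finsupp.linearCombination_single, vec, ← UniformSpace.Completion.coe_smul]
    congr 1
    exact (Finsupp.smul_single_one i a)

theorem denseRange_vec (k : PDKernel ι) : DenseRange (Finsupp.linearCombination ℂ k.vec) := by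
  have : (Finsupp.linearCombination ℂ k.vec : (ι →₀ ℂ) → k.Space) =
      fun c => UniformSpace.Completion.coe' (show k.Pre from c) := funext k.linearCombination_vec
  rw [this]
  exact UniformSpace.Completion.denseRange_coe (α := k.Pre)

end PDKernel

/-- `extendMap e f` is the bounded operator with `e i ↦ f i`, extended by linearity and continuity; it is meant for
families `e` with dense span and families `f` for which the extension exists. -/
noncomputable def extendMap {ι H K : Type*} [NormedAddCommGroup H] [InnerProductSpace ℂ H]
    [NormedAddCommGroup K] [InnerProductSpace ℂ K] [CompleteSpace K] (e : ι → H) (f : ι → K) :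
    H →L[ℂ] K :=
  (Finsupp.linearCombination ℂ f).extendOfNorm (Finsupp.linearCombination ℂ e)

theorem extendMap_apply {ι H K : Type*} [NormedAddCommGroup H] [InnerProductSpace ℂ H]
    [NormedAddCommGroup K] [InnerProductSpace ℂ K] [CompleteSpace K] {e : ι → H} {f : ι → K}
    (he : DenseRange (Finsupp.linearCombination ℂ e)) {C : ℝ}
    (hC : ∀ c, ‖Finsupp.linearCombination ℂ f c‖ ≤ C * ‖Finsupp.linearCombination ℂ e c‖) (i : ι) :
    extendMap e f (e i) = f i := by
  have := LinearMap.extendOfNorm_eq he ⟨C, hC⟩ (Finsupp.single i (1 : ℂ))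
  simpa [extendMap] using this

theorem clm_ext_of_denseRange {ι H K : Type*} [NormedAddCommGroup H] [InnerProductSpace ℂ H]
    [NormedAddCommGroup K] [InnerProductSpace ℂ K] {e : ι → H}
    (he : DenseRange (Finsupp.linearCombination ℂ e)) {S T : H →L[ℂ] K} (h : ∀ i, S (e i) = T (e i)) :
    S = T := by
  apply ContinuousLinearMap.coeFn_injective
  refine he.equalizer S.continuous T.continuous (funext fun c => ?_)
  simp [Finsupp.linearCombination_apply, Finsupp.sum, h]


section Positivity

variable {G : Type u} [NormedAddCommGroup G] [InnerProductSpace ℂ G] [CompleteSpace G]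

theorem mem_of_commute (B : VonNeumannAlgebra G) (x : G →L[ℂ] G)
    (h : ∀ y ∈ B.commutant, y * x = x * y) : x ∈ B.toStarSubalgebra := by
  have : x ∈ B.commutant.commutant := VonNeumannAlgebra.mem_commutant_iff.2 h
  rwa [VonNeumannAlgebra.commutant_commutant] at this

theorem commute_of_mem (B : VonNeumannAlgebra G) {x y : G →L[ℂ] G}
    (hx : x ∈ B.toStarSubalgebra) (hy : y ∈ B.commutant) : y * x = x * y :=
  (VonNeumannAlgebra.mem_commutant_iff.1 hy x hx).symm

/-- A positive matrix over a von Neumann algebra stays positive under a representation. -/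
theorem sum_inner_rep_nonneg (B : VonNeumannAlgebra G) {n : Type u} [Fintype n]
    (p : n → n → B.toStarSubalgebra) (hs : ∀ i j, star (p i j) = p j i)
    (hp : ∀ g : n → G, 0 ≤ (∑ i, ∑ j, ⟪g i, (p i j : G →L[ℂ] G) (g j)⟫_ℂ).re)
    {K : Type u} [NormedAddCommGroup K] [InnerProductSpace ℂ K] [CompleteSpace K]
    (π : B.toStarSubalgebra →⋆ₐ[ℂ] (K →L[ℂ] K)) (k : n → K) :
    0 ≤ (∑ i, ∑ j, ⟪k i, π (p i j) (k j)⟫_ℂ).re := by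
  classical
  let V := PiLp 2 (fun _ : n => G)
  let pr : n → V →L[ℂ] G := fun i => PiLp.proj 2 (fun _ : n => G) i
  have hpr : ∀ i (v : V), pr i v = v i := fun i v => rfl
  let inj : n → G →L[ℂ] V := fun i => (pr i).adjoint
  have hinj : ∀ i g, inj i g = WithLp.toLp 2 (Pi.single i g) := by
    intro i g
    refine ext_inner_right ℂ fun v => ?_
    rw [ContinuousLinearMap.adjoint_inner_left, PiLp.inner_apply, hpr,
      Finset.sum_eq_single i]
    · simp
    · intro j _ hj; simp [Pi.single_eq_of_ne hj]
    · simp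
  have hpi : ∀ i j g, pr i (inj j g) = if i = j then g else 0 := by
    intro i j g
    rw [hinj, hpr]
    simp [Pi.single_apply]
  have hid : ∀ v : V, ∑ j, inj j (pr j v) = v := by
    intro v
    refine ext_inner_left ℂ fun w => ?_
    rw [inner_sum, PiLp.inner_apply]
    refine Finset.sum_congr rfl fun j _ => ?_
    rw [ContinuousLinearMap.adjoint_inner_right]; rfl
  let P : V →L[ℂ] V := ∑ i, ∑ j, inj i ∘L (p i j : G →L[ℂ] G) ∘L pr j
  have hP : ∀ v w : V, ⟪v, P w⟫_ℂ = ∑ i, ∑ j, ⟪v i, (p i j : G →L[ℂ] G) (w j)⟫_ℂ := by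
    intro v w
    have hPw : P w = ∑ i, ∑ j, inj i ((p i j : G →L[ℂ] G) (pr j w)) := by
      simp only [P, sum_apply, ContinuousLinearMap.comp_apply]
    rw [hPw, inner_sum]
    refine Finset.sum_congr rfl fun i _ => ?_
    rw [inner_sum]
    refine Finset.sum_congr rfl fun j _ => ?_
    rw [ContinuousLinearMap.adjoint_inner_right]; rfl
  have hadj : ∀ i j, ContinuousLinearMap.adjoint (p i j : G →L[ℂ] G) = (p j i : G →L[ℂ] G) := by
    intro i j
    rw [← hs i j]; rfl
  have hPpos : 0 ≤ P := by
    rw [ContinuousLinearMap.nonneg_iff_isPositive, ContinuousLinearMap.isPositive_def']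
    constructor
    · rw [ContinuousLinearMap.isSelfAdjoint_iff', eq_comm, ContinuousLinearMap.eq_adjoint_iff]
      intro v w
      rw [hP, ← inner_conj_symm, hP, map_sum, Finset.sum_comm]
      refine Finset.sum_congr rfl fun i _ => ?_
      rw [map_sum]
      refine Finset.sum_congr rfl fun j _ => ?_
      rw [inner_conj_symm, ← ContinuousLinearMap.adjoint_inner_right, hadj]
    · intro v
      rw [ContinuousLinearMap.reApplyInnerSelf_apply, ← inner_re_symm, hP]
      exact hp _
  let S := CFC.sqrt P
  have hSS : S * S = P := CFC.sqrt_mul_sqrt_self P hPpos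
  have hSa : ContinuousLinearMap.adjoint S = S :=
    (CFC.sqrt_nonneg P).isSelfAdjoint.star_eq
  have hScomm : ∀ T : V →L[ℂ] V, Commute P T → Commute S T := fun T hT => hT.cfcₙ_nnreal _
  let s : n → n → (G →L[ℂ] G) := fun i j => pr i ∘L S ∘L inj j
  have hsmem : ∀ i j, s i j ∈ B.toStarSubalgebra := by
    intro i j
    refine mem_of_commute B _ fun y hy => ?_
    let D : V →L[ℂ] V := ∑ i, inj i ∘L y ∘L pr i
    have hprD : ∀ i v, pr i (D v) = y (pr i v) := by
      intro i v
      simp [D, sum_apply, map_sum, hpi]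
    have hDinj : ∀ j g, D (inj j g) = inj j (y g) := by
      intro j g
      simp only [D, sum_apply, ContinuousLinearMap.comp_apply, hpi]
      rw [Finset.sum_eq_single j]
      · simp
      · intro i _ hi; simp [hi]
      · simp
    have hprP : ∀ i v, pr i (P v) = ∑ j, (p i j : G →L[ℂ] G) (pr j v) := by
      intro i v
      simp only [P, sum_apply, map_sum, ContinuousLinearMap.comp_apply, hpi]
      rw [Finset.sum_eq_single i]
      · simp
      · intro j _ hj; simp [Ne.symm hj]
      · simp
    have hcomm : Commute P D := by
      refine ContinuousLinearMap.ext fun v => ?_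
      refine PiLp.ext fun i => ?_
      change pr i (P (D v)) = pr i (D (P v))
      rw [hprD, hprP, hprP, map_sum]
      refine Finset.sum_congr rfl fun j _ => ?_
      rw [hprD]
      exact (DFunLike.congr_fun (commute_of_mem B (p i j).2 hy) _).symm
    have hSD := hScomm D hcomm
    refine ContinuousLinearMap.ext fun g => ?_
    change y (pr i (S (inj j g))) = pr i (S (inj j (y g)))
    rw [← hprD, ← hDinj]
    exact congrArg (pr i) (DFunLike.congr_fun hSD (inj j g)).symm
  let c : n → n → B.toStarSubalgebra := fun i j => ⟨s i j, hsmem i j⟩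
  have hcs : ∀ i j, star (c i j) = c j i := by
    intro i j
    apply Subtype.ext
    change ContinuousLinearMap.adjoint (pr i ∘L S ∘L inj j) = pr j ∘L S ∘L inj i
    rw [ContinuousLinearMap.adjoint_comp, ContinuousLinearMap.adjoint_comp, hSa,
      ContinuousLinearMap.adjoint_adjoint]
    rfl
  have hpc : ∀ i j, p i j = ∑ k, c i k * c k j := by
    intro i j
    apply Subtype.ext
    refine ContinuousLinearMap.ext fun g => ?_
    have h1 : (p i j : G →L[ℂ] G) g = pr i (P (inj j g)) := by
      simp only [P, sum_apply, map_sum, ContinuousLinearMap.comp_apply, hpi]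
      rw [Finset.sum_eq_single i, Finset.sum_eq_single j]
      · simp
      · intro l _ hl; simp [hl]
      · simp
      · intro l _ hl; simp [Ne.symm hl]
      · simp
    rw [h1, ← hSS]
    change pr i (S (S (inj j g))) = _
    rw [← hid (S (inj j g))]
    simp only [map_sum]
    rw [AddSubmonoidClass.coe_finsetSum, sum_apply]
    rfl
  have key : ∑ i, ∑ j, ⟪k i, π (p i j) (k j)⟫_ℂ =
      ∑ l, ⟪∑ i, π (c l i) (k i), ∑ j, π (c l j) (k j)⟫_ℂ := by
    simp only [hpc, map_sum, sum_apply, inner_sum, sum_inner]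
    have : ∀ i j l, ⟪k i, π (c i l * c l j) (k j)⟫_ℂ = ⟪π (c l i) (k i), π (c l j) (k j)⟫_ℂ := by
      intro i j l
      rw [map_mul, ← hcs l i, map_star, ContinuousLinearMap.star_eq_adjoint,
        mul_apply_eq_comp, ContinuousLinearMap.adjoint_inner_right]
    simp only [this]
    calc _ = ∑ i, ∑ l, ∑ j, ⟪π (c l i) (k i), π (c l j) (k j)⟫_ℂ :=
          Finset.sum_congr rfl fun i _ => Finset.sum_comm
      _ = ∑ l, ∑ i, ∑ j, ⟪π (c l i) (k i), π (c l j) (k j)⟫_ℂ := Finset.sum_comm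
      _ = _ := Finset.sum_congr rfl fun l _ => Finset.sum_comm
  rw [key, Complex.re_sum]
  exact Finset.sum_nonneg fun l _ => inner_self_nonneg (𝕜 := ℂ)

end Positivity

section General

variable {ι H K : Type*} [NormedAddCommGroup H] [InnerProductSpace ℂ H]
    [NormedAddCommGroup K] [InnerProductSpace ℂ K]

theorem norm_sq_linearCombination (e : ι → H) (c : ι →₀ ℂ) :
    ‖Finsupp.linearCombination ℂ e c‖ ^ 2 =
      (∑ i ∈ c.support, ∑ j ∈ c.support, star (c i) * c j * ⟪e i, e j⟫_ℂ).re := by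
  rw [← inner_self_eq_norm_sq (𝕜 := ℂ), Finsupp.linearCombination_apply, Finsupp.sum, sum_inner]
  simp only [inner_sum, inner_smul_left, inner_smul_right]
  change Complex.re _ = _
  congr 1
  refine Finset.sum_congr rfl fun i _ => ?_
  refine Finset.sum_congr rfl fun j _ => ?_
  simp only [RCLike.star_def]; ring

theorem eq_of_forall_inner {e : ι → H} (he : DenseRange (Finsupp.linearCombination ℂ e)) {v w : H}
    (h : ∀ i, ⟪e i, v⟫_ℂ = ⟪e i, w⟫_ℂ) : v = w := by
  refine he.eq_of_inner_right ℂ fun c => ?_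
  simp [Finsupp.linearCombination_apply, Finsupp.sum, sum_inner, inner_smul_left, h]

theorem tendsto_inner_of_denseRange {α : Type*} {e : ι → H}
    (he : DenseRange (Finsupp.linearCombination ℂ e)) (l : Filter α) (T : α → H →L[ℂ] H)
    (T₀ : H →L[ℂ] H) (r : ℝ) (hr : ∀ᶠ a in l, ‖T a‖ ≤ r)
    (h : ∀ i j, Tendsto (fun a => ⟪e i, T a (e j)⟫_ℂ) l (𝓝 ⟪e i, T₀ (e j)⟫_ℂ)) (ξ η : H) :
    Tendsto (fun a => ⟪ξ, T a η⟫_ℂ) l (𝓝 ⟪ξ, T₀ η⟫_ℂ) := by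
  wlog hr0 : 0 ≤ r generalizing r
  · exact this (max r 0) (hr.mono fun a ha => ha.trans (le_max_left _ _)) (le_max_right _ _)
  set R := max r ‖T₀‖ with hR
  have hR0 : 0 ≤ R := hr0.trans (le_max_left _ _)
  -- an equicontinuous family of functions converges on a closed set
  have closed : ∀ (f : α → H → ℂ) (f₀ : H → ℂ) (C : ℝ), (∀ᶠ a in l, ∀ x y, ‖f a x - f a y‖ ≤ C * ‖x - y‖) →
      (∀ x y, ‖f₀ x - f₀ y‖ ≤ C * ‖x - y‖) →
      (∀ c, Tendsto (fun a => f a (Finsupp.linearCombination ℂ e c)) l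
        (𝓝 (f₀ (Finsupp.linearCombination ℂ e c)))) → ∀ x, Tendsto (fun a => f a x) l (𝓝 (f₀ x)) := by
    intro f f₀ C hf hf₀ hc x
    rw [Metric.tendsto_nhds]
    intro ε hε
    obtain ⟨c, hcx⟩ := he.exists_dist_lt x (ε := ε / (3 * (|C| + 1))) (by positivity)
    have hC : C * ‖x - Finsupp.linearCombination ℂ e c‖ < ε / 3 := by
      rw [dist_eq_norm, lt_div_iff₀ (by positivity)] at hcx
      have := le_abs_self C
      nlinarith [norm_nonneg (x - Finsupp.linearCombination ℂ e c)]
    filter_upwards [hf, (Metric.tendsto_nhds.1 (hc c)) (ε / 3) (by positivity)] with a h1 h2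
    have h1' := h1 x (Finsupp.linearCombination ℂ e c)
    have h3 := hf₀ x (Finsupp.linearCombination ℂ e c)
    have t1 := dist_triangle4 (f a x) (f a (Finsupp.linearCombination ℂ e c))
      (f₀ (Finsupp.linearCombination ℂ e c)) (f₀ x)
    rw [dist_eq_norm (f a x) (f a _), dist_comm (f₀ _) (f₀ x), dist_eq_norm (f₀ x)] at t1
    linarith
  have step : ∀ i, ∀ η, Tendsto (fun a => ⟪e i, T a η⟫_ℂ) l (𝓝 ⟪e i, T₀ η⟫_ℂ) := by
    intro i
    refine closed (fun a η => ⟪e i, T a η⟫_ℂ) (fun η => ⟪e i, T₀ η⟫_ℂ) (‖e i‖ * R) ?_ ?_ ?_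
    · filter_upwards [hr] with a ha x y
      rw [← inner_sub_right, ← map_sub]
      refine (norm_inner_le_norm _ _).trans ?_
      rw [mul_assoc]
      gcongr
      exact (T a).le_of_opNorm_le (ha.trans (le_max_left _ _)) _
    · intro x y
      rw [← inner_sub_right, ← map_sub]
      refine (norm_inner_le_norm _ _).trans ?_
      rw [mul_assoc]
      gcongr
      exact T₀.le_of_opNorm_le (le_max_right _ _) _
    · intro c
      simp only [Finsupp.linearCombination_apply, Finsupp.sum, map_sum, map_smul, inner_sum, inner_smul_right]
      exact tendsto_finsetSum _ fun j _ => (h i j).const_mul _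
  refine closed (fun a ξ => ⟪ξ, T a η⟫_ℂ) (fun ξ => ⟪ξ, T₀ η⟫_ℂ) (R * ‖η‖) ?_ ?_ ?_ ξ
  · filter_upwards [hr] with a ha x y
    rw [← inner_sub_left, mul_comm]
    refine (norm_inner_le_norm _ _).trans ?_
    gcongr
    exact (T a).le_of_opNorm_le (ha.trans (le_max_left _ _)) _
  · intro x y
    rw [← inner_sub_left, mul_comm]
    refine (norm_inner_le_norm _ _).trans ?_
    gcongr
    exact T₀.le_of_opNorm_le (le_max_right _ _) _
  · intro c
    simp only [Finsupp.linearCombination_apply, Finsupp.sum, sum_inner, inner_smul_left]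
    exact tendsto_finsetSum _ fun j _ => (step j η).const_mul _

end General

section Modules

variable {G : Type u} [NormedAddCommGroup G] [InnerProductSpace ℂ G] [CompleteSpace G]

instance isClosed_vN (B : VonNeumannAlgebra G) : IsClosed (B.toStarSubalgebra : Set (G →L[ℂ] G)) := by
  have : (B.toStarSubalgebra : Set (G →L[ℂ] G)) = ⋂ y ∈ B.commutant, {x | y * x = x * y} := by
    ext x
    simp only [Set.mem_iInter, Set.mem_ofPred_eq]
    exact ⟨fun hx y hy => commute_of_mem B hx hy, fun h => mem_of_commute B x h⟩
  rw [this]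
  exact isClosed_biInter fun y _ => isClosed_eq (by fun_prop) (by fun_prop)

theorem norm_rep_le (B : VonNeumannAlgebra G) {K : Type u} [NormedAddCommGroup K]
    [InnerProductSpace ℂ K] [CompleteSpace K] (π : B.toStarSubalgebra →⋆ₐ[ℂ] (K →L[ℂ] K))
    (b : B.toStarSubalgebra) : ‖π b‖ ≤ ‖(b : G →L[ℂ] G)‖ :=
  NonUnitalStarAlgHom.norm_apply_le π b

/-- A representation of a von Neumann algebra is normal if it is continuous for the weak operator
topologies on bounded sets (equivalently: σ-weakly continuous). Nets are expressed by filters. -/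
def IsNormalRep (B : VonNeumannAlgebra G) {K : Type u} [NormedAddCommGroup K]
    [InnerProductSpace ℂ K] [CompleteSpace K] (π : B.toStarSubalgebra →⋆ₐ[ℂ] (K →L[ℂ] K)) : Prop :=
  ∀ (l : Filter B.toStarSubalgebra) (b : B.toStarSubalgebra) (r : ℝ),
    (∀ᶠ a : B.toStarSubalgebra in l, ‖(a : G →L[ℂ] G)‖ ≤ r) →
    (∀ g h : G, Tendsto (fun a : B.toStarSubalgebra => ⟪g, (a : G →L[ℂ] G) h⟫_ℂ) l
      (𝓝 ⟪g, (b : G →L[ℂ] G) h⟫_ℂ)) →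
    ∀ ξ η : K, Tendsto (fun a => ⟪ξ, π a η⟫_ℂ) l (𝓝 ⟪ξ, π b η⟫_ℂ)

/-- The strong operator closure of a linear space of operators: the operators in its closure for
the topology of pointwise convergence. -/
def sotClosure {H : Type*} [NormedAddCommGroup H] [InnerProductSpace ℂ H]
    (E : Submodule ℂ (G →L[ℂ] H)) : Submodule ℂ (G →L[ℂ] H) :=
  Submodule.comap (ContinuousLinearMap.coeLM ℂ : (G →L[ℂ] H) →ₗ[ℂ] (G →ₗ[ℂ] H))
    (Submodule.comap (LinearMap.ltoFun ℂ G H ℂ)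
      (Submodule.topologicalClosure (Submodule.map (LinearMap.ltoFun ℂ G H ℂ)
        (Submodule.map (ContinuousLinearMap.coeLM ℂ) E))))

theorem mem_sotClosure {H : Type*} [NormedAddCommGroup H] [InnerProductSpace ℂ H]
    {E : Submodule ℂ (G →L[ℂ] H)} {x : G →L[ℂ] H} :
    x ∈ sotClosure E ↔ (x : G → H) ∈ closure ((fun y : G →L[ℂ] H => (y : G → H)) '' E) := by
  unfold sotClosure
  rw [Submodule.mem_comap, Submodule.mem_comap, ← SetLike.mem_coe, Submodule.topologicalClosure_coe,
    Submodule.map_coe, Submodule.map_coe, Set.image_image]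
  rfl
end Modules

section Bimodules

variable {G : Type u} [NormedAddCommGroup G] [InnerProductSpace ℂ G] [CompleteSpace G]


/-- A Hilbert space with a normal unital representation of the von Neumann algebra `B`. -/
structure NormalRep (B : VonNeumannAlgebra G) where
  H : Type u
  [instGroup : NormedAddCommGroup H]
  [instInner : InnerProductSpace ℂ H]
  [instComplete : CompleteSpace H]
  π : B.toStarSubalgebra →⋆ₐ[ℂ] (H →L[ℂ] H)
  normal : IsNormalRep B π

attribute [instance] NormalRep.instGroup NormalRep.instInner NormalRep.instComplete

/-- A von Neumann `B`-`B`-module, in its concrete form: a strongly closed space `E` of operators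
from `G` to a Hilbert space `H` (which is `E ⊙ G`, because `E G` is total in `H` and the inner product
is `⟨x, y⟩ = x* y ∈ B`) that is stable under right multiplication by `B`, together with a normal unital
representation `π` of `B` on `H` whose operators map `E` into `E`; this is the left action. -/
structure VNBimodule (B : VonNeumannAlgebra G) extends NormalRep B where
  E : Submodule ℂ (G →L[ℂ] H)
  right_mem : ∀ x ∈ E, ∀ b : B.toStarSubalgebra, x ∘L (b : G →L[ℂ] G) ∈ E
  inner_mem : ∀ x ∈ E, ∀ y ∈ E, ContinuousLinearMap.adjoint x ∘L y ∈ B.toStarSubalgebra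
  total : (Submodule.span ℂ {h : H | ∃ x ∈ E, ∃ g : G, h = x g}).topologicalClosure = ⊤
  left_mem : ∀ b, ∀ x ∈ E, π b ∘L x ∈ E
  closed : sotClosure E ≤ E

namespace VNBimodule
variable {B : VonNeumannAlgebra G}

/-- The `B`-valued inner product `⟨x, y⟩ = x* y`. -/
noncomputable def ip (X : VNBimodule B) (x y : X.E) : B.toStarSubalgebra :=
  ⟨ContinuousLinearMap.adjoint (x : G →L[ℂ] X.H) ∘L (y : G →L[ℂ] X.H), X.inner_mem x x.2 y y.2⟩

theorem star_ip (X : VNBimodule B) (x y : X.E) : star (X.ip x y) = X.ip y x := by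
  apply Subtype.ext
  change ContinuousLinearMap.adjoint (ContinuousLinearMap.adjoint (x : G →L[ℂ] X.H) ∘L (y : G →L[ℂ] X.H)) = _
  rw [ContinuousLinearMap.adjoint_comp, ContinuousLinearMap.adjoint_adjoint]
  rfl

theorem coe_ip (X : VNBimodule B) (x y : X.E) : (X.ip x y : G →L[ℂ] G) =
    ContinuousLinearMap.adjoint (x : G →L[ℂ] X.H) ∘L (y : G →L[ℂ] X.H) := rfl

theorem inner_ip (X : VNBimodule B) (x y : X.E) (g h : G) :
    ⟪g, (X.ip x y : G →L[ℂ] G) h⟫_ℂ = ⟪(x : G →L[ℂ] X.H) g, (y : G →L[ℂ] X.H) h⟫_ℂ := by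
  rw [coe_ip, ContinuousLinearMap.comp_apply, ContinuousLinearMap.adjoint_inner_right]

theorem sum_ip_re (X : VNBimodule B) {n : Type*} [Fintype n] (x : n → X.E) (g : n → G) :
    (∑ i, ∑ j, ⟪g i, (X.ip (x i) (x j) : G →L[ℂ] G) (g j)⟫_ℂ).re =
      ‖∑ i, (x i : G →L[ℂ] X.H) (g i)‖ ^ 2 := by
  have : ∑ i, ∑ j, ⟪g i, (X.ip (x i) (x j) : G →L[ℂ] G) (g j)⟫_ℂ =
      ⟪∑ i, (x i : G →L[ℂ] X.H) (g i), ∑ i, (x i : G →L[ℂ] X.H) (g i)⟫_ℂ := by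
    simp only [inner_ip, sum_inner, inner_sum]
    exact Finset.sum_comm
  rw [this]
  exact inner_self_eq_norm_sq (𝕜 := ℂ) _

/-- The matrix `C² ⟨xᵢ, xⱼ⟩ - ⟨f xᵢ, f xⱼ⟩` is positive if `f` is given by an operator of norm at
most `C`; hence so is its image under a representation. -/
theorem rep_bound (X Y : VNBimodule B) (K : NormalRep B) (f : X.E → Y.E) (T : X.H →L[ℂ] Y.H)
    (hf : ∀ x, (f x : G →L[ℂ] Y.H) = T ∘L (x : G →L[ℂ] X.H)) (C : ℝ) (hC : ‖T‖ ≤ C)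
    (s : Finset (X.E × K.H)) (c : X.E × K.H → ℂ) :
    (∑ i ∈ s, ∑ j ∈ s, star (c i) * c j * ⟪i.2, K.π (Y.ip (f i.1) (f j.1)) j.2⟫_ℂ).re ≤
      C ^ 2 * (∑ i ∈ s, ∑ j ∈ s, star (c i) * c j * ⟪i.2, K.π (X.ip i.1 j.1) j.2⟫_ℂ).re := by
  have hq : ∀ g : s → G, 0 ≤ (∑ i : s, ∑ j : s, ⟪g i, ((((C ^ 2 : ℝ) : ℂ) • X.ip i.1.1 j.1.1 -
      Y.ip (f i.1.1) (f j.1.1) : B.toStarSubalgebra) : G →L[ℂ] G) (g j)⟫_ℂ).re := by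
    intro g
    have h2 : (∑ i : s, ∑ j : s, ⟪g i, ((((C ^ 2 : ℝ) : ℂ) • X.ip i.1.1 j.1.1 -
        Y.ip (f i.1.1) (f j.1.1) : B.toStarSubalgebra) : G →L[ℂ] G) (g j)⟫_ℂ).re =
        C ^ 2 * ‖∑ i : s, (i.1.1 : G →L[ℂ] X.H) (g i)‖ ^ 2 -
          ‖∑ i : s, (f i.1.1 : G →L[ℂ] Y.H) (g i)‖ ^ 2 := by
      rw [← sum_ip_re X (fun i : s => i.1.1) g, ← sum_ip_re Y (fun i : s => f i.1.1) g,
        ← Complex.re_ofReal_mul, ← Complex.sub_re]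
      refine congrArg Complex.re ?_
      rw [Finset.mul_sum, ← Finset.sum_sub_distrib]
      refine Finset.sum_congr rfl fun i _ => ?_
      rw [Finset.mul_sum, ← Finset.sum_sub_distrib]
      refine Finset.sum_congr rfl fun j _ => ?_
      rw [← inner_smul_right, ← inner_sub_right]
      rfl
    have h3 : ∑ i : s, (f i.1.1 : G →L[ℂ] Y.H) (g i) = T (∑ i : s, (i.1.1 : G →L[ℂ] X.H) (g i)) := by
      rw [map_sum]
      refine Finset.sum_congr rfl fun i _ => ?_
      rw [hf]; rfl
    rw [h2, h3, ← mul_pow, sub_nonneg]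
    gcongr
    exact T.le_of_opNorm_le hC _
  have key := sum_inner_rep_nonneg B (n := s)
    (fun i j => ((C ^ 2 : ℝ) : ℂ) • X.ip i.1.1 j.1.1 - Y.ip (f i.1.1) (f j.1.1))
    (fun i j => by
      rw [star_sub, star_smul, star_ip, star_ip, RCLike.star_def, Complex.conj_ofReal])
    hq K.π (fun i => c i.1 • i.1.2)
  rw [← sub_nonneg, ← Complex.re_ofReal_mul, ← Complex.sub_re]
  refine key.trans_eq (congrArg Complex.re ?_)
  rw [Finset.mul_sum, ← Finset.sum_sub_distrib, ← Finset.sum_coe_sort s]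
  refine Finset.sum_congr rfl fun i _ => ?_
  rw [Finset.mul_sum, ← Finset.sum_sub_distrib, ← Finset.sum_coe_sort s]
  refine Finset.sum_congr rfl fun j _ => ?_
  have hsm : K.π (((C ^ 2 : ℝ) : ℂ) • X.ip i.1.1 j.1.1) =
      ((C ^ 2 : ℝ) : ℂ) • K.π (X.ip i.1.1 j.1.1) := map_smul K.π _ _
  rw [map_sub, hsm, sub_apply, smul_apply]
  simp only [map_smul, inner_sub_right, inner_smul_left, inner_smul_right, RCLike.star_def]
  ring

/-- The kernel `⟨x ⊗ k, y ⊗ l⟩ = ⟨k, ⟨x, y⟩ l⟩`. -/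
noncomputable def tensKernel (X : VNBimodule B) (K : NormalRep B) : PDKernel (X.E × K.H) where
  κ i j := ⟪i.2, K.π (X.ip i.1 j.1) j.2⟫_ℂ
  conj_symm i j := by
    rw [← star_ip, map_star, ContinuousLinearMap.star_eq_adjoint,
      ContinuousLinearMap.adjoint_inner_right]
    exact inner_conj_symm _ _
  nonneg s c := by
    have := rep_bound X X K (fun _ => 0) 0 (fun x => by ext; simp) 1 (by simp) s c
    have h0 : X.ip 0 0 = 0 := by
      apply Subtype.ext; ext g; simp [ip]
    simpa [h0] using this

/-- The vector `x ⊗ k` of the Hilbert space `X ⊙ K`. -/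
noncomputable def tmul (X : VNBimodule B) (K : NormalRep B) (x : X.E) (k : K.H) :
    (X.tensKernel K).Space := (X.tensKernel K).vec (x, k)

theorem inner_tmul (X : VNBimodule B) (K : NormalRep B) (x y : X.E) (k l : K.H) :
    ⟪X.tmul K x k, X.tmul K y l⟫_ℂ = ⟪k, K.π (X.ip x y) l⟫_ℂ := PDKernel.inner_vec _ _ _

theorem dense_tmul (X : VNBimodule B) (K : NormalRep B) :
    DenseRange (Finsupp.linearCombination ℂ (fun p : X.E × K.H => X.tmul K p.1 p.2)) :=
  (X.tensKernel K).denseRange_vec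

theorem norm_left_le (X Y : VNBimodule B) (K : NormalRep B) (f : X.E → Y.E) (T : X.H →L[ℂ] Y.H)
    (hf : ∀ x, (f x : G →L[ℂ] Y.H) = T ∘L (x : G →L[ℂ] X.H)) (c : X.E × K.H →₀ ℂ) :
    ‖Finsupp.linearCombination ℂ (fun p : X.E × K.H => Y.tmul K (f p.1) p.2) c‖ ≤
      ‖T‖ * ‖Finsupp.linearCombination ℂ (fun p : X.E × K.H => X.tmul K p.1 p.2) c‖ := by
  refine le_of_sq_le_sq ?_ (by positivity)
  rw [mul_pow, norm_sq_linearCombination, norm_sq_linearCombination]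
  simp only [inner_tmul]
  exact rep_bound X Y K f T hf _ le_rfl c.support c

end VNBimodule


namespace VNBimodule
variable {B : VonNeumannAlgebra G}

theorem ip_add (X : VNBimodule B) (w x y : X.E) : X.ip w (x + y) = X.ip w x + X.ip w y := by
  apply Subtype.ext; ext g; simp [ip]

theorem ip_smul (X : VNBimodule B) (w x : X.E) (z : ℂ) : X.ip w (z • x) = z • X.ip w x := by
  apply Subtype.ext; ext g; simp [ip]

/-- The left action of `B` on the module. -/
noncomputable def lact (X : VNBimodule B) (b : B.toStarSubalgebra) (x : X.E) : X.E :=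
  ⟨X.π b ∘L (x : G →L[ℂ] X.H), X.left_mem b x x.2⟩

/-- The right action of `B` on the module. -/
noncomputable def ract (X : VNBimodule B) (x : X.E) (b : B.toStarSubalgebra) : X.E :=
  ⟨(x : G →L[ℂ] X.H) ∘L (b : G →L[ℂ] G), X.right_mem x x.2 b⟩

theorem lact_apply (X : VNBimodule B) (b : B.toStarSubalgebra) (x : X.E) (g : G) :
    (X.lact b x : G →L[ℂ] X.H) g = X.π b ((x : G →L[ℂ] X.H) g) := rfl

theorem ext_apply {X : VNBimodule B} {x y : X.E}
    (h : ∀ g, (x : G →L[ℂ] X.H) g = (y : G →L[ℂ] X.H) g) : x = y :=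
  Subtype.ext (ContinuousLinearMap.ext h)

theorem lact_one (X : VNBimodule B) (x : X.E) : X.lact 1 x = x :=
  ext_apply fun g => by rw [lact_apply, map_one]; rfl

theorem lact_mul (X : VNBimodule B) (a b : B.toStarSubalgebra) (x : X.E) :
    X.lact (a * b) x = X.lact a (X.lact b x) :=
  ext_apply fun g => by rw [lact_apply, map_mul]; rfl

theorem lact_add (X : VNBimodule B) (a b : B.toStarSubalgebra) (x : X.E) :
    X.lact (a + b) x = X.lact a x + X.lact b x :=
  ext_apply fun g => by rw [lact_apply, map_add]; rfl

theorem lact_algebraMap (X : VNBimodule B) (z : ℂ) (x : X.E) :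
    X.lact (algebraMap ℂ B.toStarSubalgebra z) x = z • x :=
  ext_apply fun g => by
    have : X.π (algebraMap ℂ B.toStarSubalgebra z) = algebraMap ℂ (X.H →L[ℂ] X.H) z :=
      AlgHomClass.commutes X.π z
    rw [lact_apply, this]; rfl

theorem ip_ract (X : VNBimodule B) (w x : X.E) (b : B.toStarSubalgebra) :
    X.ip w (X.ract x b) = X.ip w x * b := by
  apply Subtype.ext; ext g; simp [ip, ract]

theorem ip_lact (X : VNBimodule B) (w x : X.E) (b : B.toStarSubalgebra) :
    X.ip w (X.lact b x) = X.ip (X.lact (star b) w) x := by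
  apply Subtype.ext
  simp only [ip, lact, ContinuousLinearMap.adjoint_comp, map_star,
    ContinuousLinearMap.star_eq_adjoint, ContinuousLinearMap.adjoint_adjoint]
  rfl

section
variable (X : VNBimodule B) (K : NormalRep B)

theorem tmul_ext {v w : (X.tensKernel K).Space}
    (h : ∀ x k, ⟪X.tmul K x k, v⟫_ℂ = ⟪X.tmul K x k, w⟫_ℂ) : v = w :=
  eq_of_forall_inner (X.dense_tmul K) fun p => h p.1 p.2

theorem tmul_add_left (x y : X.E) (k : K.H) : X.tmul K (x + y) k = X.tmul K x k + X.tmul K y k := by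
  refine X.tmul_ext K fun w l => ?_
  rw [inner_add_right, inner_tmul, inner_tmul, inner_tmul, ip_add, map_add, add_apply,
    inner_add_right]

theorem tmul_smul_left (z : ℂ) (x : X.E) (k : K.H) : X.tmul K (z • x) k = z • X.tmul K x k := by
  refine X.tmul_ext K fun w l => ?_
  have : K.π (z • X.ip w x) = z • K.π (X.ip w x) := map_smul K.π _ _
  rw [inner_smul_right, inner_tmul, inner_tmul, ip_smul, this, smul_apply, inner_smul_right]

theorem tmul_add_right (x : X.E) (k l : K.H) : X.tmul K x (k + l) = X.tmul K x k + X.tmul K x l := by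
  refine X.tmul_ext K fun w m => ?_
  rw [inner_add_right, inner_tmul, inner_tmul, inner_tmul, map_add, inner_add_right]

theorem tmul_smul_right (z : ℂ) (x : X.E) (k : K.H) : X.tmul K x (z • k) = z • X.tmul K x k := by
  refine X.tmul_ext K fun w l => ?_
  rw [inner_smul_right, inner_tmul, inner_tmul, map_smul, inner_smul_right]

theorem tmul_ract (x : X.E) (b : B.toStarSubalgebra) (k : K.H) :
    X.tmul K (X.ract x b) k = X.tmul K x (K.π b k) := by
  refine X.tmul_ext K fun w l => ?_
  rw [inner_tmul, inner_tmul, ip_ract, map_mul]; rfl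

/-- The left action `b (x ⊗ k) = bx ⊗ k`. -/
noncomputable def tensAct (b : B.toStarSubalgebra) :
    (X.tensKernel K).Space →L[ℂ] (X.tensKernel K).Space :=
  extendMap (fun p : X.E × K.H => X.tmul K p.1 p.2) (fun p => X.tmul K (X.lact b p.1) p.2)

theorem tensAct_tmul (b : B.toStarSubalgebra) (x : X.E) (k : K.H) :
    X.tensAct K b (X.tmul K x k) = X.tmul K (X.lact b x) k :=
  extendMap_apply (e := fun p : X.E × K.H => X.tmul K p.1 p.2) (X.dense_tmul K)
    (X.norm_left_le X K (X.lact b) (X.π b) (fun _ => rfl)) (x, k)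

theorem norm_tensAct_le (b : B.toStarSubalgebra) : ‖X.tensAct K b‖ ≤ ‖(b : G →L[ℂ] G)‖ :=
  (LinearMap.opNorm_extendOfNorm_le (X.dense_tmul K) (norm_nonneg _)
    (X.norm_left_le X K (X.lact b) (X.π b) (fun _ => rfl))).trans (norm_rep_le B X.π b)

theorem tens_clm_ext {H : Type*} [NormedAddCommGroup H] [InnerProductSpace ℂ H]
    {S T : (X.tensKernel K).Space →L[ℂ] H} (h : ∀ x k, S (X.tmul K x k) = T (X.tmul K x k)) : S = T :=
  clm_ext_of_denseRange (X.dense_tmul K) fun p => h p.1 p.2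

theorem tensAct_one : X.tensAct K 1 = 1 := X.tens_clm_ext K fun x k => by
  rw [tensAct_tmul, lact_one, one_apply_eq_self]

theorem tensAct_mul (a b : B.toStarSubalgebra) :
    X.tensAct K (a * b) = X.tensAct K a * X.tensAct K b := X.tens_clm_ext K fun x k => by
  rw [mul_apply_eq_comp, tensAct_tmul, tensAct_tmul, tensAct_tmul, lact_mul]

theorem tensAct_add (a b : B.toStarSubalgebra) :
    X.tensAct K (a + b) = X.tensAct K a + X.tensAct K b := X.tens_clm_ext K fun x k => by
  rw [add_apply, tensAct_tmul, tensAct_tmul, tensAct_tmul, lact_add, tmul_add_left]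

theorem tensAct_algebraMap (z : ℂ) :
    X.tensAct K (algebraMap ℂ B.toStarSubalgebra z) =
      algebraMap ℂ ((X.tensKernel K).Space →L[ℂ] (X.tensKernel K).Space) z :=
  X.tens_clm_ext K fun x k => by
    rw [tensAct_tmul, lact_algebraMap, Algebra.algebraMap_eq_smul_one, smul_apply,
      one_apply_eq_self]
    exact X.tmul_smul_left K z x k

theorem tensAct_zero : X.tensAct K 0 = 0 := by
  rw [← map_zero (algebraMap ℂ B.toStarSubalgebra), tensAct_algebraMap, map_zero]

theorem inner_tensAct (b : B.toStarSubalgebra) (v w : (X.tensKernel K).Space) :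
    ⟪X.tensAct K b v, w⟫_ℂ = ⟪v, X.tensAct K (star b) w⟫_ℂ := by
  have h : X.tensAct K b = ContinuousLinearMap.adjoint (X.tensAct K (star b)) :=
    X.tens_clm_ext K fun x k => X.tmul_ext K fun y l => by
      rw [ContinuousLinearMap.adjoint_inner_right, tensAct_tmul, tensAct_tmul, inner_tmul,
        inner_tmul, ip_lact]
  rw [h, ContinuousLinearMap.adjoint_inner_left]

/-- The left action as a representation. -/
noncomputable def tensRep : B.toStarSubalgebra →⋆ₐ[ℂ]
    ((X.tensKernel K).Space →L[ℂ] (X.tensKernel K).Space) where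
  toFun := X.tensAct K
  map_one' := X.tensAct_one K
  map_mul' := X.tensAct_mul K
  map_zero' := X.tensAct_zero K
  map_add' := X.tensAct_add K
  commutes' := X.tensAct_algebraMap K
  map_star' b := by
    rw [ContinuousLinearMap.star_eq_adjoint]
    refine (ContinuousLinearMap.eq_adjoint_iff _ _).2 fun v w => ?_
    rw [inner_tensAct, star_star]

theorem tensRep_apply (b : B.toStarSubalgebra) : X.tensRep K b = X.tensAct K b := rfl

/-- The Hilbert space `X ⊙ K`, with the left action of `B`. -/
noncomputable def tens : NormalRep B where
  H := (X.tensKernel K).Space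
  π := X.tensRep K
  normal := by
    intro l b r hr hw
    refine tendsto_inner_of_denseRange (X.dense_tmul K) l (X.tensRep K) _ r
      (hr.mono fun a ha => (X.norm_tensAct_le K a).trans ha) ?_
    rintro ⟨x, k⟩ ⟨y, m⟩
    have h1 : ∀ a, ⟪X.tmul K x k, X.tensRep K a (X.tmul K y m)⟫_ℂ =
        ⟪k, K.π (X.ip x (X.lact a y)) m⟫_ℂ := by
      intro a
      rw [tensRep_apply, tensAct_tmul, inner_tmul]
    simp only [h1]
    have h2 := K.normal (l.map fun a => X.ip x (X.lact a y)) (X.ip x (X.lact b y))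
      (‖ContinuousLinearMap.adjoint (x : G →L[ℂ] X.H)‖ * (r * ‖(y : G →L[ℂ] X.H)‖))
    refine tendsto_map'_iff.1 (h2 ?_ ?_ k m)
    · rw [eventually_map]
      filter_upwards [hr] with a ha
      refine (ContinuousLinearMap.opNorm_comp_le _ _).trans ?_
      gcongr
      refine (ContinuousLinearMap.opNorm_comp_le _ _).trans ?_
      gcongr
      exact (norm_rep_le B X.π a).trans ha
    · intro g h
      rw [tendsto_map'_iff]
      have h3 := X.normal l b r hr hw ((x : G →L[ℂ] X.H) g) ((y : G →L[ℂ] X.H) h)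
      have h4 : ∀ a, ⟪g, (X.ip x (X.lact a y) : G →L[ℂ] G) h⟫_ℂ =
          ⟪(x : G →L[ℂ] X.H) g, X.π a ((y : G →L[ℂ] X.H) h)⟫_ℂ := by
        intro a
        rw [inner_ip, lact_apply]
      simpa only [Function.comp_def, h4] using h3
end

end VNBimodule


section SOT
variable {H H' : Type*} [NormedAddCommGroup H] [InnerProductSpace ℂ H]
  [NormedAddCommGroup H'] [InnerProductSpace ℂ H']

theorem le_sotClosure (E : Submodule ℂ (G →L[ℂ] H)) : E ≤ sotClosure E := fun x hx =>
  mem_sotClosure.2 (subset_closure ⟨x, hx, rfl⟩)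

theorem sotClosure_induction {E : Submodule ℂ (G →L[ℂ] H)} {C : Set (G → H)} (hC : IsClosed C)
    (h : ∀ y ∈ E, (y : G → H) ∈ C) {x : G →L[ℂ] H} (hx : x ∈ sotClosure E) : (x : G → H) ∈ C :=
  closure_minimal (by rintro _ ⟨y, hy, rfl⟩; exact h y hy) hC (mem_sotClosure.1 hx)

theorem sotClosure_map {E : Submodule ℂ (G →L[ℂ] H)} {E' : Submodule ℂ (G →L[ℂ] H')}
    (A : H →L[ℂ] H') (b : G →L[ℂ] G) (h : ∀ y ∈ E, A ∘L y ∘L b ∈ sotClosure E')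
    {x : G →L[ℂ] H} (hx : x ∈ sotClosure E) : A ∘L x ∘L b ∈ sotClosure E' := by
  rw [mem_sotClosure]
  have hc : Continuous fun (φ : G → H) (g : G) => A (φ (b g)) := by fun_prop
  exact sotClosure_induction
    (C := (fun (φ : G → H) (g : G) => A (φ (b g))) ⁻¹'
      closure ((fun y : G →L[ℂ] H' => (y : G → H')) '' E'))
    (isClosed_closure.preimage hc) (fun y hy => mem_sotClosure.1 (h y hy)) hx

theorem sotClosure_sotClosure (E : Submodule ℂ (G →L[ℂ] H)) :
    sotClosure (sotClosure E) ≤ sotClosure E := fun _ hx =>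
  mem_sotClosure.2 (sotClosure_induction isClosed_closure (fun _ hy => mem_sotClosure.1 hy) hx)

theorem sotClosure_le_of_span {S : Set (G →L[ℂ] H)} {E' : Submodule ℂ (G →L[ℂ] H')}
    (A : H →L[ℂ] H') (b : G →L[ℂ] G) (h : ∀ y ∈ S, A ∘L y ∘L b ∈ sotClosure E')
    {x : G →L[ℂ] H} (hx : x ∈ sotClosure (Submodule.span ℂ S)) : A ∘L x ∘L b ∈ sotClosure E' := by
  refine sotClosure_map A b (fun y hy => ?_) hx
  induction hy using Submodule.span_induction with
  | mem y hy => exact h y hy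
  | zero => simp
  | add y z _ _ h1 h2 =>
    have : A ∘L (y + z) ∘L b = A ∘L y ∘L b + A ∘L z ∘L b := by ext g; simp
    rw [this]; exact add_mem h1 h2
  | smul c y _ h1 =>
    have : A ∘L (c • y) ∘L b = c • (A ∘L y ∘L b) := by ext g; simp
    rw [this]; exact Submodule.smul_mem _ _ h1

theorem sotClosure_inner_mem (B : VonNeumannAlgebra G) [CompleteSpace H] {E : Submodule ℂ (G →L[ℂ] H)}
    (h : ∀ x ∈ E, ∀ y ∈ E, ContinuousLinearMap.adjoint x ∘L y ∈ B.toStarSubalgebra)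
    {x y : G →L[ℂ] H} (hx : x ∈ sotClosure E) (hy : y ∈ sotClosure E) :
    ContinuousLinearMap.adjoint x ∘L y ∈ B.toStarSubalgebra := by
  refine mem_of_commute B _ fun b hb => ContinuousLinearMap.ext fun g => ext_inner_left ℂ fun g' => ?_
  change ⟪g', b (ContinuousLinearMap.adjoint x (y g))⟫_ℂ =
    ⟪g', ContinuousLinearMap.adjoint x (y (b g))⟫_ℂ
  rw [← ContinuousLinearMap.adjoint_inner_left, ContinuousLinearMap.adjoint_inner_right,
    ContinuousLinearMap.adjoint_inner_right]
  have h0 : ∀ x ∈ E, ∀ y ∈ E, ⟪x (ContinuousLinearMap.adjoint b g'), y g⟫_ℂ = ⟪x g', y (b g)⟫_ℂ := by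
    intro x hx y hy
    have := DFunLike.congr_fun (commute_of_mem B (h x hx y hy) hb) g
    rw [← ContinuousLinearMap.adjoint_inner_right, ContinuousLinearMap.adjoint_inner_left,
      ← ContinuousLinearMap.adjoint_inner_right x]
    exact congrArg _ this
  have h1 : ∀ y ∈ E, ⟪x (ContinuousLinearMap.adjoint b g'), y g⟫_ℂ = ⟪x g', y (b g)⟫_ℂ := by
    intro y hy
    exact sotClosure_induction (C := {φ : G → H | ⟪φ (ContinuousLinearMap.adjoint b g'), y g⟫_ℂ = ⟪φ g', y (b g)⟫_ℂ})
      (isClosed_eq (by fun_prop) (by fun_prop)) (fun x hx => h0 x hx y hy) hx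
  exact sotClosure_induction (C := {φ : G → H | ⟪x (ContinuousLinearMap.adjoint b g'), φ g⟫_ℂ = ⟪x g', φ (b g)⟫_ℂ})
      (isClosed_eq (by fun_prop) (by fun_prop)) (fun y hy => h1 y hy) hy

theorem span_inner_mem (B : VonNeumannAlgebra G) [CompleteSpace H] {S : Set (G →L[ℂ] H)}
    (h : ∀ x ∈ S, ∀ y ∈ S, ContinuousLinearMap.adjoint x ∘L y ∈ B.toStarSubalgebra) :
    ∀ x ∈ Submodule.span ℂ S, ∀ y ∈ Submodule.span ℂ S,
      ContinuousLinearMap.adjoint x ∘L y ∈ B.toStarSubalgebra := by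
  intro x hx y hy
  induction hx, hy using Submodule.span_induction₂ with
  | mem_mem x y hx hy => exact h x hx y hy
  | zero_left => simp
  | zero_right => simp
  | add_left x y z _ _ _ h1 h2 =>
    rw [map_add, ContinuousLinearMap.add_comp]; exact add_mem h1 h2
  | add_right x y z _ _ _ h1 h2 =>
    rw [ContinuousLinearMap.comp_add]; exact add_mem h1 h2
  | smul_left r x y _ _ h =>
    rw [LinearIsometryEquiv.map_smulₛₗ, ContinuousLinearMap.smul_comp]
    exact SMulMemClass.smul_mem _ h
  | smul_right r x y _ _ h =>
    rw [ContinuousLinearMap.comp_smul]; exact SMulMemClass.smul_mem _ h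

end SOT

namespace VNBimodule
variable {B : VonNeumannAlgebra G}

section
variable (X : VNBimodule B) (K : NormalRep B)

theorem norm_tmul_le (x : X.E) (k : K.H) : ‖X.tmul K x k‖ ≤ ‖(x : G →L[ℂ] X.H)‖ * ‖k‖ := by
  refine le_of_sq_le_sq ?_ (by positivity)
  rw [← inner_self_eq_norm_sq (𝕜 := ℂ), inner_tmul]
  refine (RCLike.re_le_norm _).trans ((norm_inner_le_norm _ _).trans ?_)
  have h1 : ‖K.π (X.ip x x)‖ ≤ ‖(x : G →L[ℂ] X.H)‖ * ‖(x : G →L[ℂ] X.H)‖ := by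
    refine (norm_rep_le B K.π _).trans ?_
    rw [coe_ip]
    exact (ContinuousLinearMap.norm_adjoint_comp_self _).le
  calc ‖k‖ * ‖K.π (X.ip x x) k‖ ≤ ‖k‖ * (‖(x : G →L[ℂ] X.H)‖ * ‖(x : G →L[ℂ] X.H)‖ * ‖k‖) := by
        gcongr; exact ContinuousLinearMap.le_of_opNorm_le _ h1 _
    _ = _ := by ring

/-- The operator `k ↦ x ⊗ k`. -/
noncomputable def crea (x : X.E) : K.H →L[ℂ] (X.tens K).H :=
  LinearMap.mkContinuous (F := (X.tensKernel K).Space)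
    { toFun := fun k => X.tmul K x k
      map_add' := X.tmul_add_right K x
      map_smul' := fun z k => X.tmul_smul_right K z x k } ‖(x : G →L[ℂ] X.H)‖ (X.norm_tmul_le K x)

theorem crea_apply (x : X.E) (k : K.H) : X.crea K x k = X.tmul K x k := rfl

theorem inner_crea (x y : X.E) (k l : K.H) :
    ⟪X.crea K x k, X.crea K y l⟫_ℂ = ⟪k, K.π (X.ip x y) l⟫_ℂ := X.inner_tmul K x y k l

theorem tens_π_crea (b : B.toStarSubalgebra) (x : X.E) (k : K.H) :
    (X.tens K).π b (X.crea K x k) = X.crea K (X.lact b x) k := X.tensAct_tmul K b x k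

theorem dense_crea : DenseRange (Finsupp.linearCombination ℂ (fun p : X.E × K.H => X.crea K p.1 p.2)) :=
  X.dense_tmul K

theorem crea_ract (x : X.E) (b : B.toStarSubalgebra) (k : K.H) :
    X.crea K (X.ract x b) k = X.crea K x (K.π b k) := X.tmul_ract K x b k

theorem crea_total (M : Submodule ℂ (X.tens K).H) (hM : IsClosed (M : Set (X.tens K).H))
    (h : ∀ x k, X.crea K x k ∈ M) : M = ⊤ := by
  have hd := X.dense_crea K
  rw [eq_top_iff]
  intro v _
  refine hd.induction_on (p := fun v => v ∈ M) v hM fun c => ?_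
  rw [Finsupp.linearCombination_apply]
  exact Submodule.sum_mem _ fun i _ => M.smul_mem _ (h _ _)
end

/-- The algebraic span of the elementary tensors `x ⊙ y`, where `x ⊙ y` maps `g` to `x ⊗ y g`. -/
noncomputable def algTensor (X Y : VNBimodule B) : Submodule ℂ (G →L[ℂ] (X.tens Y.toNormalRep).H) :=
  Submodule.span ℂ {z | ∃ (x : X.E) (y : Y.E), z = X.crea Y.toNormalRep x ∘L (y : G →L[ℂ] Y.H)}

theorem algTensor_right (X Y : VNBimodule B) {p : G →L[ℂ] (X.tens Y.toNormalRep).H}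
    (hp : p ∈ X.algTensor Y) (b : B.toStarSubalgebra) : p ∘L (b : G →L[ℂ] G) ∈ X.algTensor Y := by
  unfold algTensor at hp ⊢
  induction hp using Submodule.span_induction with
  | mem p hp =>
    obtain ⟨x, y, rfl⟩ := hp
    exact Submodule.subset_span ⟨x, Y.ract y b, rfl⟩
  | zero => simp
  | add p q _ _ h1 h2 => rw [ContinuousLinearMap.add_comp]; exact add_mem h1 h2
  | smul c p _ h => rw [ContinuousLinearMap.smul_comp]; exact Submodule.smul_mem _ _ h

/-- The tensor product `X ⊙ Y` of von Neumann modules: the strong closure of the span of the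
elementary tensors, as operators from `G` to `X ⊙ (Y ⊙ G)`. -/
@[reducible] noncomputable def tensor (X Y : VNBimodule B) : VNBimodule B where
  toNormalRep := X.tens Y.toNormalRep
  E := sotClosure (X.algTensor Y)
  right_mem z hz b := by
    refine sotClosure_le_of_span (ContinuousLinearMap.id ℂ _) b ?_ hz
    rintro _ ⟨x, y, rfl⟩
    exact le_sotClosure _ (Submodule.subset_span ⟨x, Y.ract y b, rfl⟩)
  inner_mem z hz w hw := by
    refine sotClosure_inner_mem B ?_ hz hw
    refine span_inner_mem B ?_
    rintro _ ⟨x, y, rfl⟩ _ ⟨x', y', rfl⟩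
    have : ContinuousLinearMap.adjoint (X.crea Y.toNormalRep x ∘L (y : G →L[ℂ] Y.H)) ∘L
        X.crea Y.toNormalRep x' ∘L (y' : G →L[ℂ] Y.H) = Y.ip y (Y.lact (X.ip x x') y') := by
      refine ContinuousLinearMap.ext fun g => ext_inner_left ℂ fun g' => ?_
      rw [inner_ip, ContinuousLinearMap.comp_apply, ContinuousLinearMap.adjoint_inner_right,
        ContinuousLinearMap.comp_apply, ContinuousLinearMap.comp_apply, inner_crea]
      rfl
    rw [this]; exact Subtype.property _
  total := by
    refine X.crea_total Y.toNormalRep _ (Submodule.isClosed_topologicalClosure _) fun x k => ?_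
    have hk : k ∈ (Submodule.span ℂ {h : Y.H | ∃ y ∈ Y.E, ∃ g : G, h = y g}).topologicalClosure := by
      rw [Y.total]; trivial
    refine (Submodule.topologicalClosure_minimal _ (t := Submodule.comap
      (X.crea Y.toNormalRep x).toLinearMap (Submodule.topologicalClosure _)) ?_ ?_) hk
    · rw [Submodule.span_le]
      rintro _ ⟨y, hy, g, rfl⟩
      exact Submodule.le_topologicalClosure _ (Submodule.subset_span
        ⟨_, le_sotClosure _ (Submodule.subset_span ⟨x, ⟨y, hy⟩, rfl⟩), g, rfl⟩)
    · exact (Submodule.isClosed_topologicalClosure _).preimage (X.crea Y.toNormalRep x).continuous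
  left_mem b z hz := by
    refine sotClosure_le_of_span _ (ContinuousLinearMap.id ℂ _) ?_ hz
    rintro _ ⟨x, y, rfl⟩
    refine le_sotClosure _ (Submodule.subset_span ⟨X.lact b x, y, ?_⟩)
    ext g
    exact X.tens_π_crea _ b x _
  closed := sotClosure_sotClosure _

/-- The elementary tensor `x ⊙ y`. -/
noncomputable def elem (X Y : VNBimodule B) (x : X.E) (y : Y.E) : (X.tensor Y).E :=
  ⟨X.crea Y.toNormalRep x ∘L (y : G →L[ℂ] Y.H),
    le_sotClosure _ (Submodule.subset_span ⟨x, y, rfl⟩)⟩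

/-- The trivial bimodule `B`. -/
@[reducible] noncomputable def unit (B : VonNeumannAlgebra G) : VNBimodule B where
  H := G
  π := B.toStarSubalgebra.subtype
  normal := fun _ _ _ _ h => h
  E := Subalgebra.toSubmodule B.toStarSubalgebra.toSubalgebra
  right_mem x hx b := B.toStarSubalgebra.mul_mem hx b.2
  inner_mem x hx y hy := B.toStarSubalgebra.mul_mem (B.toStarSubalgebra.star_mem' hx) hy
  total := by
    rw [eq_top_iff]
    intro g _
    exact Submodule.le_topologicalClosure _ (Submodule.subset_span
      ⟨1, B.toStarSubalgebra.one_mem, g, rfl⟩)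
  left_mem b x hx := B.toStarSubalgebra.mul_mem b.2 hx
  closed x hx := by
    refine mem_of_commute B _ fun b hb => ContinuousLinearMap.ext fun g => ?_
    exact sotClosure_induction (C := {φ : G → G | b (φ g) = φ (b g)})
      (isClosed_eq (by fun_prop) (by fun_prop))
      (fun y hy => DFunLike.congr_fun (commute_of_mem B hy hb) g) hx

end VNBimodule

section
variable {ι H K : Type*} [NormedAddCommGroup H] [InnerProductSpace ℂ H]
    [NormedAddCommGroup K] [InnerProductSpace ℂ K] {e : ι → H} {f : ι → K}

theorem norm_linearCombination_eq (h : ∀ i j, ⟪f i, f j⟫_ℂ = ⟪e i, e j⟫_ℂ) (c : ι →₀ ℂ) :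
    ‖Finsupp.linearCombination ℂ f c‖ = ‖Finsupp.linearCombination ℂ e c‖ := by
  rw [← sq_eq_sq₀ (norm_nonneg _) (norm_nonneg _), norm_sq_linearCombination,
    norm_sq_linearCombination]
  simp only [h]

theorem extendMap_apply' [CompleteSpace K] (he : DenseRange (Finsupp.linearCombination ℂ e))
    (h : ∀ i j, ⟪f i, f j⟫_ℂ = ⟪e i, e j⟫_ℂ) (i : ι) : extendMap e f (e i) = f i :=
  extendMap_apply he (C := 1) (fun c => by rw [one_mul, norm_linearCombination_eq h]) i

theorem norm_map_of_inner (he : DenseRange (Finsupp.linearCombination ℂ e)) (T : H →L[ℂ] K)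
    (h : ∀ i j, ⟪T (e i), T (e j)⟫_ℂ = ⟪e i, e j⟫_ℂ) (v : H) : ‖T v‖ = ‖v‖ := by
  refine he.induction_on (p := fun v => ‖T v‖ = ‖v‖) v (isClosed_eq (by fun_prop) (by fun_prop)) fun c => ?_
  have := norm_linearCombination_eq (f := fun i => T (e i)) (e := e) h c
  rw [← this]
  simp [Finsupp.linearCombination_apply, Finsupp.sum, map_sum]

end


namespace VNBimodule
variable {B : VonNeumannAlgebra G}

/-- A bounded bilinear map `x ↦ op x` between von Neumann modules. It is recorded through the
operator `op` on the Hilbert spaces with which it acts (`T ⊙ id_G` for the module map `T`); it maps the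
modules into each other and intertwines the left actions. -/
structure Hom (X Y : VNBimodule B) where
  op : X.H →L[ℂ] Y.H
  mem : ∀ x ∈ X.E, op ∘L x ∈ Y.E
  comm : ∀ b h, op (X.π b h) = Y.π b (op h)

/-- The value of a bilinear map at an element of the module. -/
def Hom.app {X Y : VNBimodule B} (T : Hom X Y) (x : X.E) : Y.E :=
  ⟨T.op ∘L (x : G →L[ℂ] X.H), T.mem x x.2⟩

/-- The operator `x ⊗ k ↦ T x ⊗ S k`. -/
noncomputable def Hom.tensMap {X Y : VNBimodule B} (T : Hom X Y) {K L : NormalRep B}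
    (S : K.H →L[ℂ] L.H) : (X.tens K).H →L[ℂ] (Y.tens L).H :=
  extendMap (fun p : X.E × K.H => X.crea K p.1 p.2) (fun p => Y.crea L (T.app p.1) (S p.2))

theorem norm_right_le (X : VNBimodule B) {K L : NormalRep B} (S : K.H →L[ℂ] L.H)
    (hS : ∀ b k, S (K.π b k) = L.π b (S k)) (c : X.E × K.H →₀ ℂ) :
    ‖Finsupp.linearCombination ℂ (fun p : X.E × K.H => X.crea L p.1 (S p.2)) c‖ ≤
      ‖S‖ * ‖Finsupp.linearCombination ℂ (fun p : X.E × K.H => X.crea K p.1 p.2) c‖ := by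
  refine le_of_sq_le_sq ?_ (by positivity)
  rw [mul_pow, norm_sq_linearCombination, norm_sq_linearCombination]
  simp only [inner_crea]
  set A : K.H →L[ℂ] K.H := ((‖S‖ ^ 2 : ℝ) : ℂ) • 1 - ContinuousLinearMap.adjoint S ∘L S with hA
  have hApos : 0 ≤ A := by
    rw [ContinuousLinearMap.nonneg_iff_isPositive, ContinuousLinearMap.isPositive_def']
    constructor
    · rw [ContinuousLinearMap.isSelfAdjoint_iff', hA, map_sub, ContinuousLinearMap.adjoint_comp,
        ContinuousLinearMap.adjoint_adjoint, LinearIsometryEquiv.map_smulₛₗ, Complex.conj_ofReal]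
      congr 2
      exact ContinuousLinearMap.adjoint_id
    · intro v
      have h1 : ⟪v, A v⟫_ℂ = ((‖S‖ ^ 2 * ‖v‖ ^ 2 - ‖S v‖ ^ 2 : ℝ) : ℂ) := by
        have h2 : A v = ((‖S‖ ^ 2 : ℝ) : ℂ) • v - ContinuousLinearMap.adjoint S (S v) := rfl
        rw [h2, inner_sub_right, inner_smul_right, ContinuousLinearMap.adjoint_inner_right,
          inner_self_eq_norm_sq_to_K, inner_self_eq_norm_sq_to_K]
        push_cast; rfl
      have h5 : RCLike.re (((‖S‖ ^ 2 * ‖v‖ ^ 2 - ‖S v‖ ^ 2 : ℝ)) : ℂ) =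
        ‖S‖ ^ 2 * ‖v‖ ^ 2 - ‖S v‖ ^ 2 := Complex.ofReal_re _
      rw [ContinuousLinearMap.reApplyInnerSelf_apply, ← inner_re_symm, h1, h5, sub_nonneg, ← mul_pow]
      gcongr
      exact S.le_opNorm v
  have hcomm : ∀ b, Commute A (K.π b) := by
    intro b
    refine ContinuousLinearMap.ext fun v => ?_
    have h1 : ∀ v, ContinuousLinearMap.adjoint S (L.π b v) = K.π b (ContinuousLinearMap.adjoint S v) := by
      intro v
      refine ext_inner_left ℂ fun w => ?_
      have h3 : L.π b = ContinuousLinearMap.adjoint (L.π (star b)) := by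
        rw [map_star, ContinuousLinearMap.star_eq_adjoint, ContinuousLinearMap.adjoint_adjoint]
      have h4 : K.π b = ContinuousLinearMap.adjoint (K.π (star b)) := by
        rw [map_star, ContinuousLinearMap.star_eq_adjoint, ContinuousLinearMap.adjoint_adjoint]
      rw [ContinuousLinearMap.adjoint_inner_right, h3, h4, ContinuousLinearMap.adjoint_inner_right,
        ContinuousLinearMap.adjoint_inner_right, ContinuousLinearMap.adjoint_inner_right, hS]
    change ((‖S‖ ^ 2 : ℝ) : ℂ) • K.π b v - ContinuousLinearMap.adjoint S (S (K.π b v)) =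
      K.π b (((‖S‖ ^ 2 : ℝ) : ℂ) • v - ContinuousLinearMap.adjoint S (S v))
    rw [map_sub, map_smul, hS, h1]
  set R := CFC.sqrt A with hR
  have hRR : R * R = A := CFC.sqrt_mul_sqrt_self A hApos
  have hRa : ContinuousLinearMap.adjoint R = R := (CFC.sqrt_nonneg A).isSelfAdjoint.star_eq
  have hRc : ∀ b k, R (K.π b k) = K.π b (R k) := fun b k =>
    DFunLike.congr_fun ((hcomm b).cfcₙ_nnreal _ : Commute R (K.π b)) k
  have hin : ∀ (x y : X.E) (k l : K.H), ⟪R k, K.π (X.ip x y) (R l)⟫_ℂ =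
      ((‖S‖ ^ 2 : ℝ) : ℂ) * ⟪k, K.π (X.ip x y) l⟫_ℂ - ⟪S k, L.π (X.ip x y) (S l)⟫_ℂ := by
    intro x y k l
    rw [← hRc, ← hRa, ContinuousLinearMap.adjoint_inner_left, hRa]
    have : R (R (K.π (X.ip x y) l)) = A (K.π (X.ip x y) l) := DFunLike.congr_fun hRR _
    rw [this]
    change ⟪k, ((‖S‖ ^ 2 : ℝ) : ℂ) • K.π (X.ip x y) l -
      ContinuousLinearMap.adjoint S (S (K.π (X.ip x y) l))⟫_ℂ = _
    rw [inner_sub_right, inner_smul_right, ContinuousLinearMap.adjoint_inner_right, hS]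
  have key : 0 ≤ (∑ i ∈ c.support, ∑ j ∈ c.support,
      star (c i) * c j * ⟪R i.2, K.π (X.ip i.1 j.1) (R j.2)⟫_ℂ).re := by
    have := norm_sq_linearCombination (fun p : X.E × K.H => X.crea K p.1 (R p.2)) c
    simp only [inner_crea] at this
    rw [← this]; positivity
  rw [← sub_nonneg, ← Complex.re_ofReal_mul, ← Complex.sub_re]
  refine key.trans_eq (congrArg Complex.re ?_)
  simp only [hin, Finset.mul_sum, ← Finset.sum_sub_distrib]
  refine Finset.sum_congr rfl fun i _ => ?_
  refine Finset.sum_congr rfl fun j _ => ?_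
  ring

theorem Hom.tensMap_crea {X Y : VNBimodule B} (T : Hom X Y) {K L : NormalRep B}
    (S : K.H →L[ℂ] L.H) (hS : ∀ b k, S (K.π b k) = L.π b (S k)) (x : X.E) (k : K.H) :
    T.tensMap S (X.crea K x k) = Y.crea L (T.app x) (S k) := by
  refine extendMap_apply (e := fun p : X.E × K.H => X.crea K p.1 p.2)
    (f := fun p => Y.crea L (T.app p.1) (S p.2)) (X.dense_crea K) (C := ‖T.op‖ * ‖S‖) (fun c => ?_) (x, k)
  have h1 := X.norm_right_le S hS c
  have h2 := norm_left_le X Y L T.app T.op (fun _ => rfl) (c.mapDomain fun p => (p.1, S p.2))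
  rw [Finsupp.linearCombination_mapDomain, Finsupp.linearCombination_mapDomain] at h2
  calc _ ≤ ‖T.op‖ * _ := h2
    _ ≤ ‖T.op‖ * (‖S‖ * _) := by gcongr; exact h1
    _ = _ := (mul_assoc _ _ _).symm

theorem Hom.tensMap_comm {X Y : VNBimodule B} (T : Hom X Y) {K L : NormalRep B}
    (S : K.H →L[ℂ] L.H) (hS : ∀ b k, S (K.π b k) = L.π b (S k)) (b : B.toStarSubalgebra)
    (v : (X.tens K).H) : T.tensMap S ((X.tens K).π b v) = (Y.tens L).π b (T.tensMap S v) := by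
  have : T.tensMap S ∘L (X.tens K).π b = (Y.tens L).π b ∘L T.tensMap S := by
    refine clm_ext_of_denseRange (X.dense_crea K) fun p => ?_
    rw [ContinuousLinearMap.comp_apply, ContinuousLinearMap.comp_apply, tens_π_crea,
      T.tensMap_crea S hS, T.tensMap_crea S hS, tens_π_crea]
    congr 1
    exact congrArg _ (ext_apply fun g => T.comm b _)
  exact DFunLike.congr_fun this v

theorem Hom.tensMap_norm {X Y : VNBimodule B} (T : Hom X Y) {K L : NormalRep B}
    (S : K.H →L[ℂ] L.H) (hS : ∀ b k, S (K.π b k) = L.π b (S k)) (hT : ∀ v, ‖T.op v‖ = ‖v‖)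
    (hS' : ∀ v, ‖S v‖ = ‖v‖) (v : (X.tens K).H) : ‖T.tensMap S v‖ = ‖v‖ := by
  refine norm_map_of_inner (X.dense_crea K) _ (fun i j => ?_) v
  have hTi := (ContinuousLinearMap.inner_map_map_iff_adjoint_comp_self T.op).2
    ((ContinuousLinearMap.norm_map_iff_adjoint_comp_self T.op).1 hT)
  have hSi := (ContinuousLinearMap.inner_map_map_iff_adjoint_comp_self S).2
    ((ContinuousLinearMap.norm_map_iff_adjoint_comp_self S).1 hS')
  have hip : Y.ip (T.app i.1) (T.app j.1) = X.ip i.1 j.1 := by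
    apply Subtype.ext
    refine ContinuousLinearMap.ext fun g => ext_inner_left ℂ fun g' => ?_
    rw [inner_ip, inner_ip]
    exact hTi _ _
  rw [T.tensMap_crea S hS, T.tensMap_crea S hS, inner_crea, inner_crea, hip, ← hS, hSi]

/-- The identification `(X ⊙ Y) ⊙ K = X ⊙ (Y ⊙ K)`, given by `(x ⊙ y) ⊗ k ↦ x ⊗ (y ⊗ k)`. -/
noncomputable def assoc (X Y : VNBimodule B) (K : NormalRep B) :
    ((X.tensor Y).tens K).H →L[ℂ] (X.tens (Y.tens K)).H :=
  extendMap (fun p : X.E × Y.E × K.H => (X.tensor Y).crea K (X.elem Y p.1 p.2.1) p.2.2)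
    (fun p => X.crea (Y.tens K) p.1 (Y.crea K p.2.1 p.2.2))

theorem ip_elem (X Y : VNBimodule B) (x x' : X.E) (y y' : Y.E) :
    (X.tensor Y).ip (X.elem Y x y) (X.elem Y x' y') = Y.ip y (Y.lact (X.ip x x') y') := by
  apply Subtype.ext
  refine ContinuousLinearMap.ext fun g => ext_inner_left ℂ fun g' => ?_
  rw [inner_ip, inner_ip]
  exact X.inner_crea _ x x' _ _

theorem inner_assoc (X Y : VNBimodule B) (K : NormalRep B) (p q : X.E × Y.E × K.H) :
    ⟪X.crea (Y.tens K) p.1 (Y.crea K p.2.1 p.2.2), X.crea (Y.tens K) q.1 (Y.crea K q.2.1 q.2.2)⟫_ℂ =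
    ⟪(X.tensor Y).crea K (X.elem Y p.1 p.2.1) p.2.2, (X.tensor Y).crea K (X.elem Y q.1 q.2.1) q.2.2⟫_ℂ := by
  rw [inner_crea, inner_crea, tens_π_crea, inner_crea, ip_elem]

theorem norm_sub_sq_le {H K : Type*} [NormedAddCommGroup H] [InnerProductSpace ℂ H] [CompleteSpace H]
    [NormedAddCommGroup K] [InnerProductSpace ℂ K] [CompleteSpace K] (A : H →L[ℂ] K) {M : ℝ}
    (hM : 0 < M) (hA : ‖A‖ ^ 2 ≤ M) (v : H) :
    ‖v - ((M⁻¹ : ℝ) : ℂ) • ContinuousLinearMap.adjoint A (A v)‖ ^ 2 ≤ ‖v‖ ^ 2 - M⁻¹ * ‖A v‖ ^ 2 := by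
  rw [@norm_sub_sq ℂ, inner_smul_right, ContinuousLinearMap.adjoint_inner_right,
    inner_self_eq_norm_sq_to_K, norm_smul, Complex.norm_real, Real.norm_of_nonneg (by positivity)]
  have h1 : ‖ContinuousLinearMap.adjoint A (A v)‖ ^ 2 ≤ M * ‖A v‖ ^ 2 := by
    calc _ ≤ (‖A‖ * ‖A v‖) ^ 2 := by
          gcongr
          rw [← LinearIsometryEquiv.norm_map ContinuousLinearMap.adjoint A]
          exact ContinuousLinearMap.le_opNorm _ _
      _ = ‖A‖ ^ 2 * ‖A v‖ ^ 2 := mul_pow _ _ _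
      _ ≤ _ := by gcongr
  have h2 : RCLike.re (((M⁻¹ : ℝ) : ℂ) * ((‖A v‖ : ℝ) : ℂ) ^ 2) = M⁻¹ * ‖A v‖ ^ 2 := by
    rw [← Complex.ofReal_pow, ← Complex.ofReal_mul]; exact Complex.ofReal_re _
  have h3 : (M⁻¹ * ‖ContinuousLinearMap.adjoint A (A v)‖) ^ 2 ≤ M⁻¹ * ‖A v‖ ^ 2 := by
    rw [mul_pow]
    calc _ ≤ M⁻¹ ^ 2 * (M * ‖A v‖ ^ 2) := by gcongr
      _ = _ := by field_simp
  erw [h2]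
  linarith

/-- One step of the approximation of the identity on a right-invariant subspace `P0`. -/
theorem approx_step (P : VNBimodule B) (P0 : Submodule ℂ (G →L[ℂ] P.H)) (hP0 : P0 ≤ P.E)
    (hr : ∀ p ∈ P0, ∀ b : B.toStarSubalgebra, p ∘L (b : G →L[ℂ] G) ∈ P0)
    (x : G →L[ℂ] P.H) (hx : x ∈ P0) :
    ∃ d : P.H →L[ℂ] P.H, ‖d‖ ≤ 1 ∧ (∀ z ∈ P.E, z - d ∘L z ∈ P0) ∧ ‖d ∘L x‖ ^ 2 ≤ ‖x‖ ^ 2 / 2 := by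
  by_cases hx0 : x = 0
  · exact ⟨1, ContinuousLinearMap.norm_id_le, fun z _ => by
      have : z - (1 : P.H →L[ℂ] P.H) ∘L z = 0 := by ext; simp
      rw [this]; exact zero_mem _, by simp [hx0]⟩
  have hn : 0 < ‖x‖ := norm_pos_iff.2 hx0
  set M := ‖x‖ ^ 2 with hM
  have hMpos : 0 < M := by positivity
  set xs := ContinuousLinearMap.adjoint x with hxs
  have hx1 := norm_sub_sq_le x hMpos hM.ge
  have hx2 : ∀ ξ, ‖ξ - ((M⁻¹ : ℝ) : ℂ) • x (xs ξ)‖ ^ 2 ≤ ‖ξ‖ ^ 2 - M⁻¹ * ‖xs ξ‖ ^ 2 := by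
    have := norm_sub_sq_le xs hMpos (by rw [hxs, LinearIsometryEquiv.norm_map])
    rwa [hxs, ContinuousLinearMap.adjoint_adjoint, ← hxs] at this
  refine ⟨1 - ((M⁻¹ : ℝ) : ℂ) • (x ∘L xs), ?_, ?_, ?_⟩
  · refine ContinuousLinearMap.opNorm_le_bound _ zero_le_one fun ξ => ?_
    rw [one_mul]
    refine le_of_sq_le_sq ((hx2 ξ).trans ?_) (norm_nonneg _)
    have : 0 ≤ M⁻¹ * ‖xs ξ‖ ^ 2 := by positivity
    linarith
  · intro z hz
    have : z - (1 - ((M⁻¹ : ℝ) : ℂ) • (x ∘L xs)) ∘L z =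
        ((M⁻¹ : ℝ) : ℂ) • (x ∘L (xs ∘L z)) := by ext g; simp
    rw [this]
    exact P0.smul_mem _ (hr x hx ⟨_, P.inner_mem x (hP0 hx) z hz⟩)
  · suffices h0 : ‖(1 - ((M⁻¹ : ℝ) : ℂ) • (x ∘L xs)) ∘L x‖ ≤ √(M / 2) by
      calc _ ≤ √(M / 2) ^ 2 := by gcongr
        _ = _ := Real.sq_sqrt (by positivity)
    refine ContinuousLinearMap.opNorm_le_bound _ (Real.sqrt_nonneg _) fun g => ?_
    refine le_of_sq_le_sq ?_ (by positivity)
    rw [mul_pow, Real.sq_sqrt (by positivity)]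
    set h := g - ((M⁻¹ : ℝ) : ℂ) • xs (x g) with hh
    have e1 : ((1 - ((M⁻¹ : ℝ) : ℂ) • (x ∘L xs)) ∘L x) g = x h := by
      rw [hh, map_sub, map_smul]; rfl
    rw [e1]
    have h2 : ‖x h‖ ^ 2 ≤ M * ‖h‖ ^ 2 := by
      rw [hM, ← mul_pow]; gcongr; exact x.le_opNorm _
    have h3 : ‖h‖ ^ 2 ≤ ‖g‖ ^ 2 - M⁻¹ * ‖x g‖ ^ 2 := hx1 g
    have h4 : ‖x h‖ ^ 2 ≤ ‖x g‖ ^ 2 := by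
      have := hx2 (x g)
      rw [hh, map_sub, map_smul]
      have h5 : 0 ≤ M⁻¹ * ‖xs (x g)‖ ^ 2 := by positivity
      linarith
    have h5 : M * ‖h‖ ^ 2 ≤ M * ‖g‖ ^ 2 - ‖x g‖ ^ 2 := by
      calc M * ‖h‖ ^ 2 ≤ M * (‖g‖ ^ 2 - M⁻¹ * ‖x g‖ ^ 2) := by gcongr
        _ = _ := by field_simp
    linarith

end VNBimodule


namespace VNBimodule
variable {B : VonNeumannAlgebra G}

/-- `P0` is a right-invariant subspace of the module `P` with total range. -/
structure IsCore (P : VNBimodule B) (P0 : Submodule ℂ (G →L[ℂ] P.H)) : Prop where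
  le : P0 ≤ P.E
  right : ∀ p ∈ P0, ∀ b : B.toStarSubalgebra, p ∘L (b : G →L[ℂ] G) ∈ P0
  total : (Submodule.span ℂ {h : P.H | ∃ x ∈ P0, ∃ g : G, h = x g}).topologicalClosure = ⊤

section
variable (P : VNBimodule B) (P0 : Submodule ℂ (G →L[ℂ] P.H))

/-- The contractions that differ from the identity by an operator mapping `P` into `P0`. -/
def cutoff : Set (P.H →L[ℂ] P.H) := {d | ‖d‖ ≤ 1 ∧ ∀ z ∈ P.E, z - d ∘L z ∈ P0}

theorem cutoff_mul (hc : P.IsCore P0) {d e : P.H →L[ℂ] P.H} (hd : d ∈ P.cutoff P0) (he : e ∈ P.cutoff P0) :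
    d ∘L e ∈ P.cutoff P0 := by
  refine ⟨(ContinuousLinearMap.opNorm_comp_le _ _).trans (mul_le_one₀ hd.1 (norm_nonneg _) he.1),
    fun z hz => ?_⟩
  have h1 : e ∘L z ∈ P.E := by
    have := P.E.sub_mem hz (hc.le (he.2 z hz)); rwa [sub_sub_cancel] at this
  have h2 := add_mem (he.2 z hz) (hd.2 _ h1)
  rwa [sub_add_sub_cancel] at h2

theorem one_mem_cutoff : 1 ∈ P.cutoff P0 := ⟨ContinuousLinearMap.norm_id_le, fun z _ => by
  have : z - (1 : P.H →L[ℂ] P.H) ∘L z = 0 := by ext; simp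
  rw [this]; exact zero_mem _⟩

theorem cutoff_pow (hc : P.IsCore P0) (x : G →L[ℂ] P.H) (hx : x ∈ P0) (n : ℕ) :
    ∃ d ∈ P.cutoff P0, ‖d ∘L x‖ ^ 2 ≤ ‖x‖ ^ 2 * (1 / 2) ^ n := by
  induction n with
  | zero => exact ⟨1, P.one_mem_cutoff P0, by
      have : (1 : P.H →L[ℂ] P.H) ∘L x = x := by ext; simp
      rw [this]; simp⟩
  | succ n ih =>
    obtain ⟨d, hd, h⟩ := ih
    have hdx : d ∘L x ∈ P0 := by
      have := P0.sub_mem hx (hd.2 x (hc.le hx)); rwa [sub_sub_cancel] at this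
    obtain ⟨e, he1, he2, he3⟩ := approx_step P P0 hc.le hc.right _ hdx
    refine ⟨e ∘L d, P.cutoff_mul P0 hc ⟨he1, he2⟩ hd, ?_⟩
    rw [ContinuousLinearMap.comp_assoc]
    calc _ ≤ _ := he3
      _ ≤ ‖x‖ ^ 2 * (1 / 2) ^ n / 2 := by gcongr
      _ = _ := by ring

theorem norm_apply_le_of_cutoff {d : P.H →L[ℂ] P.H} (hd : d ∈ P.cutoff P0) (v : P.H) : ‖d v‖ ≤ ‖v‖ := by
  have := d.le_of_opNorm_le hd.1 v; rwa [one_mul] at this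

theorem cutoff_small (hc : P.IsCore P0) (v : P.H) (d₀ : P.H →L[ℂ] P.H) (hd₀ : d₀ ∈ P.cutoff P0) (ε : ℝ) (hε : 0 < ε) :
    ∃ d ∈ P.cutoff P0, ‖d (d₀ v)‖ < ε := by
  have hv : v ∈ (Submodule.span ℂ {h : P.H | ∃ x ∈ P0, ∃ g : G, h = x g}).topologicalClosure := by
    rw [hc.total]; trivial
  obtain ⟨w, hw, hvw⟩ := Metric.mem_closure_iff.1 hv (ε / 2) (by positivity)
  suffices h : ∀ d₀ ∈ P.cutoff P0, ∀ ε > 0, ∃ d ∈ P.cutoff P0, ‖d (d₀ w)‖ < ε by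
    obtain ⟨d, hd, h⟩ := h d₀ hd₀ (ε / 2) (by positivity)
    refine ⟨d, hd, ?_⟩
    have h1 := P.norm_apply_le_of_cutoff P0 (P.cutoff_mul P0 hc hd hd₀) (v - w)
    rw [dist_eq_norm] at hvw
    have h2 := norm_add_le ((d ∘L d₀) (v - w)) ((d ∘L d₀) w)
    rw [← map_add, sub_add_cancel] at h2
    have h3 : ‖(d ∘L d₀) w‖ < ε / 2 := h
    exact h2.trans_lt (by linarith)
  clear hvw hd₀ d₀ ε hε
  induction hw using Submodule.span_induction with
  | mem w hw =>
    obtain ⟨x, hx, g, rfl⟩ := hw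
    intro d₀ hd₀ ε hε
    have hx' : d₀ ∘L x ∈ P0 := by
      have := P0.sub_mem hx (hd₀.2 x (hc.le hx)); rwa [sub_sub_cancel] at this
    have hlim : Tendsto (fun n : ℕ => ‖d₀ ∘L x‖ ^ 2 * (1 / 2 : ℝ) ^ n * ‖g‖ ^ 2) atTop (𝓝 0) := by
      have := ((tendsto_pow_atTop_nhds_zero_of_lt_one (r := (1 / 2 : ℝ)) (by norm_num)
        (by norm_num)).const_mul (‖d₀ ∘L x‖ ^ 2)).mul_const (‖g‖ ^ 2)
      simpa using this
    obtain ⟨n, hn⟩ := (hlim.eventually (gt_mem_nhds (show 0 < ε ^ 2 by positivity))).exists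
    obtain ⟨d, hd, h⟩ := P.cutoff_pow P0 hc _ hx' n
    refine ⟨d, hd, lt_of_pow_lt_pow_left₀ 2 hε.le (lt_of_le_of_lt ?_ hn)⟩
    calc ‖(d ∘L d₀ ∘L x) g‖ ^ 2 ≤ (‖d ∘L d₀ ∘L x‖ * ‖g‖) ^ 2 := by
          gcongr; exact (d ∘L d₀ ∘L x).le_opNorm g
      _ = ‖d ∘L d₀ ∘L x‖ ^ 2 * ‖g‖ ^ 2 := mul_pow _ _ _
      _ ≤ _ := by gcongr
  | zero => intro d₀ _ ε hε; exact ⟨1, P.one_mem_cutoff P0, by simpa using hε⟩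
  | add a b _ _ ha hb =>
    intro d₀ hd₀ ε hε
    obtain ⟨d, hd, h⟩ := ha d₀ hd₀ (ε / 2) (by positivity)
    obtain ⟨e, he, h'⟩ := hb (d ∘L d₀) (P.cutoff_mul P0 hc hd hd₀) (ε / 2) (by positivity)
    refine ⟨e ∘L d, P.cutoff_mul P0 hc he hd, ?_⟩
    have h1 := P.norm_apply_le_of_cutoff P0 he (d (d₀ a))
    rw [map_add, map_add]
    refine (norm_add_le _ _).trans_lt ?_
    change ‖e (d (d₀ a))‖ + ‖e (d (d₀ b))‖ < ε
    change ‖e (d (d₀ b))‖ < ε / 2 at h'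
    linarith
  | smul c a _ ha =>
    intro d₀ hd₀ ε hε
    obtain ⟨d, hd, h⟩ := ha d₀ hd₀ (ε / (‖c‖ + 1)) (by positivity)
    refine ⟨d, hd, ?_⟩
    rw [map_smul, map_smul, norm_smul]
    rw [lt_div_iff₀ (by positivity)] at h
    nlinarith [norm_nonneg (d (d₀ a)), norm_nonneg c]

theorem cutoff_small_finite (hc : P.IsCore P0) {I : Set P.H} (hI : I.Finite) (ε : ℝ) (hε : 0 < ε) :
    ∃ d ∈ P.cutoff P0, ∀ v ∈ I, ‖d v‖ < ε := by
  induction I, hI using Set.Finite.induction_on with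
  | empty => exact ⟨1, P.one_mem_cutoff P0, by simp⟩
  | @insert v I _ _ ih =>
    obtain ⟨d, hd, h⟩ := ih
    obtain ⟨e, he, h'⟩ := P.cutoff_small P0 hc v d hd ε hε
    refine ⟨e ∘L d, P.cutoff_mul P0 hc he hd, ?_⟩
    rintro w (rfl | hw)
    · exact h'
    · exact (P.norm_apply_le_of_cutoff P0 he _).trans_lt (h w hw)

theorem zero_mem_closure_cutoff (hc : P.IsCore P0) : (0 : P.H → P.H) ∈
    closure ((fun (d : P.H →L[ℂ] P.H) (v : P.H) => d v) '' P.cutoff P0) := by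
  refine mem_closure_iff_nhds.2 fun s hs => ?_
  rw [nhds_pi, Filter.mem_pi] at hs
  obtain ⟨I, hI, t, ht', hts⟩ := hs
  have h1 : ∀ i, ∃ ε > 0, Metric.ball (0 : P.H) ε ⊆ t i := fun i => Metric.mem_nhds_iff.1 (ht' i)
  choose ε hε hεt using h1
  obtain ⟨δ, hδ, hδI⟩ : ∃ δ > 0, ∀ i ∈ I, δ ≤ ε i := by
    clear hts
    induction I, hI using Set.Finite.induction_on with
    | empty => exact ⟨1, one_pos, by simp⟩
    | @insert v I _ _ ih =>
      obtain ⟨δ, hδ, h⟩ := ih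
      refine ⟨min δ (ε v), lt_min hδ (hε v), ?_⟩
      rintro w (rfl | hw)
      · exact min_le_right _ _
      · exact (min_le_left _ _).trans (h w hw)
  obtain ⟨d, hd, h⟩ := P.cutoff_small_finite P0 hc hI δ hδ
  refine ⟨_, hts fun i hi => hεt i ?_, d, hd, rfl⟩
  rw [mem_ball_zero_iff]
  exact (h i hi).trans_le (hδI i hi)

/-- A right-invariant subspace `P0` of `P` with total range is dense in `P`, even after tensoring
with an arbitrary normal representation. -/
theorem crea_induction (hc : P.IsCore P0) (K : NormalRep B) {C : Set (K.H → (P.tens K).H)} (hC : IsClosed C)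
    (hp : ∀ p : P.E, (p : G →L[ℂ] P.H) ∈ P0 → (fun k => P.crea K p k) ∈ C) (z : P.E) :
    (fun k => P.crea K z k) ∈ C := by
  have hne := mem_closure_iff_comap_neBot.1 (P.zero_mem_closure_cutoff P0 hc)
  set S := (fun (d : P.H →L[ℂ] P.H) (v : P.H) => d v) '' P.cutoff P0
  set l : Filter S := comap (↑) (𝓝 (0 : P.H → P.H)) with hl
  have hlim : ∀ v, Tendsto (fun s : S => (s : P.H → P.H) v) l (𝓝 0) := fun v =>
    (tendsto_pi_nhds.1 (tendsto_comap (f := ((↑) : S → (P.H → P.H))))) v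
  choose d hd hds using fun s : S => s.2
  have hlim' : ∀ v, Tendsto (fun s : S => d s v) l (𝓝 0) := fun v =>
    (hlim v).congr fun s => (congrFun (hds s) v).symm
  have hmem : ∀ s, d s ∘L (z : G →L[ℂ] P.H) ∈ P.E := fun s => by
    have := P.E.sub_mem z.2 (hc.le ((hd s).2 z z.2)); rwa [sub_sub_cancel] at this
  let y : S → P.E := fun s => ⟨_, hmem s⟩
  have hyn : ∀ s, ‖(y s : G →L[ℂ] P.H)‖ ≤ ‖(z : G →L[ℂ] P.H)‖ := fun s =>
    ContinuousLinearMap.opNorm_le_bound _ (norm_nonneg _) fun g =>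
      (P.norm_apply_le_of_cutoff P0 (hd s) _).trans ((z : G →L[ℂ] P.H).le_opNorm g)
  have key : ∀ k, Tendsto (fun s => P.crea K (y s) k) l (𝓝 0) := by
    intro k
    have h2 := K.normal (l.map fun s => P.ip (y s) (y s)) 0
      (‖(z : G →L[ℂ] P.H)‖ * ‖(z : G →L[ℂ] P.H)‖) ?_ ?_ k k
    · rw [tendsto_map'_iff] at h2
      have h3 : Tendsto (fun s => ‖P.crea K (y s) k‖ ^ 2) l (𝓝 0) := by
        have h4 := (Complex.continuous_re.tendsto _).comp h2
        rw [map_zero, zero_apply, inner_zero_right] at h4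
        refine h4.congr fun s => ?_
        rw [← inner_self_eq_norm_sq (𝕜 := ℂ), inner_crea]; rfl
      rw [tendsto_zero_iff_norm_tendsto_zero]
      have h5 := (Real.continuous_sqrt.tendsto _).comp h3
      rw [Real.sqrt_zero] at h5
      exact h5.congr fun s => Real.sqrt_sq (norm_nonneg _)
    · rw [eventually_map]
      refine Eventually.of_forall fun s => ?_
      rw [coe_ip]
      refine (ContinuousLinearMap.opNorm_comp_le _ _).trans ?_
      rw [LinearIsometryEquiv.norm_map]
      gcongr <;> exact hyn s
    · intro g h
      rw [tendsto_map'_iff]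
      have h3 := (hlim' ((z : G →L[ℂ] P.H) g)).inner (𝕜 := ℂ) (hlim' ((z : G →L[ℂ] P.H) h))
      rw [inner_zero_left] at h3
      rw [show ((0 : B.toStarSubalgebra) : G →L[ℂ] G) h = 0 from rfl, inner_zero_right]
      refine h3.congr fun s => ?_
      exact (inner_ip P (y s) (y s) g h).symm
  have key' : Tendsto (fun s k => P.crea K (z - y s) k) l (𝓝 fun k => P.crea K z k) := by
    rw [tendsto_pi_nhds]
    intro k
    have : Tendsto (fun s => P.crea K z k - P.crea K (y s) k) l (𝓝 (P.crea K z k - 0)) :=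
      tendsto_const_nhds.sub (key k)
    rw [sub_zero] at this
    refine this.congr fun s => ?_
    refine sub_eq_of_eq_add ?_
    have h6 := P.tmul_add_left K (z - y s) (y s) k
    rw [sub_add_cancel] at h6
    exact h6
  exact hC.mem_of_tendsto key' (Eventually.of_forall fun s => hp _ ((hd s).2 z z.2))
end

section
variable (X Y : VNBimodule B)

theorem crea_elem_induction (K : NormalRep B) (C : Submodule ℂ (K.H → ((X.tensor Y).tens K).H))
    (hC : IsClosed (C : Set (K.H → ((X.tensor Y).tens K).H)))
    (h : ∀ x y, (fun k => (X.tensor Y).crea K (X.elem Y x y) k) ∈ C) (z : (X.tensor Y).E) :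
    (fun k => (X.tensor Y).crea K z k) ∈ C := by
  refine crea_induction (X.tensor Y) (X.algTensor Y) ⟨le_sotClosure _,
    fun p hp b => X.algTensor_right Y hp b, ?_⟩ K hC ?_ z
  · rw [eq_top_iff, ← (X.tensor Y).total]
    refine Submodule.topologicalClosure_minimal _ (Submodule.span_le.2 ?_)
      (Submodule.isClosed_topologicalClosure _)
    rintro _ ⟨z, hz, g, rfl⟩
    have := sotClosure_induction (C := {φ : G → (X.tensor Y).H | φ g ∈ (Submodule.span ℂ
      {h | ∃ x ∈ X.algTensor Y, ∃ g : G, h = x g}).topologicalClosure})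
      ((Submodule.isClosed_topologicalClosure _).preimage (continuous_apply g))
      (fun y hy => Submodule.le_topologicalClosure _ (Submodule.subset_span ⟨y, hy, g, rfl⟩)) hz
    exact this
  · rintro ⟨p, hp'⟩ hp
    change p ∈ X.algTensor Y at hp
    unfold algTensor at hp
    induction hp using Submodule.span_induction with
    | mem p hp =>
      obtain ⟨x, y, rfl⟩ := hp
      exact h x y
    | zero =>
      have : (fun k => (X.tensor Y).crea K ⟨0, hp'⟩ k) = 0 := by
        ext1 k
        have := (X.tensor Y).tmul_smul_left K 0 0 k
        rw [zero_smul, zero_smul] at this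
        exact this
      exact this ▸ zero_mem _
    | add p q h1' h2' h1 h2 =>
      have : (fun k => (X.tensor Y).crea K ⟨p + q, hp'⟩ k) =
          (fun k => (X.tensor Y).crea K ⟨p, le_sotClosure _ h1'⟩ k) +
          (fun k => (X.tensor Y).crea K ⟨q, le_sotClosure _ h2'⟩ k) := by
        ext1 k
        exact (X.tensor Y).tmul_add_left K ⟨p, le_sotClosure _ h1'⟩ ⟨q, le_sotClosure _ h2'⟩ k
      exact this ▸ add_mem (h1 _) (h2 _)
    | smul c p h1' h1 =>
      have : (fun k => (X.tensor Y).crea K ⟨c • p, hp'⟩ k) =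
          c • (fun k => (X.tensor Y).crea K ⟨p, le_sotClosure _ h1'⟩ k) := by
        ext1 k
        exact (X.tensor Y).tmul_smul_left K c ⟨p, le_sotClosure _ h1'⟩ k
      exact this ▸ Submodule.smul_mem _ _ (h1 _)

/-- The operators of the form `(x ⊙ y) ⊗ k` are total. -/
theorem dense_elem (K : NormalRep B) : DenseRange (Finsupp.linearCombination ℂ
    (fun p : X.E × Y.E × K.H => (X.tensor Y).crea K (X.elem Y p.1 p.2.1) p.2.2)) := by
  set e := (fun p : X.E × Y.E × K.H => (X.tensor Y).crea K (X.elem Y p.1 p.2.1) p.2.2)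
  have : (Submodule.span ℂ (Set.range e)).topologicalClosure = ⊤ := by
    refine crea_total _ K _ (Submodule.isClosed_topologicalClosure _) fun z k => ?_
    exact X.crea_elem_induction Y K (Submodule.comap (LinearMap.proj k)
        (Submodule.span ℂ (Set.range e)).topologicalClosure)
      ((Submodule.isClosed_topologicalClosure _).preimage (continuous_apply k))
      (fun x y => Submodule.le_topologicalClosure _ (Submodule.subset_span ⟨(x, y, k), rfl⟩)) z
  rw [DenseRange, ← LinearMap.coe_range, Finsupp.range_linearCombination,
    Submodule.dense_iff_topologicalClosure_eq_top]
  exact this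

theorem assoc_elem (K : NormalRep B) (x : X.E) (y : Y.E) (k : K.H) :
    assoc X Y K ((X.tensor Y).crea K (X.elem Y x y) k) = X.crea (Y.tens K) x (Y.crea K y k) :=
  extendMap_apply' (e := fun p : X.E × Y.E × K.H =>
      (X.tensor Y).crea K (X.elem Y p.1 p.2.1) p.2.2)
    (X.dense_elem Y K) (inner_assoc X Y K) (x, y, k)

theorem assoc_norm (K : NormalRep B) (v : ((X.tensor Y).tens K).H) : ‖assoc X Y K v‖ = ‖v‖ := by
  refine norm_map_of_inner (X.dense_elem Y K) _ (fun p q => ?_) v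
  rw [assoc_elem, assoc_elem]
  exact inner_assoc X Y K p q

theorem assoc_comm (K : NormalRep B) (b : B.toStarSubalgebra) (v : ((X.tensor Y).tens K).H) :
    assoc X Y K (((X.tensor Y).tens K).π b v) = (X.tens (Y.tens K)).π b (assoc X Y K v) := by
  have : assoc X Y K ∘L ((X.tensor Y).tens K).π b = (X.tens (Y.tens K)).π b ∘L assoc X Y K := by
    refine clm_ext_of_denseRange (X.dense_elem Y K) fun p => ?_
    rw [ContinuousLinearMap.comp_apply, ContinuousLinearMap.comp_apply, assoc_elem, tens_π_crea,
      tens_π_crea, ← assoc_elem]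
    congr 2
    refine congrArg _ ?_
    exact ext_apply (X := X.tensor Y) (x := (X.tensor Y).lact b (X.elem Y p.1 p.2.1))
      (y := X.elem Y (X.lact b p.1) p.2.1) fun g => X.tens_π_crea _ b _ _
  exact DFunLike.congr_fun this v

theorem assoc_mem (Z : VNBimodule B) (z : G →L[ℂ] ((X.tensor Y).tensor Z).H)
    (hz : z ∈ ((X.tensor Y).tensor Z).E) :
    assoc X Y Z.toNormalRep ∘L z ∈ (X.tensor (Y.tensor Z)).E := by
  refine sotClosure_le_of_span (E' := X.algTensor (Y.tensor Z)) (assoc X Y Z.toNormalRep)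
    (ContinuousLinearMap.id ℂ G) ?_ hz
  rintro _ ⟨p, w, rfl⟩
  let L : (Z.H → ((X.tensor Y).tens Z.toNormalRep).H) →ₗ[ℂ] (G → (X.tensor (Y.tensor Z)).H) :=
    { toFun := fun φ g => assoc X Y Z.toNormalRep (φ ((w : G →L[ℂ] Z.H) g))
      map_add' := fun φ ψ => by ext1 g; exact map_add _ _ _
      map_smul' := fun c φ => by ext1 g; exact (assoc X Y Z.toNormalRep).map_smul _ _ }
  have hL : Continuous L := continuous_pi fun g =>
    (assoc X Y Z.toNormalRep).continuous.comp (continuous_apply _)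
  refine X.crea_elem_induction Y Z.toNormalRep (Submodule.comap L (Submodule.topologicalClosure
    (Submodule.map (LinearMap.ltoFun ℂ G _ ℂ) (Submodule.map (ContinuousLinearMap.coeLM ℂ)
      (X.algTensor (Y.tensor Z))))))
    ((Submodule.isClosed_topologicalClosure _).preimage hL) (fun x y => ?_) p
  refine Submodule.le_topologicalClosure _ ⟨_, ⟨_, Submodule.subset_span ⟨x, Y.elem Z y w, rfl⟩, rfl⟩, ?_⟩
  ext1 g
  exact (X.assoc_elem Y Z.toNormalRep x y _).symm

end
end VNBimodule


namespace VNBimodule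
variable {B : VonNeumannAlgebra G}

namespace Hom

theorem ext_op {X Y : VNBimodule B} {T S : Hom X Y} (h : ∀ v, T.op v = S.op v) : T = S := by
  cases T; cases S
  congr 1
  exact ContinuousLinearMap.ext h

/-- The identity map. -/
def id (X : VNBimodule B) : Hom X X where
  op := ContinuousLinearMap.id ℂ X.H
  mem _ h := h
  comm _ _ := rfl

/-- Composition of bilinear maps. -/
def comp {X Y Z : VNBimodule B} (T : Hom Y Z) (S : Hom X Y) : Hom X Z where
  op := T.op ∘L S.op
  mem x hx := T.mem _ (S.mem x hx)
  comm b h := by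
    rw [ContinuousLinearMap.comp_apply, S.comm, T.comm]; rfl

/-- The tensor product `T ⊙ S : x ⊙ y ↦ T x ⊙ S y` of bilinear maps. -/
noncomputable def tens {X X' Y Y' : VNBimodule B} (T : Hom X X') (S : Hom Y Y') :
    Hom (X.tensor Y) (X'.tensor Y') where
  op := T.tensMap S.op
  comm := T.tensMap_comm S.op S.comm
  mem z hz := by
    refine sotClosure_le_of_span (E' := X'.algTensor Y') (T.tensMap S.op)
      (ContinuousLinearMap.id ℂ G) ?_ hz
    rintro _ ⟨x, y, rfl⟩
    refine le_sotClosure _ (Submodule.subset_span ⟨T.app x, S.app y, ?_⟩)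
    ext g
    exact T.tensMap_crea S.op S.comm x _

/-- The identification `(X ⊙ Y) ⊙ Z = X ⊙ (Y ⊙ Z)`. -/
noncomputable def assoc (X Y Z : VNBimodule B) :
    Hom ((X.tensor Y).tensor Z) (X.tensor (Y.tensor Z)) where
  op := VNBimodule.assoc X Y Z.toNormalRep
  comm := X.assoc_comm Y Z.toNormalRep
  mem := X.assoc_mem Y Z

theorem tens_crea {X X' Y Y' : VNBimodule B} (T : Hom X X') (S : Hom Y Y') (x : X.E) (k : Y.H) :
    (T.tens S).op (X.crea Y.toNormalRep x k) = X'.crea Y'.toNormalRep (T.app x) (S.op k) :=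
  T.tensMap_crea S.op S.comm x k

theorem assoc_elem (X Y Z : VNBimodule B) (x : X.E) (y : Y.E) (k : Z.H) :
    (assoc X Y Z).op ((X.tensor Y).crea Z.toNormalRep (X.elem Y x y) k) =
      X.crea (Y.tensor Z).toNormalRep x (Y.crea Z.toNormalRep y k) :=
  X.assoc_elem Y Z.toNormalRep x y k

theorem tens_app_elem {X X' Y Y' : VNBimodule B} (T : Hom X X') (S : Hom Y Y') (x : X.E) (y : Y.E) :
    (T.tens S).app (X.elem Y x y) = X'.elem Y' (T.app x) (S.app y) :=
  ext_apply (x := (T.tens S).app (X.elem Y x y)) (y := X'.elem Y' (T.app x) (S.app y))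
    fun _ => T.tens_crea S x _

theorem assoc_app_elem (X Y Z : VNBimodule B) (x : X.E) (y : Y.E) (z : Z.E) :
    (assoc X Y Z).app ((X.tensor Y).elem Z (X.elem Y x y) z) = X.elem (Y.tensor Z) x (Y.elem Z y z) :=
  ext_apply (x := (assoc X Y Z).app ((X.tensor Y).elem Z (X.elem Y x y) z))
    (y := X.elem (Y.tensor Z) x (Y.elem Z y z)) fun _ => assoc_elem X Y Z x y _

section
variable {X X' X'' Y Y' Y'' Z Z' W : VNBimodule B}

theorem tens_ext {T S : Hom (X.tensor Y) Z} (h : ∀ x k, T.op (X.crea Y.toNormalRep x k) =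
    S.op (X.crea Y.toNormalRep x k)) : T = S :=
  ext_op fun v => DFunLike.congr_fun (clm_ext_of_denseRange (S := T.op) (T := S.op)
    (X.dense_crea Y.toNormalRep) fun p => h p.1 p.2) v

theorem tens_ext₂ {T S : Hom ((X.tensor Y).tensor Z) W}
    (h : ∀ x y k, T.op ((X.tensor Y).crea Z.toNormalRep (X.elem Y x y) k) =
      S.op ((X.tensor Y).crea Z.toNormalRep (X.elem Y x y) k)) : T = S :=
  ext_op fun v => DFunLike.congr_fun (clm_ext_of_denseRange (S := T.op) (T := S.op)
    (X.dense_elem Y Z.toNormalRep) fun p => h p.1 p.2.1 p.2.2) v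

theorem tens_comp (T' : Hom X' X'') (T : Hom X X') (S' : Hom Y' Y'') (S : Hom Y Y') :
    (T'.comp T).tens (S'.comp S) = (T'.tens S').comp (T.tens S) :=
  tens_ext fun x k => by
    change _ = (T'.tens S').op ((T.tens S).op _)
    rw [tens_crea, tens_crea, tens_crea]
    rfl

theorem assoc_natural (T : Hom X X') (S : Hom Y Y') (R : Hom Z Z') :
    (assoc X' Y' Z').comp ((T.tens S).tens R) = (T.tens (S.tens R)).comp (assoc X Y Z) :=
  tens_ext₂ fun x y k => by
    change (assoc X' Y' Z').op (((T.tens S).tens R).op _) = (T.tens (S.tens R)).op ((assoc X Y Z).op _)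
    rw [tens_crea, tens_app_elem, assoc_elem, assoc_elem, tens_crea, tens_crea]

theorem pentagon (X Y Z W : VNBimodule B) :
    (assoc X Y (Z.tensor W)).comp (assoc (X.tensor Y) Z W) =
      ((id X).tens (assoc Y Z W)).comp ((assoc X (Y.tensor Z) W).comp ((assoc X Y Z).tens (id W))) := by
  set P := (assoc X Y (Z.tensor W)).comp (assoc (X.tensor Y) Z W)
  set Q := ((id X).tens (assoc Y Z W)).comp ((assoc X (Y.tensor Z) W).comp ((assoc X Y Z).tens (id W)))
  set a := (assoc (X.tensor Y) Z W).op
  have ha := (ContinuousLinearMap.norm_map_iff_adjoint_comp_self a).1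
    ((X.tensor Y).assoc_norm Z W.toNormalRep)
  have haa : ∀ v, ContinuousLinearMap.adjoint a (a v) = v := fun v => DFunLike.congr_fun ha v
  have key : P.op ∘L ContinuousLinearMap.adjoint a = Q.op ∘L ContinuousLinearMap.adjoint a := by
    refine clm_ext_of_denseRange (X.dense_elem Y (Z.tensor W).toNormalRep) ?_
    rintro ⟨x, y, k⟩
    have h2 : (P.op ∘L ContinuousLinearMap.adjoint a) ∘L
        (X.tensor Y).crea (Z.tensor W).toNormalRep (X.elem Y x y) =
        (Q.op ∘L ContinuousLinearMap.adjoint a) ∘L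
        (X.tensor Y).crea (Z.tensor W).toNormalRep (X.elem Y x y) := by
      refine clm_ext_of_denseRange (Z.dense_crea W.toNormalRep) ?_
      rintro ⟨z, w⟩
      change P.op (ContinuousLinearMap.adjoint a ((X.tensor Y).crea (Z.tensor W).toNormalRep
        (X.elem Y x y) (Z.crea W.toNormalRep z w))) = Q.op (ContinuousLinearMap.adjoint a
        ((X.tensor Y).crea (Z.tensor W).toNormalRep (X.elem Y x y) (Z.crea W.toNormalRep z w)))
      rw [← assoc_elem, haa]
      change (assoc X Y (Z.tensor W)).op ((assoc (X.tensor Y) Z W).op _) =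
        ((id X).tens (assoc Y Z W)).op ((assoc X (Y.tensor Z) W).op (((assoc X Y Z).tens (id W)).op _))
      rw [assoc_elem, assoc_elem, tens_crea, assoc_app_elem, assoc_elem, tens_crea]
      change _ = X.crea _ _ ((assoc Y Z W).op ((Y.tensor Z).crea W.toNormalRep (Y.elem Z y z) w))
      rw [assoc_elem]
      rfl
    exact DFunLike.congr_fun h2 k
  refine ext_op fun v => ?_
  have := DFunLike.congr_fun key (a v)
  change P.op (ContinuousLinearMap.adjoint a (a v)) = Q.op (ContinuousLinearMap.adjoint a (a v)) at this
  rwa [haa] at this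

end
end Hom
end VNBimodule

open VNBimodule

namespace VNBimodule.Hom
variable {B : VonNeumannAlgebra G}

theorem id_tens_id (X Y : VNBimodule B) : (id X).tens (id Y) = id (X.tensor Y) :=
  tens_ext fun _ _ => tens_crea _ _ _ _

theorem op_congr {X Y Y' Z : VNBimodule B} {a : Hom Y Z} {b : Hom X Y} {c : Hom Y' Z} {d : Hom X Y'}
    (h : a.comp b = c.comp d) (v : X.H) : a.op (b.op v) = c.op (d.op v) :=
  congrArg (fun T : Hom X Z => T.op v) h

theorem split_keep {R T₁ T M L P : VNBimodule B} (β : Hom T (R.tensor T₁)) (f : Hom M L)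
    (g : Hom (T₁.tensor L) P) :
    ((id R).tens (g.comp ((id T₁).tens f))).comp ((assoc R T₁ M).comp (β.tens (id M))) =
      (((id R).tens g).comp ((assoc R T₁ L).comp (β.tens (id L)))).comp ((id T).tens f) := by
  have h1 : (β.tens (id L)).comp ((id T).tens f) =
      (((id R).tens (id T₁)).tens f).comp (β.tens (id M)) := by
    rw [id_tens_id]
    exact (tens_comp β (id T) (id L) f).symm.trans (tens_comp (id _) β f (id M))
  have h2 := assoc_natural (id R) (id T₁) f
  have h3 := tens_comp (id R) (id R) g ((id T₁).tens f)
  change (id R).tens (g.comp ((id T₁).tens f)) = _ at h3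
  rw [h3]
  refine ext_op fun v => ?_
  change ((id R).tens g).op (((id R).tens ((id T₁).tens f)).op ((assoc R T₁ M).op
      ((β.tens (id M)).op v))) =
    ((id R).tens g).op ((assoc R T₁ L).op ((β.tens (id L)).op (((id T).tens f).op v)))
  rw [op_congr h1, op_congr h2]

theorem keep_comp {R M L P W : VNBimodule B} (f : Hom M L) (g : Hom L P) (k : Hom W (R.tensor M)) :
    ((id R).tens (g.comp f)).comp k = ((id R).tens g).comp (((id R).tens f).comp k) :=
  congrArg (fun T : Hom _ _ => T.comp k) (tens_comp (id R) (id R) g f)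

theorem split_split {R T₁ T₂ T W Q M L P : VNBimodule B} (β₁ : Hom T (R.tensor T₁))
    (β₂ : Hom W (T.tensor T₂)) (β₃ : Hom Q (T₁.tensor T₂)) (β₄ : Hom W (R.tensor Q))
    (h5 : (assoc R T₁ T₂).comp ((β₁.tens (id T₂)).comp β₂) = ((id R).tens β₃).comp β₄)
    (f : Hom (T₂.tensor M) L) (g : Hom (T₁.tensor L) P) :
    (((id R).tens g).comp ((assoc R T₁ L).comp (β₁.tens (id L)))).comp
      (((id T).tens f).comp ((assoc T T₂ M).comp (β₂.tens (id M)))) =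
    ((id R).tens (g.comp (((id T₁).tens f).comp ((assoc T₁ T₂ M).comp (β₃.tens (id M)))))).comp
      ((assoc R Q M).comp (β₄.tens (id M))) := by
  have h1 : (β₁.tens (id L)).comp ((id T).tens f) =
      (((id R).tens (id T₁)).tens f).comp (β₁.tens (id (T₂.tensor M))) := by
    rw [id_tens_id]
    exact (tens_comp β₁ (id T) (id L) f).symm.trans (tens_comp (id _) β₁ f (id _))
  have h2 := assoc_natural (id R) (id T₁) f
  have h3 := assoc_natural β₁ (id T₂) (id M)
  rw [id_tens_id] at h3
  have h4 := pentagon R T₁ T₂ M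
  have h6 := assoc_natural (id R) β₃ (id M)
  have tc : ∀ {X X' X'' Y Y' Y'' : VNBimodule B} (a : Hom X' X'') (b : Hom X X') (c : Hom Y' Y'')
      (d : Hom Y Y') (v : (X.tensor Y).H),
      ((a.comp b).tens (c.comp d)).op v = (a.tens c).op ((b.tens d).op v) :=
    fun a b c d v => congrArg (fun T => T.op v) (tens_comp a b c d)
  have h5' : ∀ v : (W.tensor M).H, ((assoc R T₁ T₂).tens (id M)).op (((β₁.tens (id T₂)).tens (id M)).op
      ((β₂.tens (id M)).op v)) = (((id R).tens β₃).tens (id M)).op ((β₄.tens (id M)).op v) := by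
    intro v
    rw [← tc, ← tc, ← tc]
    exact congrArg (fun T => (tens T (id M)).op v) h5
  have tr : ∀ {X Y Z V : VNBimodule B} (a : Hom Y Z) (b : Hom X Y) (v : (V.tensor X).H),
      ((id V).tens (a.comp b)).op v = ((id V).tens a).op (((id V).tens b).op v) :=
    fun a b v => tc (id _) (id _) a b v
  have h4' : ∀ v, (assoc R T₁ (T₂.tensor M)).op ((assoc (R.tensor T₁) T₂ M).op v) =
      ((id R).tens (assoc T₁ T₂ M)).op ((assoc R (T₁.tensor T₂) M).op
        (((assoc R T₁ T₂).tens (id M)).op v)) := op_congr h4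
  refine ext_op fun v => ?_
  change ((id R).tens g).op ((assoc R T₁ L).op ((β₁.tens (id L)).op (((id T).tens f).op
    ((assoc T T₂ M).op ((β₂.tens (id M)).op v))))) =
    ((id R).tens _).op ((assoc R Q M).op ((β₄.tens (id M)).op v))
  rw [op_congr h1, op_congr h2, ← op_congr h3, h4', h5', op_congr h6, tr, tr, tr]

end VNBimodule.Hom

/-- The two possible time sets: the nonnegative integers and the nonnegative reals. -/
inductive TimeSet
  | discrete
  | continuous

/-- The points of the time set, as an additive submonoid of the nonnegative reals. -/
def TimeSet.pts : TimeSet → AddSubmonoid ℝ≥0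
  | discrete => AddSubmonoid.multiples 1
  | continuous => ⊤

theorem TimeSet.exists_add {𝕋 : TimeSet} {s r : 𝕋.pts} (h : s < r) : ∃ d : 𝕋.pts, 0 < d ∧ s + d = r := by
  obtain ⟨s, hs⟩ := s
  obtain ⟨r, hr⟩ := r
  have hlt : s < r := h
  refine ⟨⟨r - s, ?_⟩, tsub_pos_of_lt hlt, Subtype.ext (add_tsub_cancel_of_le hlt.le)⟩
  cases 𝕋 with
  | continuous => trivial
  | discrete =>
    obtain ⟨m, rfl⟩ := hs
    obtain ⟨n, rfl⟩ := hr
    exact ⟨n - m, by simp⟩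

theorem TimeSet.le_add {𝕋 : TimeSet} (s r : 𝕋.pts) : s ≤ s + r :=
  le_self_add (a := (s : ℝ≥0)) (b := r)

/-- An inclusion system `(E, β)` of von Neumann `B`-`B`-modules: a family `E_t` with `E_0 = B` and
bilinear isometries `β_{s,t} : E_{s+t} → E_s ⊙ E_t` with
`(β_{r,s} ⊙ id) β_{r+s,t} = (id ⊙ β_{s,t}) β_{r,s+t}`. The index `u = s + t` of `E_{s+t}` is a variable.
The identification `E_0 = B` is given by the element `vac` of `E_0` that corresponds to `1`: it is a
central unitary from `G` onto the Hilbert space of `E_0`. As part of this identification, `β_{0,t}` and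
`β_{t,0}` are the canonical maps `x ↦ 1 ⊙ x` and `x ↦ x ⊙ 1`. -/
structure InclusionSystem (B : VonNeumannAlgebra G) (𝕋 : TimeSet) where
  E : 𝕋.pts → VNBimodule B
  vac : (E 0).E
  vac_left : (E 0).ip vac vac = 1
  vac_right : (vac : G →L[ℂ] (E 0).H) ∘L ContinuousLinearMap.adjoint (vac : G →L[ℂ] (E 0).H) = 1
  vac_comm : ∀ b, (E 0).lact b vac = (E 0).ract vac b
  β : ∀ {s t u : 𝕋.pts}, s + t = u → Hom (E u) ((E s).tensor (E t))
  norm_β : ∀ {s t u : 𝕋.pts} (h : s + t = u) (v : (E u).H), ‖(β h).op v‖ = ‖v‖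
  coassoc : ∀ {r s t p q u : 𝕋.pts} (hrs : r + s = p) (hpt : p + t = u) (hst : s + t = q) (hrq : r + q = u),
    (Hom.assoc (E r) (E s) (E t)).comp (((β hrs).tens (Hom.id (E t))).comp (β hpt)) =
      ((Hom.id (E r)).tens (β hst)).comp (β hrq)
  β_zero_left : ∀ (t : 𝕋.pts) (x : (E t).E), (β (zero_add t)).app x = (E 0).elem (E t) vac x
  β_zero_right : ∀ (t : 𝕋.pts) (x : (E t).E), (β (add_zero t)).app x = (E t).elem (E 0) x vac

namespace InclusionSystem

variable {B : VonNeumannAlgebra G} {𝕋 : TimeSet} (I : InclusionSystem B 𝕋)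

/-- `E_{(t_n, …, t_1)} = E_{t_n} ⊙ ⋯ ⊙ E_{t_1}`; the module of the empty tuple is `B`. -/
noncomputable def tuple : List 𝕋.pts → VNBimodule B
  | [] => unit B
  | s :: l => (I.E s).tensor (tuple l)

/-- `Refine m l f`: the tuple `l` is a refinement of the tuple `m` (it arises by replacing each entry of
`m` by a tuple with this sum) and `f` is the isometry `β_{l m} : E_m → E_l`. A first entry of `m` is either
kept, or it is `s = r + s'` and split by `β_{r,s'}`, so that `l` starts with `r` and the rest of `l` refines
the tuple with `s'` put in front of the rest of `m`. By coassociativity it does not matter in which order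
an entry is split. -/
inductive Refine : (m l : List 𝕋.pts) → Hom (I.tuple m) (I.tuple l) → Prop
  | nil : Refine [] [] (Hom.id _)
  | keep {m l : List 𝕋.pts} (s : 𝕋.pts) {f : Hom (I.tuple m) (I.tuple l)} (h : Refine m l f) :
      Refine (s :: m) (s :: l) ((Hom.id (I.E s)).tens f)
  | split {m l : List 𝕋.pts} {r s' s : 𝕋.pts} (hr : 0 < r) (hs : 0 < s') (h : r + s' = s)
      {f : Hom (I.tuple (s' :: m)) (I.tuple l)} (hf : Refine (s' :: m) l f) :
      Refine (s :: m) (r :: l) (((Hom.id (I.E r)).tens f).comp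
        ((Hom.assoc (I.E r) (I.E s') (I.tuple m)).comp ((I.β h).tens (Hom.id (I.tuple m)))))

variable {I}

theorem Refine.norm {m l : List 𝕋.pts} {f : Hom (I.tuple m) (I.tuple l)} (h : I.Refine m l f)
    (v : (I.tuple m).H) : ‖f.op v‖ = ‖v‖ := by
  induction h with
  | nil => rfl
  | keep s h ih => exact Hom.tensMap_norm _ _ (Hom.comm _) (fun _ => rfl) ih v
  | @split m l r s' s hr hs h f hf ih =>
    refine (Hom.tensMap_norm _ _ (Hom.comm f) (fun _ => rfl) ih _).trans ?_
    refine (VNBimodule.assoc_norm _ _ _ _).trans ?_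
    exact Hom.tensMap_norm _ _ (Hom.comm _) (I.norm_β h) (fun _ => rfl) v

theorem Refine.uniq {m l : List 𝕋.pts} {f g : Hom (I.tuple m) (I.tuple l)} (h : I.Refine m l f)
    (h' : I.Refine m l g) : f = g := by
  induction h with
  | nil => cases h'; rfl
  | @keep m l s f h ih =>
    cases h' with
    | keep _ h' => rw [ih h']
    | split hr hs he hf =>
      exact absurd (add_eq_left.1 he) hs.ne'
  | @split m l r s' s hr hs he f hf ih =>
    cases h' with
    | keep _ h' => exact absurd (add_eq_left.1 he) hs.ne'
    | @split _ _ _ s'' _ hr' hs' he' g hg =>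
      obtain rfl : s' = s'' := add_left_cancel (he.trans he'.symm)
      rw [ih hg]

theorem Refine.congr {m l : List 𝕋.pts} {f g : Hom (I.tuple m) (I.tuple l)} (h : I.Refine m l f)
    (e : f = g) : I.Refine m l g := e ▸ h

theorem Refine.trans {m l p : List 𝕋.pts} {f : Hom (I.tuple m) (I.tuple l)}
    {g : Hom (I.tuple l) (I.tuple p)} (h : I.Refine m l f) (h' : I.Refine l p g) :
    I.Refine m p (g.comp f) := by
  induction h' generalizing m with
  | nil => exact h
  | @keep l p s g h' ih =>
    cases h with
    | @keep m _ _ f h => exact ((ih h).keep s).congr (Hom.tens_comp (Hom.id _) (Hom.id _) g f)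
    | @split m _ _ s' w hr hs he f hf =>
      exact ((ih hf).split hr hs he).congr (Hom.keep_comp f g _)
  | @split l p r s' s hr hs he g hg ih =>
    cases h with
    | @keep m _ _ f h =>
      exact ((ih (h.keep s')).split hr hs he).congr (Hom.split_keep (I.β he) f g)
    | @split m _ _ s'' w hr' hs' he' f hf =>
      have hw : r + (s' + s'') = w := by rw [← add_assoc, he, he']
      refine ((ih (hf.split hs hs' rfl)).split hr (add_pos hs hs') hw).congr ?_
      exact (Hom.split_split (I.β he) (I.β he') (I.β rfl) (I.β hw) (I.coassoc he he' rfl hw) f g).symm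

theorem exists_common_refinement (n : ℕ) : ∀ (l m : List 𝕋.pts), l.length + m.length ≤ n →
    (∀ s ∈ l, 0 < s) → (∀ s ∈ m, 0 < s) → l.sum = m.sum →
    ∃ (p : List 𝕋.pts) (f : Hom (I.tuple l) (I.tuple p)) (g : Hom (I.tuple m) (I.tuple p)),
      (∀ s ∈ p, 0 < s) ∧ p.sum = l.sum ∧ I.Refine l p f ∧ I.Refine m p g := by
  induction n with
  | zero =>
    intro l m h
    obtain rfl : l = [] := List.length_eq_zero_iff.1 (by omega)
    obtain rfl : m = [] := List.length_eq_zero_iff.1 (by omega)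
    exact fun _ _ _ => ⟨[], _, _, by simp, rfl, .nil, .nil⟩
  | succ n ih =>
    intro l m hn hl hm hsum
    match l, m with
    | [], [] => exact ⟨[], _, _, by simp, rfl, .nil, .nil⟩
    | [], r :: m =>
      have h1 : r + m.sum = 0 := by simpa using hsum.symm
      exact absurd ((TimeSet.le_add r m.sum).trans h1.le) (hm r (by simp)).not_ge
    | s :: l, [] =>
      have h1 : s + l.sum = 0 := by simpa using hsum
      exact absurd ((TimeSet.le_add s l.sum).trans h1.le) (hl s (by simp)).not_ge
    | s :: l, r :: m =>
      simp only [List.length_cons, List.sum_cons, List.forall_mem_cons] at hn hl hm hsum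
      rcases lt_trichotomy s r with h | rfl | h
      · obtain ⟨d, hd, rfl⟩ := TimeSet.exists_add h
        obtain ⟨p, f, g, hp, hps, hf, hg⟩ := ih l (d :: m) (by simp; omega) hl.2
          (List.forall_mem_cons.2 ⟨hd, hm.2⟩) (by
            rw [add_assoc] at hsum; simpa using add_left_cancel hsum)
        exact ⟨s :: p, _, _, List.forall_mem_cons.2 ⟨hl.1, hp⟩, by simp [hps], hf.keep s, hg.split hl.1 hd rfl⟩
      · obtain ⟨p, f, g, hp, hps, hf, hg⟩ := ih l m (by omega) hl.2 hm.2 (add_left_cancel hsum)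
        exact ⟨s :: p, _, _, List.forall_mem_cons.2 ⟨hl.1, hp⟩, by simp [hps], hf.keep s, hg.keep s⟩
      · obtain ⟨d, hd, rfl⟩ := TimeSet.exists_add h
        have hsum' : d + l.sum = m.sum := by
          rw [add_assoc] at hsum; exact add_left_cancel hsum
        obtain ⟨p, f, g, hp, hps, hf, hg⟩ := ih (d :: l) m (by simp; omega)
          (List.forall_mem_cons.2 ⟨hd, hl.2⟩) hm.2 (by simpa using hsum')
        refine ⟨r :: p, _, _, List.forall_mem_cons.2 ⟨hm.1, hp⟩, ?_, hf.split hm.1 hd rfl, hg.keep r⟩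
        simp [hps, add_assoc]

end InclusionSystem

instance {B : VonNeumannAlgebra G} (X Y : VNBimodule B) : Nonempty (Hom X Y) :=
  ⟨{ op := 0
     mem := fun x _ => by rw [ContinuousLinearMap.zero_comp]; exact zero_mem _
     comm := fun b h => by rw [zero_apply, zero_apply, map_zero] }⟩

/-- An inductive system of von Neumann modules: a directed index set, and a bilinear isometry
`X i → X j` whenever `i ≤ j`. `Map i j f` says that `i ≤ j` and that `f` is this isometry. -/
structure VNSystem (B : VonNeumannAlgebra G) where
  J : Type
  [nonempty : Nonempty J]
  X : J → VNBimodule B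
  Map : ∀ i j, Hom (X i) (X j) → Prop
  norm : ∀ {i j f}, Map i j f → ∀ v, ‖f.op v‖ = ‖v‖
  uniq : ∀ {i j f g}, Map i j f → Map i j g → f = g
  trans : ∀ {i j k f g}, Map i j f → Map j k g → Map i k (g.comp f)
  directed : ∀ i j, ∃ k f g, Map i k f ∧ Map j k g

namespace VNSystem

variable {B : VonNeumannAlgebra G} (D : VNSystem B)

/-- A common upper bound of two indices. -/
noncomputable def ub (i j : D.J) : D.J := (D.directed i j).choose
/-- The map into the common upper bound from the left index. -/
noncomputable def ubl (i j : D.J) : Hom (D.X i) (D.X (D.ub i j)) := (D.directed i j).choose_spec.choose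
/-- The map into the common upper bound from the right index. -/
noncomputable def ubr (i j : D.J) : Hom (D.X j) (D.X (D.ub i j)) :=
  (D.directed i j).choose_spec.choose_spec.choose

theorem ubl_map (i j : D.J) : D.Map i _ (D.ubl i j) :=
  (D.directed i j).choose_spec.choose_spec.choose_spec.1
theorem ubr_map (i j : D.J) : D.Map j _ (D.ubr i j) :=
  (D.directed i j).choose_spec.choose_spec.choose_spec.2

theorem inner_map {i j f} (h : D.Map i j f) (v w : (D.X i).H) : ⟪f.op v, f.op w⟫_ℂ = ⟪v, w⟫_ℂ :=
  (ContinuousLinearMap.inner_map_map_iff_adjoint_comp_self f.op).2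
    ((ContinuousLinearMap.norm_map_iff_adjoint_comp_self f.op).1 (D.norm h)) v w

theorem inner_ub {i j k f g} (hf : D.Map i k f) (hg : D.Map j k g) (v : (D.X i).H) (w : (D.X j).H) :
    ⟪(D.ubl i j).op v, (D.ubr i j).op w⟫_ℂ = ⟪f.op v, g.op w⟫_ℂ := by
  obtain ⟨u, a, b, ha, hb⟩ := D.directed k (D.ub i j)
  rw [← D.inner_map ha, ← D.inner_map hb]
  have h1 := D.uniq (D.trans hf ha) (D.trans (D.ubl_map i j) hb)
  have h2 := D.uniq (D.trans hg ha) (D.trans (D.ubr_map i j) hb)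
  have e1 : a.op (f.op v) = b.op ((D.ubl i j).op v) := congrArg (fun T : Hom _ _ => T.op v) h1
  have e2 : a.op (g.op w) = b.op ((D.ubr i j).op w) := congrArg (fun T : Hom _ _ => T.op w) h2
  rw [e1, e2]

theorem exists_ub (s : Finset (Σ j, (D.X j).H)) : ∃ k, ∀ p ∈ s, ∃ f, D.Map p.1 k f := by
  classical
  induction s using Finset.induction_on with
  | empty => exact ⟨D.nonempty.some, by simp⟩
  | @insert p s _ ih =>
    obtain ⟨k, hk⟩ := ih
    obtain ⟨u, a, b, ha, hb⟩ := D.directed k p.1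
    refine ⟨u, fun q hq => ?_⟩
    rcases Finset.mem_insert.1 hq with rfl | hq
    · exact ⟨b, hb⟩
    · obtain ⟨f, hf⟩ := hk q hq
      exact ⟨_, D.trans hf ha⟩

/-- The inner product `⟨[h], [k]⟩ = ⟨f h, g k⟩` of the limit Hilbert space, for the maps `f`, `g` into a common upper bound. -/
noncomputable def kernel : PDKernel (Σ j, (D.X j).H) where
  κ p q := ⟪(D.ubl p.1 q.1).op p.2, (D.ubr p.1 q.1).op q.2⟫_ℂ
  conj_symm p q := by
    rw [D.inner_ub (D.ubr_map q.1 p.1) (D.ubl_map q.1 p.1)]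
    exact inner_conj_symm _ _
  nonneg s c := by
    obtain ⟨k, hk⟩ := D.exists_ub s
    choose! f hf using hk
    have : ∑ i ∈ s, ∑ j ∈ s, star (c i) * c j *
        ⟪(D.ubl i.1 j.1).op i.2, (D.ubr i.1 j.1).op j.2⟫_ℂ =
        ⟪∑ i ∈ s, c i • (f i).op i.2, ∑ i ∈ s, c i • (f i).op i.2⟫_ℂ := by
      rw [sum_inner]
      refine Finset.sum_congr rfl fun i hi => ?_
      rw [inner_sum]
      refine Finset.sum_congr rfl fun j hj => ?_
      rw [D.inner_ub (hf i hi) (hf j hj), inner_smul_left, inner_smul_right, mul_assoc]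
      rfl
    rw [this]
    exact inner_self_nonneg (𝕜 := ℂ)

theorem inner_vec {i j k f g} (hf : D.Map i k f) (hg : D.Map j k g) (v : (D.X i).H) (w : (D.X j).H) :
    ⟪D.kernel.vec ⟨i, v⟩, D.kernel.vec ⟨j, w⟩⟫_ℂ = ⟪f.op v, g.op w⟫_ℂ :=
  (PDKernel.inner_vec _ _ _).trans (D.inner_ub hf hg v w)

theorem vec_ext {v w : D.kernel.Space} (h : ∀ p, ⟪D.kernel.vec p, v⟫_ℂ = ⟪D.kernel.vec p, w⟫_ℂ) :
    v = w := eq_of_forall_inner D.kernel.denseRange_vec h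

/-- The canonical isometry from a member of the system into the limit, on the level of Hilbert
spaces. -/
noncomputable def incl (i : D.J) : (D.X i).H →L[ℂ] D.kernel.Space :=
  LinearMap.mkContinuous
    { toFun := fun v => D.kernel.vec ⟨i, v⟩
      map_add' := fun v w => D.vec_ext fun ⟨j, y⟩ => by
        have h1 := D.ubl_map j i
        have h2 := D.ubr_map j i
        rw [inner_add_right, D.inner_vec h1 h2, D.inner_vec h1 h2, D.inner_vec h1 h2, map_add,
          inner_add_right]
      map_smul' := fun z v => D.vec_ext fun ⟨j, y⟩ => by
        have h1 := D.ubl_map j i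
        have h2 := D.ubr_map j i
        rw [RingHom.id_apply, inner_smul_right, D.inner_vec h1 h2, D.inner_vec h1 h2, map_smul,
          inner_smul_right] } 1 fun v => by
    refine le_of_sq_le_sq ?_ (by positivity)
    rw [one_mul, ← inner_self_eq_norm_sq (𝕜 := ℂ), ← inner_self_eq_norm_sq (𝕜 := ℂ)]
    refine le_of_eq (congrArg _ ?_)
    have h1 := D.ubl_map i i
    exact (D.inner_vec h1 h1 v v).trans (D.inner_map h1 v v)

theorem incl_apply (i : D.J) (v : (D.X i).H) : D.incl i v = D.kernel.vec ⟨i, v⟩ := rfl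

theorem inner_incl {i j k f g} (hf : D.Map i k f) (hg : D.Map j k g) (v : (D.X i).H) (w : (D.X j).H) :
    ⟪D.incl i v, D.incl j w⟫_ℂ = ⟪f.op v, g.op w⟫_ℂ := D.inner_vec hf hg v w

theorem norm_incl (i : D.J) (v : (D.X i).H) : ‖D.incl i v‖ = ‖v‖ := by
  have h1 := D.ubl_map i i
  rw [← sq_eq_sq₀ (norm_nonneg _) (norm_nonneg _), ← inner_self_eq_norm_sq (𝕜 := ℂ),
    ← inner_self_eq_norm_sq (𝕜 := ℂ), D.inner_incl h1 h1, D.inner_map h1]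

theorem incl_map {i j f} (hf : D.Map i j f) (v : (D.X i).H) : D.incl j (f.op v) = D.incl i v :=
  D.vec_ext fun ⟨k, y⟩ => by
    have h1 := D.ubl_map k j
    have h2 := D.ubr_map k j
    exact (D.inner_vec h1 h2 _ _).trans (D.inner_vec h1 (D.trans hf h2) _ _).symm

theorem exists_rep (b : B.toStarSubalgebra) (c : (Σ j, (D.X j).H) →₀ ℂ) : ∃ k v,
    Finsupp.linearCombination ℂ (fun p => D.incl p.1 p.2) c = D.incl k v ∧
    Finsupp.linearCombination ℂ (fun p => D.incl p.1 ((D.X p.1).π b p.2)) c = D.incl k ((D.X k).π b v) := by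
  induction c using Finsupp.induction_linear with
  | zero => exact ⟨D.nonempty.some, 0, by simp, by simp⟩
  | single p z =>
    refine ⟨p.1, z • p.2, ?_, ?_⟩ <;> simp
  | add c d hc hd =>
    obtain ⟨i, v, h1, h2⟩ := hc
    obtain ⟨j, w, h3, h4⟩ := hd
    obtain ⟨k, f, g, hf, hg⟩ := D.directed i j
    refine ⟨k, f.op v + g.op w, ?_, ?_⟩
    · rw [map_add, h1, h3, map_add, D.incl_map hf, D.incl_map hg]
    · rw [map_add, h2, h4, map_add, map_add, ← f.comm, ← g.comm, D.incl_map hf, D.incl_map hg]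

theorem dense_incl : DenseRange (Finsupp.linearCombination ℂ
    (fun p : Σ j, (D.X j).H => D.incl p.1 p.2)) := D.kernel.denseRange_vec

theorem act_bound (b : B.toStarSubalgebra) (c : (Σ j, (D.X j).H) →₀ ℂ) :
    ‖Finsupp.linearCombination ℂ (fun p => D.incl p.1 ((D.X p.1).π b p.2)) c‖ ≤
    ‖(b : G →L[ℂ] G)‖ * ‖Finsupp.linearCombination ℂ (fun p => D.incl p.1 p.2) c‖ := by
  obtain ⟨k, v, h1, h2⟩ := D.exists_rep b c
  rw [h1, h2, norm_incl, norm_incl]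
  exact ((D.X k).π b).le_of_opNorm_le (norm_rep_le B _ b) v

/-- The left action on the limit. -/
noncomputable def act (b : B.toStarSubalgebra) : D.kernel.Space →L[ℂ] D.kernel.Space :=
  extendMap (fun p : Σ j, (D.X j).H => D.incl p.1 p.2) (fun p => D.incl p.1 ((D.X p.1).π b p.2))

theorem act_incl (b : B.toStarSubalgebra) (i : D.J) (v : (D.X i).H) :
    D.act b (D.incl i v) = D.incl i ((D.X i).π b v) :=
  extendMap_apply (e := fun p : Σ j, (D.X j).H => D.incl p.1 p.2) D.dense_incl (D.act_bound b) ⟨i, v⟩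

theorem norm_act_le (b : B.toStarSubalgebra) : ‖D.act b‖ ≤ ‖(b : G →L[ℂ] G)‖ :=
  LinearMap.opNorm_extendOfNorm_le D.dense_incl (norm_nonneg _) (D.act_bound b)

theorem clm_ext {H : Type*} [NormedAddCommGroup H] [InnerProductSpace ℂ H]
    {S T : D.kernel.Space →L[ℂ] H} (h : ∀ i v, S (D.incl i v) = T (D.incl i v)) : S = T :=
  clm_ext_of_denseRange D.dense_incl fun p => h p.1 p.2

/-- The left action on the limit as a representation. -/
noncomputable def rep : B.toStarSubalgebra →⋆ₐ[ℂ] (D.kernel.Space →L[ℂ] D.kernel.Space) where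
  toFun := D.act
  map_one' := D.clm_ext fun i v => by rw [act_incl, map_one]; rfl
  map_mul' a b := D.clm_ext fun i v => by
    rw [mul_apply_eq_comp, act_incl, act_incl, act_incl, map_mul]; rfl
  map_zero' := D.clm_ext fun i v => by rw [act_incl, map_zero, zero_apply, map_zero]; rfl
  map_add' a b := D.clm_ext fun i v => by
    rw [add_apply, act_incl, act_incl, act_incl, map_add, add_apply, map_add]
  commutes' z := D.clm_ext fun i v => by
    have h1 : (D.X i).π (algebraMap ℂ B.toStarSubalgebra z) = algebraMap ℂ _ z :=
      AlgHomClass.commutes (D.X i).π z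
    rw [act_incl, h1, Algebra.algebraMap_eq_smul_one, Algebra.algebraMap_eq_smul_one, smul_apply,
      smul_apply, map_smul]
    rfl
  map_star' b := by
    rw [ContinuousLinearMap.star_eq_adjoint]
    refine D.clm_ext fun i v => D.vec_ext fun ⟨j, w⟩ => ?_
    have h1 := D.ubl_map j i
    have h2 := D.ubr_map j i
    rw [ContinuousLinearMap.adjoint_inner_right, ← incl_apply, act_incl, act_incl,
      D.inner_incl h1 h2, D.inner_incl h1 h2, Hom.comm, Hom.comm, map_star,
      ContinuousLinearMap.star_eq_adjoint, ContinuousLinearMap.adjoint_inner_right]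

theorem rep_incl (b : B.toStarSubalgebra) (i : D.J) (v : (D.X i).H) :
    D.rep b (D.incl i v) = D.incl i ((D.X i).π b v) := D.act_incl b i v

/-- The algebraic inductive limit, as a space of operators. -/
noncomputable def algLim : Submodule ℂ (G →L[ℂ] D.kernel.Space) :=
  Submodule.span ℂ {z | ∃ (i : D.J) (x : (D.X i).E), z = D.incl i ∘L (x : G →L[ℂ] (D.X i).H)}

/-- The inductive limit of a directed system of von Neumann modules. -/
@[reducible] noncomputable def lim : VNBimodule B where
  H := D.kernel.Space
  π := D.rep
  normal := by
    intro l b r hr hw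
    refine tendsto_inner_of_denseRange D.dense_incl l D.rep _ r
      (hr.mono fun a ha => (D.norm_act_le a).trans ha) ?_
    rintro ⟨i, v⟩ ⟨j, w⟩
    have h1 := D.ubl_map i j
    have h2 := D.ubr_map i j
    simp only [rep_incl, D.inner_incl h1 h2, Hom.comm]
    exact (D.X _).normal l b r hr hw _ _
  E := sotClosure D.algLim
  right_mem z hz b := by
    refine sotClosure_le_of_span (ContinuousLinearMap.id ℂ _) b ?_ hz
    rintro _ ⟨i, x, rfl⟩
    exact le_sotClosure _ (Submodule.subset_span ⟨i, (D.X i).ract x b, rfl⟩)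
  inner_mem z hz w hw := by
    refine sotClosure_inner_mem B ?_ hz hw
    refine span_inner_mem B ?_
    rintro _ ⟨i, x, rfl⟩ _ ⟨j, y, rfl⟩
    have h1 := D.ubl_map i j
    have h2 := D.ubr_map i j
    have : ContinuousLinearMap.adjoint (D.incl i ∘L (x : G →L[ℂ] (D.X i).H)) ∘L
        D.incl j ∘L (y : G →L[ℂ] (D.X j).H) =
        (D.X _).ip ((D.ubl i j).app x) ((D.ubr i j).app y) := by
      refine ContinuousLinearMap.ext fun g => ext_inner_left ℂ fun g' => ?_
      rw [inner_ip, ContinuousLinearMap.comp_apply, ContinuousLinearMap.adjoint_inner_right]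
      exact D.inner_incl h1 h2 _ _
    rw [this]; exact Subtype.property _
  total := by
    have key : ∀ i v, D.incl i v ∈ (Submodule.span ℂ {h : D.kernel.Space |
        ∃ x ∈ sotClosure D.algLim, ∃ g : G, h = x g}).topologicalClosure := by
      intro i v
      have hv : v ∈ (Submodule.span ℂ {h : (D.X i).H | ∃ y ∈ (D.X i).E, ∃ g : G, h = y g}).topologicalClosure := by
        rw [(D.X i).total]; trivial
      refine (Submodule.topologicalClosure_minimal _ (t := Submodule.comap
        (D.incl i).toLinearMap (Submodule.topologicalClosure _)) ?_ ?_) hv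
      · rw [Submodule.span_le]
        rintro _ ⟨y, hy, g, rfl⟩
        exact Submodule.le_topologicalClosure _ (Submodule.subset_span
          ⟨_, le_sotClosure _ (Submodule.subset_span ⟨i, ⟨y, hy⟩, rfl⟩), g, rfl⟩)
      · exact (Submodule.isClosed_topologicalClosure _).preimage (D.incl i).continuous
    rw [eq_top_iff]
    intro v _
    refine D.dense_incl.induction_on (p := fun v => v ∈ (Submodule.span ℂ {h : D.kernel.Space |
        ∃ x ∈ sotClosure D.algLim, ∃ g : G, h = x g}).topologicalClosure) v
      (Submodule.isClosed_topologicalClosure _) fun c => ?_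
    rw [Finsupp.linearCombination_apply]
    exact Submodule.sum_mem _ fun i _ => Submodule.smul_mem _ _ (key _ _)
  left_mem b z hz := by
    refine sotClosure_le_of_span _ (ContinuousLinearMap.id ℂ _) ?_ hz
    rintro _ ⟨i, x, rfl⟩
    refine le_sotClosure _ (Submodule.subset_span ⟨i, (D.X i).lact b x, ?_⟩)
    ext g
    exact D.rep_incl b i _
  closed := sotClosure_sotClosure _

/-- The canonical isometry of a member of the system into the limit. -/
noncomputable def inc (i : D.J) : Hom (D.X i) D.lim where
  op := D.incl i
  mem x hx := le_sotClosure _ (Submodule.subset_span ⟨i, ⟨x, hx⟩, rfl⟩)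
  comm b v := (D.rep_incl b i v).symm

end VNSystem

namespace VNBimodule
variable {B : VonNeumannAlgebra G} (X : VNBimodule B)

theorem dense_apply : DenseRange (Finsupp.linearCombination ℂ
    (fun p : X.E × G => (p.1 : G →L[ℂ] X.H) p.2)) := by
  rw [DenseRange, ← LinearMap.coe_range, Finsupp.range_linearCombination,
    Submodule.dense_iff_topologicalClosure_eq_top, ← X.total]
  congr 2
  ext h
  constructor
  · rintro ⟨p, rfl⟩; exact ⟨_, p.1.2, p.2, rfl⟩
  · rintro ⟨x, hx, g, rfl⟩; exact ⟨(⟨x, hx⟩, g), rfl⟩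

/-- An element of the trivial module `B`, as an element of the algebra. -/
def ofUnit (b : (unit B).E) : B.toStarSubalgebra := ⟨(b : G →L[ℂ] (unit B).H), b.2⟩

/-- The operator `x g ↦ x ⊗ g`. -/
noncomputable def rightUnitOp : X.H →L[ℂ] (X.tensor (unit B)).H :=
  extendMap (fun p : X.E × G => (p.1 : G →L[ℂ] X.H) p.2)
    (fun p => X.crea (unit B).toNormalRep p.1 p.2)

theorem rightUnitOp_apply (x : X.E) (g : G) : X.rightUnitOp ((x : G →L[ℂ] X.H) g) =
    X.crea (unit B).toNormalRep x g :=
  extendMap_apply' (e := fun p : X.E × G => (p.1 : G →L[ℂ] X.H) p.2)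
    (f := fun p => X.crea (unit B).toNormalRep p.1 p.2) X.dense_apply
    (fun _ _ => (X.inner_crea _ _ _ _ _).trans (X.inner_ip _ _ _ _)) (x, g)

/-- The identification `X = X ⊙ B`, given by `x g ↦ x ⊗ g`. -/
noncomputable def Hom.rightUnit : Hom X (X.tensor (unit B)) where
  op := X.rightUnitOp
  mem x hx := le_sotClosure _ (Submodule.subset_span ⟨⟨x, hx⟩,
    ⟨(1 : G →L[ℂ] G), B.toStarSubalgebra.one_mem⟩,
    ContinuousLinearMap.ext fun g => X.rightUnitOp_apply ⟨x, hx⟩ g⟩)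
  comm b h := DFunLike.congr_fun (clm_ext_of_denseRange X.dense_apply
    (S := X.rightUnitOp ∘L X.π b) (T := (X.tensor (unit B)).π b ∘L X.rightUnitOp) fun p => by
      rw [ContinuousLinearMap.comp_apply, ContinuousLinearMap.comp_apply, rightUnitOp_apply,
        ← X.lact_apply, rightUnitOp_apply]
      exact (X.tens_π_crea _ b _ _).symm) h

/-- The operator `b ⊗ k ↦ b k`. -/
noncomputable def leftUnitOp : ((unit B).tensor X).H →L[ℂ] X.H :=
  extendMap (fun p : (unit B).E × X.H => (unit B).crea X.toNormalRep p.1 p.2)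
    (fun p => X.π (ofUnit p.1) p.2)

theorem leftUnitOp_crea (b : (unit B).E) (k : X.H) :
    X.leftUnitOp ((unit B).crea X.toNormalRep b k) = X.π (ofUnit b) k :=
  extendMap_apply' (e := fun p : (unit B).E × X.H => (unit B).crea X.toNormalRep p.1 p.2)
    (f := fun p => X.π (ofUnit p.1) p.2) ((unit B).dense_crea X.toNormalRep)
    (fun i j => by
      rw [inner_crea, ← ContinuousLinearMap.adjoint_inner_right,
        ← ContinuousLinearMap.star_eq_adjoint, ← map_star, ← mul_apply_eq_comp, ← map_mul]
      rfl) (b, k)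

/-- The identification `B ⊙ X = X`, given by `b ⊗ k ↦ b k`. -/
noncomputable def Hom.leftUnit : Hom ((unit B).tensor X) X where
  op := X.leftUnitOp
  mem z hz := by
    refine X.closed (sotClosure_le_of_span _ (ContinuousLinearMap.id ℂ G) ?_ hz)
    rintro _ ⟨b, y, rfl⟩
    refine le_sotClosure _ ?_
    convert X.left_mem (ofUnit b) y y.2 using 1
    exact ContinuousLinearMap.ext fun g => X.leftUnitOp_crea b _
  comm a h := DFunLike.congr_fun (clm_ext_of_denseRange ((unit B).dense_crea X.toNormalRep)
    (S := X.leftUnitOp ∘L ((unit B).tensor X).π a) (T := X.π a ∘L X.leftUnitOp) fun p => by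
      rw [ContinuousLinearMap.comp_apply, ContinuousLinearMap.comp_apply, leftUnitOp_crea,
        tens_π_crea, leftUnitOp_crea, ← mul_apply_eq_comp, ← map_mul]
      rfl) h

/-- The bilinear map is adjointable: the adjoint operator maps the second module into the first. -/
def Hom.Adjointable {X Y : VNBimodule B} (T : Hom X Y) : Prop :=
  ∀ y ∈ Y.E, ContinuousLinearMap.adjoint T.op ∘L y ∈ X.E

end VNBimodule

namespace InclusionSystem

variable {B : VonNeumannAlgebra G} {𝕋 : TimeSet} (I : InclusionSystem B 𝕋)

theorem _root_.TimeSet.zero_le (t : 𝕋.pts) : 0 ≤ t := _root_.zero_le (a := (t : ℝ≥0))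

/-- The tuples `(t_n, …, t_1)` with `t_i > 0` and sum `t`. -/
def Tup (t : 𝕋.pts) : Type := {l : List 𝕋.pts // (∀ s ∈ l, 0 < s) ∧ l.sum = t}

/-- The tuple `(t)`. -/
def Tup.single {t : 𝕋.pts} (ht : 0 < t) : Tup t := ⟨[t], by simpa using ht, by simp⟩

/-- The empty tuple. -/
def Tup.empty : Tup (0 : 𝕋.pts) := ⟨[], by simp, rfl⟩

/-- Concatenation of tuples. -/
def Tup.append {s t u : 𝕋.pts} (h : s + t = u) (l : Tup s) (m : Tup t) : Tup u :=
  ⟨l.1 ++ m.1, fun r hr => (List.mem_append.1 hr).elim (l.2.1 r) (m.2.1 r), by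
    rw [List.sum_append, l.2.2, m.2.2, h]⟩

/-- The directed system of the modules `E_𝔱`, for the tuples `𝔱` with sum `t`. -/
noncomputable def sys (t : 𝕋.pts) : VNSystem B where
  J := Tup t
  nonempty := by
    by_cases h : t = 0
    · subst h; exact ⟨Tup.empty⟩
    · exact ⟨Tup.single (lt_of_le_of_ne (TimeSet.zero_le t) (Ne.symm h))⟩
  X l := I.tuple l.1
  Map l m f := I.Refine l.1 m.1 f
  norm h := h.norm
  uniq h h' := h.uniq h'
  trans h h' := h.trans h'
  directed l m := by
    obtain ⟨p, f, g, hp, hs, hf, hg⟩ := exists_common_refinement (I := I) _ l.1 m.1 le_rfl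
      l.2.1 m.2.1 (l.2.2.trans m.2.2.symm)
    exact ⟨⟨p, hp, hs.trans l.2.2⟩, f, g, hf, hg⟩

/-- The module `𝓔_t` of the generated product system: the inductive limit of the `E_𝔱`. -/
noncomputable def gen (t : 𝕋.pts) : VNBimodule B := (I.sys t).lim

/-- The canonical isometry `i_𝔱 : E_𝔱 → 𝓔_t`. -/
noncomputable def incTup {t : 𝕋.pts} (l : Tup t) : Hom (I.tuple l.1) (I.gen t) := (I.sys t).inc l

/-- The identification `E_0 = B`. -/
noncomputable def vacHom : Hom (I.E 0) (unit B) where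
  op := ContinuousLinearMap.adjoint (I.vac : G →L[ℂ] (I.E 0).H)
  mem x hx := (I.E 0).inner_mem _ I.vac.2 x hx
  comm b h := by
    refine ext_inner_left ℂ fun (g : G) => ?_
    have h1 := DFunLike.congr_fun (congrArg Subtype.val (I.vac_comm (star b))) g
    change (I.E 0).π (star b) ((I.vac : G →L[ℂ] (I.E 0).H) g) =
      (I.vac : G →L[ℂ] (I.E 0).H) ((star b : B.toStarSubalgebra).1 g) at h1
    have h2 : (star b : B.toStarSubalgebra).1 = ContinuousLinearMap.adjoint b.1 := rfl
    change _ = ⟪g, b.1 (ContinuousLinearMap.adjoint (I.vac : G →L[ℂ] (I.E 0).H) h)⟫_ℂ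
    rw [ContinuousLinearMap.adjoint_inner_right, ← ContinuousLinearMap.adjoint_inner_left b.1,
      ContinuousLinearMap.adjoint_inner_right, ← h2, ← h1, map_star,
      ContinuousLinearMap.star_eq_adjoint, ContinuousLinearMap.adjoint_inner_left]

/-- The canonical isometry `i_t : E_t → 𝓔_t`, that is `i_𝔱` for the tuple `𝔱 = (t)`, or for `𝔱 = ()` if
`t = 0`. -/
noncomputable def incl (t : 𝕋.pts) : Hom (I.E t) (I.gen t) :=
  if h : 0 = t then
    h.rec (motive := fun t _ => Hom (I.E t) (I.gen t)) ((I.incTup Tup.empty).comp I.vacHom)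
  else
    (I.incTup (Tup.single (lt_of_le_of_ne (TimeSet.zero_le t) h))).comp (Hom.rightUnit (I.E t))

/-- The identification `E_𝔰 ⊙ E_𝔱 = E_{𝔰 ⌣ 𝔱}`. -/
noncomputable def conc : ∀ l m : List 𝕋.pts, Hom ((I.tuple l).tensor (I.tuple m)) (I.tuple (l ++ m))
  | [], m => Hom.leftUnit (I.tuple m)
  | s :: l, m => ((Hom.id (I.E s)).tens (conc l m)).comp (Hom.assoc (I.E s) (I.tuple l) (I.tuple m))

/-- The product `B_{s,t} : 𝓔_s ⊙ 𝓔_t → 𝓔_{s+t}`, given by `i_𝔰 x ⊙ i_𝔱 y ↦ i_{𝔰 ⌣ 𝔱} (x ⊙ y)`; it is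
written on the Hilbert spaces, where it reads `i_𝔰 x ⊗ i_𝔱 k ↦ i_{𝔰 ⌣ 𝔱} (x ⊗ k)`. -/
noncomputable def prod {s t u : 𝕋.pts} (h : s + t = u) :
    ((I.gen s).tensor (I.gen t)).H →L[ℂ] (I.gen u).H :=
  extendMap (ι := Σ (l : Tup s) (m : Tup t), (I.tuple l.1).E × (I.tuple m.1).H)
    (fun p => (I.gen s).crea (I.gen t).toNormalRep ((I.incTup p.1).app p.2.2.1)
      ((I.incTup p.2.1).op p.2.2.2))
    (fun p => (I.incTup (p.1.append h p.2.1)).op ((I.conc p.1.1 p.2.1.1).op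
      ((I.tuple p.1.1).crea (I.tuple p.2.1.1).toNormalRep p.2.2.1 p.2.2.2)))

end InclusionSystem


/-- Weak morphisms between two families of modules with structure maps `β` and `γ`: adjointable
bilinear maps `T_t : E_t → F_t` with `‖T_t‖ ≤ e^{tk}` for some real `k`, such that the `γ_{s,t}` are
adjointable and `T_{s+t} = γ_{s,t}^* (T_s ⊙ T_t) β_{s,t}`. -/
structure IsWeakMorphism {B : VonNeumannAlgebra G} {𝕋 : TimeSet} (E F : 𝕋.pts → VNBimodule B)
    (β : ∀ {s t u : 𝕋.pts}, s + t = u → (E u).H →L[ℂ] ((E s).tensor (E t)).H)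
    (γ : ∀ {s t u : 𝕋.pts}, s + t = u → (F u).H →L[ℂ] ((F s).tensor (F t)).H)
    (T : ∀ t, Hom (E t) (F t)) : Prop where
  adjointable : ∀ t, (T t).Adjointable
  bound : ∃ k : ℝ, ∀ t : 𝕋.pts, ‖(T t).op‖ ≤ Real.exp (((t : ℝ≥0) : ℝ) * k)
  adjointable_right : ∀ {s t u : 𝕋.pts} (h : s + t = u), ∀ z ∈ ((F s).tensor (F t)).E,
    ContinuousLinearMap.adjoint (γ h) ∘L z ∈ (F u).E
  map_add : ∀ {s t u : 𝕋.pts} (h : s + t = u),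
    (T u).op = ContinuousLinearMap.adjoint (γ h) ∘L ((T s).tens (T t)).op ∘L β h

namespace InclusionSystem

variable {B : VonNeumannAlgebra G} {𝕋 : TimeSet}

/-- Weak morphisms of inclusion systems. -/
def IsMorphism (E F : InclusionSystem B 𝕋) (T : ∀ t, Hom (E.E t) (F.E t)) : Prop :=
  IsWeakMorphism E.E F.E (fun h => (E.β h).op) (fun h => (F.β h).op) T

/-- Morphisms of the generated product systems. The structure maps `𝓔_{s+t} → 𝓔_s ⊙ 𝓔_t` of the
product system are the adjoints of the unitary products `𝓔_s ⊙ 𝓔_t → 𝓔_{s+t}`. -/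
def IsProductMorphism (E F : InclusionSystem B 𝕋) (T : ∀ t, Hom (E.gen t) (F.gen t)) : Prop :=
  IsWeakMorphism E.gen F.gen (fun h => ContinuousLinearMap.adjoint (E.prod h))
    (fun h => ContinuousLinearMap.adjoint (F.prod h)) T

/-- The family `T'` lifts `T`: `T_s = j_s^* T'_s i_s` for all `s`, with the canonical isometries `i`, `j`. -/
def IsLift (E F : InclusionSystem B 𝕋) (T : ∀ t, Hom (E.E t) (F.E t))
    (T' : ∀ t, Hom (E.gen t) (F.gen t)) : Prop :=
  ∀ s, (T s).op = ContinuousLinearMap.adjoint (F.incl s).op ∘L (T' s).op ∘L (E.incl s).op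

/-- The map `T_𝔱 = T_{t_n} ⊙ ⋯ ⊙ T_{t_1}`. -/
noncomputable def tupleMap {E F : InclusionSystem B 𝕋} (T : ∀ t, Hom (E.E t) (F.E t)) :
    ∀ l : List 𝕋.pts, Hom (E.tuple l) (F.tuple l)
  | [] => Hom.id (unit B)
  | s :: l => (T s).tens (tupleMap T l)

/-- The operator `j_𝔱 T_𝔱 i_𝔱^*`. -/
noncomputable def tupleLift {E F : InclusionSystem B 𝕋} (T : ∀ t, Hom (E.E t) (F.E t)) {t : 𝕋.pts}
    (l : Tup t) : (E.gen t).H →L[ℂ] (F.gen t).H :=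
  (F.incTup l).op ∘L (tupleMap T l.1).op ∘L ContinuousLinearMap.adjoint (E.incTup l).op

end InclusionSystem

end Bimodules

/-!
A bilinear map `A : 𝓔_t → 𝓕_t` of generated modules is determined by its compressions `j_𝔱^* A i_𝔱` to the
tuples `𝔱` with sum `t`, because the ranges of the `i_𝔱` and of the `j_𝔱` increase to dense subspaces
(`gen_clm_ext`). Conversely, a bounded family `P_𝔱 : E_𝔱 → F_𝔱` that is compatible, that is
`γ_{𝔱𝔰}^* P_𝔱 β_{𝔱𝔰} = P_𝔰` for `𝔱 ≥ 𝔰`, consists of the compressions of some `A`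
(`exists_hom_of_compressions`): the operators `j_𝔱 P_𝔱 i_𝔱^*` have a weak cluster point. Since
`j_𝔱 P_𝔱 i_𝔱^* = q_𝔱 A p_𝔱` with the range projections `p_𝔱` of `i_𝔱` and `q_𝔱` of `j_𝔱`, which increase
to the identity, the net converges strongly to `A` (`tendsto_of_compression`). As the values of the net on
the vectors `i_𝔰 x` lie in `𝓕_t`, so do those of `A`, for `𝓕_t` is strongly closed; the same argument for the
adjoint family shows that `A` is adjointable.

For a weak morphism `T`, the relation `T_{s+t} = γ^* (T_s ⊙ T_t) β` says that the maps `T_𝔱` are compatible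
(`IsMorphism.isCompression_refine`), and they are bounded by `e^{tk}`. The resulting maps `T'_t` form a
morphism: the product is unitary and given by concatenation (`prod_tens`), so the compressions of
`C (T'_s ⊙ T'_t) B^*` to the tuples `𝔰 ⌣ 𝔱`, which are cofinal, are `T_𝔰 ⊙ T_𝔱 = T_{𝔰 ⌣ 𝔱}`. In the same way,
the compressions of a morphism to all tuples are determined by those to the tuples of length at most one
(`IsProductMorphism.compression`), which gives uniqueness.

The time `0` needs care. The relation for `s = t = 0` makes `T_0`, as a map `c` from `B` to `B`, the
multiplication by a central projection that need not be `1`, while the map of the empty tuple is the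
identity. The compatible family is therefore taken to be `T_{t_n} ⊙ ⋯ ⊙ T_{t_1} ⊙ c`
(`tupleMapVac`). For nonempty tuples this is `T_𝔱`, because `T_t = γ_{t,0}^* (T_t ⊙ T_0) β_{t,0}` says that `c`
acts trivially on the right of `T_t`.
-/

/-! ### Operators on Hilbert spaces -/

section HilbertSpace

variable {H K : Type*} [NormedAddCommGroup H] [InnerProductSpace ℂ H]
    [NormedAddCommGroup K] [InnerProductSpace ℂ K]

theorem inner_map_of_norm_map [CompleteSpace H] [CompleteSpace K] {A : H →L[ℂ] K}
    (hA : ∀ v, ‖A v‖ = ‖v‖) (v w : H) : ⟪A v, A w⟫_ℂ = ⟪v, w⟫_ℂ :=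
  (ContinuousLinearMap.inner_map_map_iff_adjoint_comp_self A).2
    ((ContinuousLinearMap.norm_map_iff_adjoint_comp_self A).1 hA) v w

theorem adjoint_apply_of_norm_map [CompleteSpace H] [CompleteSpace K] {A : H →L[ℂ] K}
    (hA : ∀ v, ‖A v‖ = ‖v‖) (v : H) : ContinuousLinearMap.adjoint A (A v) = v :=
  DFunLike.congr_fun ((ContinuousLinearMap.norm_map_iff_adjoint_comp_self A).1 hA) v

theorem norm_le_one_of_norm_map {A : H →L[ℂ] K} (hA : ∀ v, ‖A v‖ = ‖v‖) : ‖A‖ ≤ 1 :=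
  A.opNorm_le_bound zero_le_one fun v => by rw [hA, one_mul]

theorem surjective_of_norm_map [CompleteSpace H] {A : H →L[ℂ] K} (hA : ∀ v, ‖A v‖ = ‖v‖)
    (hd : DenseRange A) : Function.Surjective A := by
  have h : IsClosed (Set.range A) :=
    (AddMonoidHomClass.isometry_of_norm A hA).isClosedEmbedding.isClosed_range
  rw [← Set.range_eq_univ, ← h.closure_eq]
  exact hd.closure_range

theorem denseRange_of_linearCombination {ι : Type*} {f : ι → K} (hf : DenseRange (Finsupp.linearCombination ℂ f))
    (A : H →L[ℂ] K) (h : ∀ i, f i ∈ Set.range A) : DenseRange A := by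
  refine hf.mono ?_
  rintro _ ⟨c, rfl⟩
  rw [Finsupp.linearCombination_apply]
  exact Submodule.sum_mem (LinearMap.range A.toLinearMap) fun i _ => Submodule.smul_mem _ _ (h i)

/-- An operator is determined by its matrix elements with respect to two total families. -/
theorem clm_ext_inner {ι κ : Type*} {e : ι → H} {f : κ → K}
    (he : DenseRange (Finsupp.linearCombination ℂ e)) (hf : DenseRange (Finsupp.linearCombination ℂ f))
    {S T : H →L[ℂ] K} (h : ∀ i j, ⟪f j, S (e i)⟫_ℂ = ⟪f j, T (e i)⟫_ℂ) : S = T :=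
  clm_ext_of_denseRange he fun i => eq_of_forall_inner hf (h i)

/-- The range projection `V V^*` of an isometry realizes the distance to the range. -/
theorem norm_sub_range_proj_le [CompleteSpace H] [CompleteSpace K] {V : H →L[ℂ] K}
    (hV : ∀ v, ‖V v‖ = ‖v‖) (ξ : K) (y : H) :
    ‖V (ContinuousLinearMap.adjoint V ξ) - ξ‖ ≤ ‖ξ - V y‖ := by
  set a := ξ - V (ContinuousLinearMap.adjoint V ξ) with ha
  set b := V (ContinuousLinearMap.adjoint V ξ - y) with hb
  have hab : ⟪a, b⟫_ℂ = 0 := by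
    rw [hb, ← ContinuousLinearMap.adjoint_inner_left, ha, map_sub, adjoint_apply_of_norm_map hV,
      sub_self, inner_zero_left]
  have h1 := norm_add_sq_eq_norm_sq_add_norm_sq_of_inner_eq_zero a b hab
  have h2 : a + b = ξ - V y := by rw [ha, hb, map_sub]; abel
  rw [h2] at h1
  rw [← neg_sub, norm_neg, ← ha]
  nlinarith [norm_nonneg a, norm_nonneg b, norm_nonneg (ξ - V y)]

/-- A bounded family of operators has a cluster point for the weak operator topology. It is stated
for matrix elements that are eventually constant; these are then matrix elements of the cluster point. -/
theorem exists_weak_cluster {α : Type*} [CompleteSpace K] (l : Filter α) [l.NeBot] (Φ : α → H →L[ℂ] K)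
    {r : ℝ} (hr : 0 ≤ r) (hΦ : ∀ a, ‖Φ a‖ ≤ r) : ∃ A : H →L[ℂ] K, ‖A‖ ≤ r ∧ ∀ (ξ : K) (η : H) (z : ℂ),
      (∀ᶠ a in l, ⟪ξ, Φ a η⟫_ℂ = z) → ⟪ξ, A η⟫_ℂ = z := by
  let U := Ultrafilter.of l
  have hb : ∀ ξ η a, ‖⟪Φ a η, ξ⟫_ℂ‖ ≤ r * ‖η‖ * ‖ξ‖ := fun ξ η a =>
    (norm_inner_le_norm _ _).trans (by gcongr; exact (Φ a).le_of_opNorm_le (hΦ a) η)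
  have hlim : ∀ ξ η, ∃ z : ℂ, ‖z‖ ≤ r * ‖η‖ * ‖ξ‖ ∧ Tendsto (fun a => ⟪Φ a η, ξ⟫_ℂ) U (𝓝 z) := by
    intro ξ η
    obtain ⟨z, hz, h⟩ := (isCompact_closedBall (0 : ℂ) (r * ‖η‖ * ‖ξ‖)).ultrafilter_le_nhds'
      (U.map fun a => ⟪Φ a η, ξ⟫_ℂ) (Filter.mem_map.2 (Filter.mem_of_superset Filter.univ_mem
        fun a _ => mem_closedBall_zero_iff.2 (hb ξ η a)))
    exact ⟨z, mem_closedBall_zero_iff.1 hz, h⟩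
  choose f hf hft using hlim
  have huniq : ∀ {ξ η z}, Tendsto (fun a => ⟪Φ a η, ξ⟫_ℂ) U (𝓝 z) → f ξ η = z := fun h =>
    tendsto_nhds_unique (hft _ _) h
  let S : H →L⋆[ℂ] K →L[ℂ] ℂ := LinearMap.mkContinuous₂
    (LinearMap.mk₂'ₛₗ (starRingEnd ℂ) (RingHom.id ℂ) (fun η ξ => f ξ η)
      (fun η η' ξ => huniq (by simpa only [map_add, inner_add_left] using (hft ξ η).add (hft ξ η')))
      (fun c η ξ => huniq (by simpa only [map_smul, inner_smul_left, smul_eq_mul] using (hft ξ η).const_mul _))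
      (fun η ξ ξ' => huniq (by simpa only [inner_add_right] using (hft ξ η).add (hft ξ' η)))
      (fun c η ξ => huniq (by simpa only [inner_smul_right, RingHom.id_apply, smul_eq_mul] using (hft ξ η).const_mul _)))
    r (fun η ξ => hf ξ η)
  have hS : ‖S‖ ≤ r := LinearMap.mkContinuous₂_norm_le _ hr _
  refine ⟨((InnerProductSpace.toDual ℂ K).symm : (K →L[ℂ] ℂ) →L⋆[ℂ] K).comp S, ?_, ?_⟩
  · refine ContinuousLinearMap.opNorm_le_bound _ hr fun η => ?_
    refine ((InnerProductSpace.toDual ℂ K).symm.norm_map (S η)).trans_le ?_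
    exact S.le_of_opNorm_le hS η
  · intro ξ η z hz
    have h1 : ⟪(InnerProductSpace.toDual ℂ K).symm (S η), ξ⟫_ℂ = f ξ η :=
      InnerProductSpace.toDual_symm_apply
    have h2 : f ξ η = (starRingEnd ℂ) z := by
      refine huniq (tendsto_const_nhds.congr' ?_)
      filter_upwards [Ultrafilter.of_le l hz] with a ha
      rw [← ha, inner_conj_symm]
    rw [← inner_conj_symm]
    change (starRingEnd ℂ) ⟪(InnerProductSpace.toDual ℂ K).symm (S η), ξ⟫_ℂ = z
    rw [h1, h2, Complex.conj_conj]

end HilbertSpace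

/-! ### Compressions, adjoints and unit constraints of bilinear maps -/

namespace VNBimodule

variable {G : Type u} [NormedAddCommGroup G] [InnerProductSpace ℂ G] [CompleteSpace G]
  {B : VonNeumannAlgebra G} {X X' Y Y' Z Z' W W' : VNBimodule B}

namespace Hom

theorem app_apply (T : Hom X Y) (x : X.E) (g : G) :
    (T.app x : G →L[ℂ] Y.H) g = T.op ((x : G →L[ℂ] X.H) g) := rfl

/-- The map `g` compresses `P` along `f` to `Q`: that is, `g^* P f = Q`. -/
def IsCompression (g : Hom Y Y') (P : Hom X' Y') (f : Hom X X') (Q : Hom X Y) : Prop :=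
  ∀ y x, ⟪g.op y, P.op (f.op x)⟫_ℂ = ⟪y, Q.op x⟫_ℂ

namespace IsCompression

theorem trans {g : Hom Y Y'} {P : Hom X' Y'} {f : Hom X X'} {Q : Hom X Y} {g' : Hom W Y} {f' : Hom Z X}
    {R : Hom Z W} (h : IsCompression g P f Q) (h' : IsCompression g' Q f' R) :
    IsCompression (g.comp g') P (f.comp f') R := fun y x => (h _ _).trans (h' y x)

theorem of_comm {g : Hom Y Y'} {P : Hom X' Y'} {f : Hom X X'} {Q : Hom X Y}
    (hg : ∀ v, ‖g.op v‖ = ‖v‖) (h : ∀ v, P.op (f.op v) = g.op (Q.op v)) : IsCompression g P f Q :=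
  fun y x => by rw [h, inner_map_of_norm_map hg]

/-- A compression along unitaries is an intertwining. -/
theorem comm {g : Hom Y Y'} {P : Hom X' Y'} {f : Hom X X'} {Q : Hom X Y}
    (h : IsCompression g P f Q) (hg : ∀ v, ‖g.op v‖ = ‖v‖) (hs : Function.Surjective g.op) (v : X.H) :
    P.op (f.op v) = g.op (Q.op v) :=
  ext_inner_left ℂ fun w => by
    obtain ⟨y, rfl⟩ := hs w
    rw [h, inner_map_of_norm_map hg]

/-- Compressions can be tensored: `⟨g₁ y, P₁ f₁ x⟩ = ⟨y, Q₁ x⟩` as elements of `B`, and this element passes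
through the bilinear maps of the second factor. -/
theorem tens {g₁ : Hom Y Y'} {P₁ : Hom X' Y'} {f₁ : Hom X X'} {Q₁ : Hom X Y} {g₂ : Hom W W'}
    {P₂ : Hom Z' W'} {f₂ : Hom Z Z'} {Q₂ : Hom Z W} (h₁ : IsCompression g₁ P₁ f₁ Q₁)
    (h₂ : IsCompression g₂ P₂ f₂ Q₂) :
    IsCompression (g₁.tens g₂) (P₁.tens P₂) (f₁.tens f₂) (Q₁.tens Q₂) := by
  have h : ContinuousLinearMap.adjoint (g₁.tens g₂).op ∘L (P₁.tens P₂).op ∘L (f₁.tens f₂).op =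
      (Q₁.tens Q₂).op := by
    refine clm_ext_inner (X.dense_crea Z.toNormalRep) (Y.dense_crea W.toNormalRep) ?_
    rintro ⟨x, k⟩ ⟨y, l⟩
    change ⟪Y.crea W.toNormalRep y l, ContinuousLinearMap.adjoint (g₁.tens g₂).op ((P₁.tens P₂).op
      ((f₁.tens f₂).op (X.crea Z.toNormalRep x k)))⟫_ℂ = _
    rw [ContinuousLinearMap.adjoint_inner_right]
    rw [tens_crea, tens_crea, tens_crea, tens_crea, inner_crea, inner_crea]
    have h3 : Y'.ip (g₁.app y) (P₁.app (f₁.app x)) = Y.ip y (Q₁.app x) :=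
      Subtype.ext (ContinuousLinearMap.ext fun a => ext_inner_left ℂ fun b => by
        rw [inner_ip, inner_ip]; exact h₁ _ _)
    rw [h3, ← P₂.comm, ← f₂.comm, h₂, Q₂.comm]
  intro y x
  rw [← h]
  exact (ContinuousLinearMap.adjoint_inner_right _ _ _).symm

end IsCompression

theorem norm_tens_le (T : Hom X X') (S : Hom Y Y') : ‖(T.tens S).op‖ ≤ ‖T.op‖ * ‖S.op‖ := by
  refine LinearMap.opNorm_extendOfNorm_le (X.dense_crea Y.toNormalRep) (by positivity) fun c => ?_
  have h1 := X.norm_right_le S.op S.comm c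
  have h2 := norm_left_le X X' Y'.toNormalRep T.app T.op (fun _ => rfl) (c.mapDomain fun p => (p.1, S.op p.2))
  rw [Finsupp.linearCombination_mapDomain, Finsupp.linearCombination_mapDomain] at h2
  calc _ ≤ ‖T.op‖ * _ := h2
    _ ≤ ‖T.op‖ * (‖S.op‖ * _) := by gcongr; exact h1
    _ = _ := (mul_assoc _ _ _).symm

/-- The adjoint of an adjointable bilinear map. -/
noncomputable def adj (T : Hom X Y) (hT : T.Adjointable) : Hom Y X where
  op := ContinuousLinearMap.adjoint T.op
  mem := hT
  comm b v := ext_inner_right ℂ fun w => by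
    have h3 : ∀ X : VNBimodule B, X.π b = ContinuousLinearMap.adjoint (X.π (star b)) := fun X => by
      rw [map_star, ContinuousLinearMap.star_eq_adjoint, ContinuousLinearMap.adjoint_adjoint]
    rw [ContinuousLinearMap.adjoint_inner_left, h3, h3, ContinuousLinearMap.adjoint_inner_left,
      ContinuousLinearMap.adjoint_inner_left, ContinuousLinearMap.adjoint_inner_left, T.comm]

theorem inner_adj (T : Hom X Y) (hT : T.Adjointable) (v : X.H) (w : Y.H) :
    ⟪v, (T.adj hT).op w⟫_ℂ = ⟪T.op v, w⟫_ℂ := ContinuousLinearMap.adjoint_inner_right _ _ _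

theorem adjointable_of_adjoint_eq {T : Hom X Y} {S : Hom Y X} (h : S.op = ContinuousLinearMap.adjoint T.op) :
    T.Adjointable := fun y hy => h ▸ S.mem y hy

theorem Adjointable.comp {T : Hom Y Z} {S : Hom X Y} (hT : T.Adjointable) (hS : S.Adjointable) :
    (T.comp S).Adjointable :=
  adjointable_of_adjoint_eq (S := (S.adj hS).comp (T.adj hT))
    (ContinuousLinearMap.adjoint_comp T.op S.op).symm

theorem Adjointable.tens {T : Hom X X'} {S : Hom Y Y'} (hT : T.Adjointable) (hS : S.Adjointable) :
    (T.tens S).Adjointable := by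
  refine adjointable_of_adjoint_eq (S := (T.adj hT).tens (S.adj hS)) ?_
  refine clm_ext_inner (X'.dense_crea Y'.toNormalRep) (X.dense_crea Y.toNormalRep) ?_
  rintro ⟨x, k⟩ ⟨y, l⟩
  rw [ContinuousLinearMap.adjoint_inner_right, tens_crea, tens_crea, inner_crea, inner_crea]
  have h1 : X.ip y ((T.adj hT).app x) = X'.ip (T.app y) x :=
    Subtype.ext (ContinuousLinearMap.ext fun a => ext_inner_left ℂ fun b => by
      rw [inner_ip, inner_ip, app_apply, app_apply, inner_adj])
  rw [h1, ← (S.adj hS).comm, inner_adj]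

theorem norm_tens_map {T : Hom X X'} {S : Hom Y Y'} (hT : ∀ v, ‖T.op v‖ = ‖v‖) (hS : ∀ v, ‖S.op v‖ = ‖v‖)
    (v : (X.tensor Y).H) : ‖(T.tens S).op v‖ = ‖v‖ := T.tensMap_norm S.op S.comm hT hS v

theorem id_tens_surjective {S : Hom Y Y'} (hS : ∀ v, ‖S.op v‖ = ‖v‖) (hs : Function.Surjective S.op) :
    Function.Surjective ((Hom.id X).tens S).op := by
  refine surjective_of_norm_map (norm_tens_map (fun _ => rfl) hS)
    (denseRange_of_linearCombination (X.dense_crea Y'.toNormalRep) _ ?_)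
  rintro ⟨x, k⟩
  obtain ⟨l, rfl⟩ := hs k
  exact ⟨_, tens_crea _ _ x l⟩

theorem assoc_surjective (X Y Z : VNBimodule B) : Function.Surjective (Hom.assoc X Y Z).op := by
  have ht : (⊤ : Submodule ℂ (X.tensor (Y.tensor Z)).H) ≤ (LinearMap.range (Hom.assoc X Y Z).op.toLinearMap) := by
    have hc : IsClosed (Set.range (Hom.assoc X Y Z).op) :=
      (AddMonoidHomClass.isometry_of_norm _ (X.assoc_norm Y Z.toNormalRep)).isClosedEmbedding.isClosed_range
    refine (X.crea_total (Y.tensor Z).toNormalRep _ hc fun x k => ?_).ge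
    have := Y.crea_total Z.toNormalRep ((LinearMap.range (Hom.assoc X Y Z).op.toLinearMap).comap
      (X.crea (Y.tensor Z).toNormalRep x).toLinearMap)
      (hc.preimage (X.crea (Y.tensor Z).toNormalRep x).continuous)
      fun y l => ⟨_, assoc_elem X Y Z x y l⟩
    have hk : k ∈ (⊤ : Submodule ℂ (Y.tensor Z).H) := trivial
    rw [← this] at hk
    exact hk
  exact fun v => ht trivial

theorem leftUnit_crea (b : (unit B).E) (k : X.H) :
    (leftUnit X).op ((unit B).crea X.toNormalRep b k) = X.π (ofUnit b) k := X.leftUnitOp_crea b k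

theorem rightUnit_apply (x : X.E) (g : G) : (rightUnit X).op ((x : G →L[ℂ] X.H) g) =
    X.crea (unit B).toNormalRep x g := X.rightUnitOp_apply x g

theorem norm_leftUnit (v : ((unit B).tensor X).H) : ‖(leftUnit X).op v‖ = ‖v‖ := by
  refine norm_map_of_inner ((unit B).dense_crea X.toNormalRep) _ ?_ v
  rintro ⟨b, k⟩ ⟨b', k'⟩
  rw [leftUnit_crea, leftUnit_crea, inner_crea, ← ContinuousLinearMap.adjoint_inner_right,
    ← ContinuousLinearMap.star_eq_adjoint, ← map_star, ← mul_apply_eq_comp, ← map_mul]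
  rfl

theorem leftUnit_surjective : Function.Surjective (leftUnit X).op := fun k =>
  ⟨_, (leftUnit_crea ⟨1, B.toStarSubalgebra.one_mem⟩ k).trans (by
    rw [show ofUnit ⟨1, B.toStarSubalgebra.one_mem⟩ = (1 : B.toStarSubalgebra) from rfl, map_one]; rfl)⟩

theorem norm_rightUnit (v : X.H) : ‖(rightUnit X).op v‖ = ‖v‖ := by
  refine norm_map_of_inner X.dense_apply _ ?_ v
  rintro ⟨x, g⟩ ⟨y, h⟩
  rw [rightUnit_apply, rightUnit_apply, inner_crea]
  exact X.inner_ip x y g h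

theorem rightUnit_surjective : Function.Surjective (rightUnit X).op :=
  surjective_of_norm_map norm_rightUnit (denseRange_of_linearCombination
    (X.dense_crea (unit B).toNormalRep) _ fun p => ⟨_, rightUnit_apply p.1 p.2⟩)

theorem leftUnit_natural (T : Hom X Y) : (leftUnit Y).comp ((Hom.id (unit B)).tens T) = T.comp (leftUnit X) :=
  tens_ext fun b k => by
    change (leftUnit Y).op (((Hom.id (unit B)).tens T).op _) = T.op ((leftUnit X).op _)
    rw [tens_crea, leftUnit_crea, leftUnit_crea, T.comm]; rfl

theorem rightUnit_natural (T : Hom X Y) (v : X.H) :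
    (T.tens (Hom.id (unit B))).op ((rightUnit X).op v) = (rightUnit Y).op (T.op v) := by
  refine DFunLike.congr_fun (clm_ext_of_denseRange X.dense_apply
    (S := (T.tens (Hom.id (unit B))).op ∘L (rightUnit X).op) (T := (rightUnit Y).op ∘L T.op) fun p => ?_) v
  change (T.tens (Hom.id (unit B))).op ((rightUnit X).op _) = (rightUnit Y).op (T.op _)
  rw [rightUnit_apply, tens_crea, ← app_apply, rightUnit_apply]
  rfl

/-- The triangle identity `(b ⊙ y) ⊙ z ↦ b (y ⊙ z)`. -/
theorem leftUnit_assoc (Y Z : VNBimodule B) : (leftUnit (Y.tensor Z)).comp (Hom.assoc (unit B) Y Z) =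
    (leftUnit Y).tens (Hom.id Z) :=
  tens_ext₂ fun b y k => by
    change (leftUnit (Y.tensor Z)).op ((Hom.assoc (unit B) Y Z).op _) = _
    rw [assoc_elem, leftUnit_crea, tens_crea, tens_π_crea]
    congr 1
    refine congrArg _ (ext_apply fun g => ?_)
    exact (leftUnit_crea b _).symm

end Hom

end VNBimodule

/-! ### Inductive limits -/

namespace VNSystem

variable {G : Type u} [NormedAddCommGroup G] [InnerProductSpace ℂ G] [CompleteSpace G]
  {B : VonNeumannAlgebra G} (D : VNSystem B)

open VNBimodule

/-- The filter of the tails `{j | i ≤ j}` of the index set of an inductive system; convergence along it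
is convergence of nets. -/
def tails : Filter D.J where
  sets := {s | ∃ i, ∀ j, (∃ f, D.Map i j f) → j ∈ s}
  univ_sets := ⟨D.nonempty.some, fun _ _ => trivial⟩
  sets_of_superset := fun ⟨i, h⟩ hst => ⟨i, fun j hj => hst (h j hj)⟩
  inter_sets := by
    rintro s t ⟨i, hi⟩ ⟨j, hj⟩
    obtain ⟨k, f, g, hf, hg⟩ := D.directed i j
    exact ⟨k, fun l ⟨a, ha⟩ => ⟨hi l ⟨_, D.trans hf ha⟩, hj l ⟨_, D.trans hg ha⟩⟩⟩

theorem eventually_tails {p : D.J → Prop} :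
    (∀ᶠ j in D.tails, p j) ↔ ∃ i, ∀ j, (∃ f, D.Map i j f) → p j := Iff.rfl

instance tails_neBot : D.tails.NeBot := by
  refine ⟨fun h => ?_⟩
  obtain ⟨i, hi⟩ := Filter.empty_mem_iff_bot.2 h
  obtain ⟨k, f, -, hf, -⟩ := D.directed i i
  exact hi k ⟨f, hf⟩

theorem exists_norm_sub_incl_lt (ξ : D.lim.H) {ε : ℝ} (hε : 0 < ε) : ∃ i v, ‖ξ - D.incl i v‖ < ε := by
  obtain ⟨c, hc⟩ := D.dense_incl.exists_dist_lt ξ hε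
  obtain ⟨k, v, hv, -⟩ := D.exists_rep 0 c
  rw [dist_eq_norm, hv] at hc
  exact ⟨k, v, hc⟩

/-- The range projections of the canonical isometries converge strongly to the identity. -/
theorem tendsto_incl_adjoint (ξ : D.lim.H) :
    Tendsto (fun i => (D.inc i).op (ContinuousLinearMap.adjoint (D.inc i).op ξ)) D.tails (𝓝 ξ) := by
  rw [Metric.tendsto_nhds]
  intro ε hε
  obtain ⟨i, v, hv⟩ := D.exists_norm_sub_incl_lt ξ hε
  refine D.eventually_tails.2 ⟨i, fun j ⟨f, hf⟩ => ?_⟩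
  rw [dist_eq_norm]
  refine (norm_sub_range_proj_le (V := (D.inc j).op) (D.norm_incl j) ξ (f.op v)).trans_lt ?_
  rwa [← D.incl_map hf] at hv

theorem algLim_isCore : D.lim.IsCore D.algLim where
  le := le_sotClosure _
  right p hp b := by
    unfold algLim at hp ⊢
    induction hp using Submodule.span_induction with
    | mem p hp =>
      obtain ⟨i, x, rfl⟩ := hp
      exact Submodule.subset_span ⟨i, (D.X i).ract x b, rfl⟩
    | zero => simp
    | add p q _ _ h1 h2 => rw [ContinuousLinearMap.add_comp]; exact add_mem h1 h2
    | smul c p _ h => rw [ContinuousLinearMap.smul_comp]; exact Submodule.smul_mem _ _ h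
  total := by
    rw [eq_top_iff, ← D.lim.total]
    refine Submodule.topologicalClosure_minimal _ (Submodule.span_le.2 ?_)
      (Submodule.isClosed_topologicalClosure _)
    rintro _ ⟨z, hz, g, rfl⟩
    exact sotClosure_induction (C := {φ : G → D.lim.H | φ g ∈ (Submodule.span ℂ
      {h | ∃ x ∈ D.algLim, ∃ g : G, h = x g}).topologicalClosure})
      ((Submodule.isClosed_topologicalClosure _).preimage (continuous_apply g))
      (fun y hy => Submodule.le_topologicalClosure _ (Submodule.subset_span ⟨y, hy, g, rfl⟩)) hz

/-- A closed linear condition on the operators `k ↦ z ⊗ k`, for `z` in the limit, has to be checked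
only for the `z` that come from a member of the system. -/
theorem crea_inc_induction (K : NormalRep B) (C : Submodule ℂ (K.H → (D.lim.tens K).H))
    (hC : IsClosed (C : Set (K.H → (D.lim.tens K).H)))
    (h : ∀ i x, (fun k => D.lim.crea K ((D.inc i).app x) k) ∈ C) (z : D.lim.E) :
    (fun k => D.lim.crea K z k) ∈ C := by
  refine crea_induction D.lim D.algLim D.algLim_isCore K hC ?_ z
  rintro ⟨p, hp'⟩ hp
  change p ∈ D.algLim at hp
  unfold algLim at hp
  induction hp using Submodule.span_induction with
  | mem p hp =>
    obtain ⟨i, x, rfl⟩ := hp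
    exact h i x
  | zero =>
    have : (fun k => D.lim.crea K ⟨0, hp'⟩ k) = 0 := by
      ext1 k
      have := D.lim.tmul_smul_left K 0 0 k
      rw [zero_smul, zero_smul] at this
      exact this
    exact this ▸ zero_mem _
  | add p q h1' h2' h1 h2 =>
    have : (fun k => D.lim.crea K ⟨p + q, hp'⟩ k) =
        (fun k => D.lim.crea K ⟨p, le_sotClosure _ h1'⟩ k) +
        (fun k => D.lim.crea K ⟨q, le_sotClosure _ h2'⟩ k) := by
      ext1 k
      exact D.lim.tmul_add_left K ⟨p, le_sotClosure _ h1'⟩ ⟨q, le_sotClosure _ h2'⟩ k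
    exact this ▸ add_mem (h1 _) (h2 _)
  | smul c p h1' h1 =>
    have : (fun k => D.lim.crea K ⟨c • p, hp'⟩ k) =
        c • (fun k => D.lim.crea K ⟨p, le_sotClosure _ h1'⟩ k) := by
      ext1 k
      exact D.lim.tmul_smul_left K c ⟨p, le_sotClosure _ h1'⟩ k
    exact this ▸ Submodule.smul_mem _ _ (h1 _)

/-- The vectors `i_j x ⊗ i_m k` are total in the tensor product of two limits. -/
theorem dense_crea_inc (D' : VNSystem B) : DenseRange (Finsupp.linearCombination ℂ
    (fun p : Σ (i : D.J) (m : D'.J), (D.X i).E × (D'.X m).H =>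
      D.lim.crea D'.lim.toNormalRep ((D.inc p.1).app p.2.2.1) ((D'.inc p.2.1).op p.2.2.2))) := by
  set e := fun p : Σ (i : D.J) (m : D'.J), (D.X i).E × (D'.X m).H =>
      D.lim.crea D'.lim.toNormalRep ((D.inc p.1).app p.2.2.1) ((D'.inc p.2.1).op p.2.2.2)
  have hcl := Submodule.isClosed_topologicalClosure (Submodule.span ℂ (Set.range e))
  have h1 : ∀ i x k, D.lim.crea D'.lim.toNormalRep ((D.inc i).app x) k ∈
      (Submodule.span ℂ (Set.range e)).topologicalClosure := by
    intro i x k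
    refine D'.dense_incl.induction_on (p := fun k => D.lim.crea D'.lim.toNormalRep ((D.inc i).app x) k ∈
      (Submodule.span ℂ (Set.range e)).topologicalClosure) k
      (hcl.preimage (D.lim.crea D'.lim.toNormalRep ((D.inc i).app x)).continuous) fun c => ?_
    rw [Finsupp.linearCombination_apply, Finsupp.sum, map_sum]
    refine Submodule.sum_mem _ fun p _ => ?_
    rw [map_smul]
    exact Submodule.smul_mem _ _ (Submodule.le_topologicalClosure _
      (Submodule.subset_span ⟨⟨i, p.1, x, p.2⟩, rfl⟩))
  have h2 : (Submodule.span ℂ (Set.range e)).topologicalClosure = ⊤ :=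
    D.lim.crea_total D'.lim.toNormalRep _ hcl fun z k =>
      D.crea_inc_induction D'.lim.toNormalRep (Submodule.comap
        (LinearMap.proj (R := ℂ) (φ := fun _ : D'.lim.H => (D.lim.tens D'.lim.toNormalRep).H) k)
        (Submodule.span ℂ (Set.range e)).topologicalClosure)
        (hcl.preimage (continuous_apply (A := fun _ : D'.lim.H => (D.lim.tens D'.lim.toNormalRep).H) k))
        (fun i x => h1 i x k) z
  rw [DenseRange, ← LinearMap.coe_range, Finsupp.range_linearCombination,
    Submodule.dense_iff_topologicalClosure_eq_top]
  exact h2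

end VNSystem

/-! ### Concatenation of refinements -/

namespace VNBimodule.Hom

variable {G : Type u} [NormedAddCommGroup G] [InnerProductSpace ℂ G] [CompleteSpace G]
  {B : VonNeumannAlgebra G} {R S S' M M' L L' N P : VNBimodule B}

theorem tens_comp_apply {X X' X'' Y Y' Y'' : VNBimodule B} (a : Hom X' X'') (b : Hom X X') (c : Hom Y' Y'')
    (d : Hom Y Y') (v : (X.tensor Y).H) :
    ((a.comp b).tens (c.comp d)).op v = (a.tens c).op ((b.tens d).op v) :=
  congrArg (fun T => T.op v) (Hom.tens_comp a b c d)

theorem id_tens_congr {X Y Z W V : VNBimodule B} {a : Hom Y Z} {b : Hom X Y} {c : Hom W Z} {d : Hom X W}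
    (h : a.comp b = c.comp d) (v : (V.tensor X).H) :
    ((id V).tens a).op (((id V).tens b).op v) = ((id V).tens c).op (((id V).tens d).op v) := by
  rw [← tens_comp_apply, ← tens_comp_apply, h]

theorem keep_conc (c : Hom (M.tensor M') N) (d : Hom (L.tensor L') P) (F : Hom N P) (f : Hom M L)
    (f' : Hom M' L') (e : F.comp c = d.comp (f.tens f')) :
    ((id R).tens F).comp (((id R).tens c).comp (assoc R M M')) =
      (((id R).tens d).comp (assoc R L L')).comp (((id R).tens f).tens f') :=
  ext_op fun v => by
    change ((id R).tens F).op (((id R).tens c).op ((assoc R M M').op v)) =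
      ((id R).tens d).op ((assoc R L L').op ((((id R).tens f).tens f').op v))
    rw [id_tens_congr e, op_congr (assoc_natural (id R) f f')]

theorem split_conc (β : Hom S (R.tensor S')) (f : Hom (S'.tensor M) L) (f' : Hom M' L')
    (c : Hom (M.tensor M') N) (d : Hom (L.tensor L') P) (F : Hom (S'.tensor N) P)
    (e : F.comp (((id S').tens c).comp (assoc S' M M')) = d.comp (f.tens f')) :
    (((id R).tens F).comp ((assoc R S' N).comp (β.tens (id N)))).comp (((id S).tens c).comp (assoc S M M')) =
      (((id R).tens d).comp (assoc R L L')).comp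
        ((((id R).tens f).comp ((assoc R S' M).comp (β.tens (id M)))).tens f') := by
  -- the splitting of the first factor is natural in the remaining ones
  have h1 : (β.tens (id N)).comp ((id S).tens c) =
      (((id R).tens (id S')).tens c).comp (β.tens (id (M.tensor M'))) := by
    rw [id_tens_id]
    exact (tens_comp β (id S) (id N) c).symm.trans (tens_comp (id _) β c (id _))
  have h2 := assoc_natural (id R) (id S') c
  have h3 := assoc_natural β (id M) (id M')
  rw [id_tens_id] at h3
  have h4 : ∀ v, (assoc R S' (M.tensor M')).op ((assoc (R.tensor S') M M').op v) =
      ((id R).tens (assoc S' M M')).op ((assoc R (S'.tensor M) M').op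
        (((assoc R S' M).tens (id M')).op v)) := op_congr (pentagon R S' M M')
  have h5 := assoc_natural (id R) f f'
  have h6 : ∀ w, ((((id R).tens f).comp ((assoc R S' M).comp (β.tens (id M)))).tens f').op w =
      (((id R).tens f).tens f').op (((assoc R S' M).tens (id M')).op
        (((β.tens (id M)).tens (id M')).op w)) := fun w => by
    rw [← tens_comp_apply, ← tens_comp_apply]; rfl
  have h7 : ∀ w, ((id R).tens F).op (((id R).tens ((id S').tens c)).op (((id R).tens (assoc S' M M')).op w)) =
      ((id R).tens d).op (((id R).tens (f.tens f')).op w) := fun w =>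
    (congrArg _ (tens_comp_apply (id R) (id R) ((id S').tens c) (assoc S' M M') w).symm).trans
      (id_tens_congr e w)
  refine ext_op fun v => ?_
  change ((id R).tens F).op ((assoc R S' N).op ((β.tens (id N)).op
    (((id S).tens c).op ((assoc S M M').op v)))) =
    ((id R).tens d).op ((assoc R L L').op (Hom.op _ v))
  rw [op_congr h1, op_congr h2, ← op_congr h3, h4, h6, op_congr h5, ← h7]

end VNBimodule.Hom

namespace InclusionSystem

variable {G : Type u} [NormedAddCommGroup G] [InnerProductSpace ℂ G] [CompleteSpace G]
  {B : VonNeumannAlgebra G} {𝕋 : TimeSet}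

open VNBimodule

/-- Whether a tuple refines another one does not depend on the inclusion system. -/
theorem Refine.transfer {I : InclusionSystem B 𝕋} (I' : InclusionSystem B 𝕋) {m l : List 𝕋.pts}
    {f : Hom (I.tuple m) (I.tuple l)} (h : I.Refine m l f) : ∃ g, I'.Refine m l g := by
  induction h with
  | nil => exact ⟨_, .nil⟩
  | keep s _ ih => obtain ⟨g, hg⟩ := ih; exact ⟨_, hg.keep s⟩
  | split hr hs h _ ih => obtain ⟨g, hg⟩ := ih; exact ⟨_, hg.split hr hs h⟩

variable {I : InclusionSystem B 𝕋}

theorem norm_conc (l m : List 𝕋.pts) (v) : ‖(I.conc l m).op v‖ = ‖v‖ := by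
  induction l with
  | nil => exact Hom.norm_leftUnit v
  | cons s l ih =>
    refine (Hom.norm_tens_map (fun _ => rfl) ih _).trans ?_
    exact VNBimodule.assoc_norm _ _ _ v

theorem conc_surjective (l m : List 𝕋.pts) : Function.Surjective (I.conc l m).op := by
  induction l with
  | nil => exact Hom.leftUnit_surjective
  | cons s l ih =>
    exact (Hom.id_tens_surjective (norm_conc l m) ih).comp (Hom.assoc_surjective _ _ _)

/-- Refinements can be concatenated, and their isometries are then tensored. -/
theorem Refine.append {m l : List 𝕋.pts} {f : Hom (I.tuple m) (I.tuple l)} (h : I.Refine m l f)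
    {m' l' : List 𝕋.pts} {f' : Hom (I.tuple m') (I.tuple l')} (h' : I.Refine m' l' f') :
    ∃ F, I.Refine (m ++ m') (l ++ l') F ∧ F.comp (I.conc m m') = (I.conc l l').comp (f.tens f') := by
  induction h with
  | nil => exact ⟨f', h', (Hom.leftUnit_natural f').symm⟩
  | @keep m l s f h ih =>
    obtain ⟨F, hF, e⟩ := ih
    exact ⟨_, hF.keep s, Hom.keep_conc (I.conc m m') (I.conc l l') F f f' e⟩
  | @split m l r s' s hr hs h f hf ih =>
    obtain ⟨F, hF, e⟩ := ih
    exact ⟨_, hF.split hr hs h, Hom.split_conc (I.β h) f f' (I.conc m m') (I.conc l l') F e⟩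

/-- A refinement of a concatenation is a concatenation of refinements. -/
theorem Refine.exists_append {a m' p : List 𝕋.pts} {f : Hom (I.tuple a) (I.tuple p)} (h : I.Refine a p f) :
    ∀ m, a = m ++ m' → ∃ l l' g g', p = l ++ l' ∧ I.Refine m l g ∧ I.Refine m' l' g' := by
  induction h with
  | nil =>
    intro m e
    obtain ⟨rfl, rfl⟩ := List.append_eq_nil_iff.1 e.symm
    exact ⟨[], [], _, _, rfl, .nil, .nil⟩
  | @keep a p s f h ih =>
    intro m e
    cases m with
    | nil => obtain rfl : _ = m' := e; exact ⟨[], s :: p, _, _, rfl, .nil, h.keep s⟩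
    | cons r m =>
      obtain ⟨rfl, rfl⟩ := List.cons.inj e
      obtain ⟨l, l', g, g', rfl, hg, hg'⟩ := ih m rfl
      exact ⟨s :: l, l', _, _, rfl, hg.keep s, hg'⟩
  | @split a p r s' s hr hs h f hf ih =>
    intro m e
    cases m with
    | nil => obtain rfl : _ = m' := e; exact ⟨[], r :: p, _, _, rfl, .nil, hf.split hr hs h⟩
    | cons q m =>
      obtain ⟨rfl, rfl⟩ := List.cons.inj e
      obtain ⟨l, l', g, g', rfl, hg, hg'⟩ := ih (s' :: m) rfl
      exact ⟨r :: l, l', _, _, rfl, hg.split hr hs h, hg'⟩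

end InclusionSystem

namespace InclusionSystem

variable {G : Type u} [NormedAddCommGroup G] [InnerProductSpace ℂ G] [CompleteSpace G]
  {B : VonNeumannAlgebra G} {𝕋 : TimeSet}

open VNBimodule

theorem Refine.sum_eq {I : InclusionSystem B 𝕋} {m l : List 𝕋.pts} {f : Hom (I.tuple m) (I.tuple l)}
    (h : I.Refine m l f) : l.sum = m.sum := by
  induction h with
  | nil => rfl
  | keep s _ ih => rw [List.sum_cons, List.sum_cons, ih]
  | split _ _ h _ ih => rw [List.sum_cons, ih, List.sum_cons, List.sum_cons, ← add_assoc, h]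

/-! ### The product of the generated system -/

section Product

variable (I : InclusionSystem B 𝕋) {s t u : 𝕋.pts}

theorem norm_incTup (l : Tup t) (v) : ‖(I.incTup l).op v‖ = ‖v‖ := (I.sys t).norm_incl l v

theorem incTup_refine {m l : Tup t} {f : Hom (I.tuple m.1) (I.tuple l.1)} (h : I.Refine m.1 l.1 f) (v) :
    (I.incTup l).op (f.op v) = (I.incTup m).op v := (I.sys t).incl_map h v

theorem exists_refine_pair (l m : Tup t) : ∃ (p : Tup t) (f : _) (g : _),
    I.Refine l.1 p.1 f ∧ I.Refine m.1 p.1 g := (I.sys t).directed l m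

/-- Any tuple is refined by a concatenation of tuples with given sums, and these may be chosen to refine
given tuples. -/
theorem exists_refine_append (h : s + t = u) (n : Tup u) (l : Tup s) (m : Tup t) :
    ∃ (l' : Tup s) (m' : Tup t) (f : _) (g : _) (k : _), I.Refine l.1 l'.1 f ∧ I.Refine m.1 m'.1 g ∧
      I.Refine n.1 (l'.append h m').1 k := by
  obtain ⟨p, f, g, hf, hg⟩ := I.exists_refine_pair (l.append h m) n
  obtain ⟨l', m', f', g', e, hf', hg'⟩ := hf.exists_append l.1 rfl
  have hp := p.2.1
  rw [e] at hp
  refine ⟨⟨l', fun r hr => hp r (List.mem_append_left _ hr), hf'.sum_eq.trans l.2.2⟩,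
    ⟨m', fun r hr => hp r (List.mem_append_right _ hr), hg'.sum_eq.trans m.2.2⟩, f', g',
    ?_⟩
  obtain ⟨p, hp'⟩ := p
  dsimp only at e
  subst e
  exact ⟨g, hf', hg', hg⟩

/-- The family of vectors on which the product is defined is mapped isometrically. -/
theorem inner_prod_family (h : s + t = u) (l l' : Tup s) (m m' : Tup t) (x : (I.tuple l.1).E)
    (x' : (I.tuple l'.1).E) (k : (I.tuple m.1).H) (k' : (I.tuple m'.1).H) :
    ⟪(I.incTup (l.append h m)).op ((I.conc l.1 m.1).op
        ((I.tuple l.1).crea (I.tuple m.1).toNormalRep x k)),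
      (I.incTup (l'.append h m')).op ((I.conc l'.1 m'.1).op
        ((I.tuple l'.1).crea (I.tuple m'.1).toNormalRep x' k'))⟫_ℂ =
    ⟪(I.gen s).crea (I.gen t).toNormalRep ((I.incTup l).app x) ((I.incTup m).op k),
      (I.gen s).crea (I.gen t).toNormalRep ((I.incTup l').app x') ((I.incTup m').op k')⟫_ℂ := by
  -- both pairs of tuples are replaced by a common refinement
  obtain ⟨p, f, f', hf, hf'⟩ := I.exists_refine_pair l l'
  obtain ⟨q, g, g', hg, hg'⟩ := I.exists_refine_pair m m'
  have key : ∀ {l : Tup s} {m : Tup t} {f g} (hf : I.Refine l.1 p.1 f) (hg : I.Refine m.1 q.1 g)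
      (x : (I.tuple l.1).E) (k : (I.tuple m.1).H), (I.incTup (l.append h m)).op ((I.conc l.1 m.1).op
        ((I.tuple l.1).crea (I.tuple m.1).toNormalRep x k)) =
      (I.incTup (p.append h q)).op ((I.conc p.1 q.1).op
        ((I.tuple p.1).crea (I.tuple q.1).toNormalRep (f.app x) (g.op k))) ∧
      (I.gen s).crea (I.gen t).toNormalRep ((I.incTup l).app x) ((I.incTup m).op k) =
      (I.gen s).crea (I.gen t).toNormalRep ((I.incTup p).app (f.app x)) ((I.incTup q).op (g.op k)) := by
    intro l m f g hf hg x k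
    obtain ⟨F, hF, e⟩ := hf.append hg
    constructor
    · rw [← Hom.tens_crea, ← Hom.op_congr e]
      exact (I.incTup_refine (m := l.append h m) (l := p.append h q) hF _).symm
    · rw [I.incTup_refine hg]
      congr 1
      refine congrArg _ (ext_apply fun a => ?_)
      exact (I.incTup_refine hf _).symm
  rw [(key hf hg x k).1, (key hf' hg' x' k').1, (key hf hg x k).2, (key hf' hg' x' k').2]
  refine (inner_map_of_norm_map (I.norm_incTup (p.append h q)) _ _).trans
    ((inner_map_of_norm_map (norm_conc _ _) _ _).trans ?_)
  rw [inner_crea, inner_crea]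
  have hip : (I.gen s).ip ((I.incTup p).app (f.app x)) ((I.incTup p).app (f'.app x')) =
      (I.tuple p.1).ip (f.app x) (f'.app x') :=
    Subtype.ext (ContinuousLinearMap.ext fun a => ext_inner_left ℂ fun b => by
      rw [inner_ip, inner_ip]; exact inner_map_of_norm_map (I.norm_incTup p) _ _)
  rw [hip, ← (I.incTup q).comm, inner_map_of_norm_map (I.norm_incTup q)]

theorem prod_crea (h : s + t = u) (l : Tup s) (m : Tup t) (x : (I.tuple l.1).E) (k : (I.tuple m.1).H) :
    I.prod h ((I.gen s).crea (I.gen t).toNormalRep ((I.incTup l).app x) ((I.incTup m).op k)) =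
      (I.incTup (l.append h m)).op ((I.conc l.1 m.1).op
        ((I.tuple l.1).crea (I.tuple m.1).toNormalRep x k)) :=
  extendMap_apply' (ι := Σ (l : Tup s) (m : Tup t), (I.tuple l.1).E × (I.tuple m.1).H)
    (e := fun p => (I.gen s).crea (I.gen t).toNormalRep ((I.incTup p.1).app p.2.2.1)
      ((I.incTup p.2.1).op p.2.2.2))
    (f := fun p => (I.incTup (p.1.append h p.2.1)).op ((I.conc p.1.1 p.2.1.1).op
      ((I.tuple p.1.1).crea (I.tuple p.2.1.1).toNormalRep p.2.2.1 p.2.2.2)))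
    ((I.sys s).dense_crea_inc (I.sys t)) (fun _ _ => I.inner_prod_family h _ _ _ _ _ _ _ _) ⟨l, m, x, k⟩

theorem norm_prod (h : s + t = u) (v) : ‖I.prod h v‖ = ‖v‖ := by
  refine norm_map_of_inner ((I.sys s).dense_crea_inc (I.sys t)) (I.prod h) ?_ v
  rintro ⟨l, m, x, k⟩ ⟨l', m', x', k'⟩
  refine (congrArg₂ _ (I.prod_crea h l m x k) (I.prod_crea h l' m' x' k')).trans ?_
  exact I.inner_prod_family h _ _ _ _ _ _ _ _

/-- The product, restricted to the members of the inductive systems, is concatenation. -/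
theorem prod_tens (h : s + t = u) (l : Tup s) (m : Tup t) (v : ((I.tuple l.1).tensor (I.tuple m.1)).H) :
    I.prod h (((I.incTup l).tens (I.incTup m)).op v) =
      (I.incTup (l.append h m)).op ((I.conc l.1 m.1).op v) := by
  refine DFunLike.congr_fun (clm_ext_of_denseRange ((I.tuple l.1).dense_crea (I.tuple m.1).toNormalRep)
    (S := I.prod h ∘L ((I.incTup l).tens (I.incTup m)).op)
    (T := (I.incTup (l.append h m)).op ∘L (I.conc l.1 m.1).op) fun p => ?_) v
  change I.prod h (((I.incTup l).tens (I.incTup m)).op _) = _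
  rw [Hom.tens_crea, prod_crea]
  rfl

/-- The product maps the module `𝓔_s ⊙ 𝓔_t` into `𝓔_{s+t}`. -/
theorem prod_mem (h : s + t = u) (z) (hz : z ∈ ((I.gen s).tensor (I.gen t)).E) :
    I.prod h ∘L z ∈ (I.gen u).E := by
  refine sotClosure_le_of_span (E' := (I.sys u).algLim) (I.prod h) (ContinuousLinearMap.id ℂ G) ?_ hz
  rintro _ ⟨x, y, rfl⟩
  let L : ((I.gen t).H → ((I.gen s).tens (I.gen t).toNormalRep).H) →ₗ[ℂ] (G → (I.gen u).H) :=
    { toFun := fun φ g => I.prod h (φ ((y : G →L[ℂ] (I.gen t).H) g))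
      map_add' := fun φ ψ => by ext1 g; exact map_add _ _ _
      map_smul' := fun c φ => by ext1 g; exact (I.prod h).map_smul _ _ }
  have hL : Continuous L := continuous_pi fun g =>
    (I.prod h).continuous.comp (continuous_apply _)
  refine (I.sys s).crea_inc_induction (I.gen t).toNormalRep (Submodule.comap L
    (Submodule.topologicalClosure (Submodule.map (LinearMap.ltoFun ℂ G _ ℂ)
      (Submodule.map (ContinuousLinearMap.coeLM ℂ) (I.sys u).algLim))))
    ((Submodule.isClosed_topologicalClosure _).preimage hL) (fun l x => ?_) x
  refine sotClosure_le_of_span (E' := (I.sys u).algLim)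
    (I.prod h ∘L (I.gen s).crea (I.gen t).toNormalRep ((I.incTup l).app x))
    (ContinuousLinearMap.id ℂ G) ?_ y.2
  rintro _ ⟨m, y, rfl⟩
  refine le_sotClosure _ (Submodule.subset_span ⟨Tup.append h l m,
    (I.conc l.1 m.1).app ((I.tuple l.1).elem (I.tuple m.1) x y), ?_⟩)
  exact ContinuousLinearMap.ext fun g => I.prod_crea h l m x _

end Product

end InclusionSystem

namespace InclusionSystem

variable {G : Type u} [NormedAddCommGroup G] [InnerProductSpace ℂ G] [CompleteSpace G]
  {B : VonNeumannAlgebra G} {𝕋 : TimeSet}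

open VNBimodule

/-! ### The identification of the time-zero module with the algebra -/

section Vacuum

variable (I : InclusionSystem B 𝕋)

/-- The identification `B = E_0`, `b ↦ vac b`, inverse to `vacHom`. -/
noncomputable def vacUnit : Hom (unit B) (I.E 0) where
  op := (I.vac : G →L[ℂ] (I.E 0).H)
  mem b hb := (I.E 0).right_mem _ I.vac.2 ⟨b, hb⟩
  comm b g := (DFunLike.congr_fun (congrArg Subtype.val (I.vac_comm b)) g).symm

theorem vacHom_vacUnit (g : G) : I.vacHom.op (I.vacUnit.op g) = g :=
  DFunLike.congr_fun (congrArg Subtype.val I.vac_left) g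

theorem vacUnit_vacHom (v : (I.E 0).H) : I.vacUnit.op (I.vacHom.op v) = v :=
  DFunLike.congr_fun I.vac_right v

theorem norm_vacUnit (g : G) : ‖I.vacUnit.op g‖ = ‖g‖ :=
  (ContinuousLinearMap.norm_map_iff_adjoint_comp_self I.vacUnit.op).2 (congrArg Subtype.val I.vac_left) g

theorem norm_vacHom (v : (I.E 0).H) : ‖I.vacHom.op v‖ = ‖v‖ := by
  rw [← norm_vacUnit, vacUnit_vacHom]

theorem inner_vacUnit (g : G) (v : (I.E 0).H) : ⟪I.vacUnit.op g, v⟫_ℂ = ⟪g, I.vacHom.op v⟫_ℂ :=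
  (ContinuousLinearMap.adjoint_inner_right _ _ _).symm

theorem β_zero_left_op (t : 𝕋.pts) (v : (I.E t).H) :
    (I.β (zero_add t)).op v = (I.E 0).crea (I.E t).toNormalRep I.vac v :=
  DFunLike.congr_fun (clm_ext_of_denseRange (I.E t).dense_apply
    (S := (I.β (zero_add t)).op) (T := (I.E 0).crea (I.E t).toNormalRep I.vac) fun p =>
      DFunLike.congr_fun (congrArg Subtype.val (I.β_zero_left t p.1)) p.2) v

theorem β_leftUnit (t : 𝕋.pts) :
    (I.β (zero_add t)).comp (Hom.leftUnit (I.E t)) = I.vacUnit.tens (Hom.id (I.E t)) :=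
  Hom.tens_ext fun b k => by
    change (I.β (zero_add t)).op ((Hom.leftUnit (I.E t)).op _) = _
    rw [Hom.leftUnit_crea, β_zero_left_op, Hom.tens_crea, ← crea_ract]
    rfl

theorem β_zero_right_op (t : 𝕋.pts) (v : (I.E t).H) :
    (I.β (add_zero t)).op v = ((Hom.id (I.E t)).tens I.vacUnit).op ((Hom.rightUnit (I.E t)).op v) := by
  refine DFunLike.congr_fun (clm_ext_of_denseRange (I.E t).dense_apply
    (S := (I.β (add_zero t)).op)
    (T := ((Hom.id (I.E t)).tens I.vacUnit).op ∘L (Hom.rightUnit (I.E t)).op) fun p => ?_) v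
  change _ = ((Hom.id (I.E t)).tens I.vacUnit).op ((Hom.rightUnit (I.E t)).op _)
  rw [Hom.rightUnit_apply, Hom.tens_crea]
  exact DFunLike.congr_fun (congrArg Subtype.val (I.β_zero_right t p.1)) p.2

end Vacuum

/-! ### The maps on tuples given by a morphism -/

section Morphism

variable {E F : InclusionSystem B 𝕋} (T : ∀ t, Hom (E.E t) (F.E t))

/-- The map `T_0`, read as a map from `B` to `B`. For a morphism it is the multiplication
by a central projection, which need not be the identity. -/
noncomputable def vacMap : Hom (unit B) (unit B) := F.vacHom.comp ((T 0).comp E.vacUnit)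

/-- The map `T_𝔱`, with the modification that the map of the empty tuple is `T_0`, read as a map from
`B` to `B`, and not the identity. -/
noncomputable def tupleMapVac : ∀ l : List 𝕋.pts, Hom (E.tuple l) (F.tuple l)
  | [] => vacMap T
  | s :: l => (T s).tens (tupleMapVac l)

theorem isCompression_vacMap : Hom.IsCompression F.vacUnit (T 0) E.vacUnit (vacMap T) :=
  fun g _ => F.inner_vacUnit g _

variable {T}

theorem IsMorphism.isCompression (hT : E.IsMorphism F T) {s t u : 𝕋.pts} (h : s + t = u) :
    Hom.IsCompression (F.β h) ((T s).tens (T t)) (E.β h) (T u) := fun y x => by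
  rw [hT.map_add h]
  exact (ContinuousLinearMap.adjoint_inner_right _ _ _).symm

/-- The map `T_0` acts trivially on the left of `T_t`. -/
theorem IsMorphism.leftUnit_vacMap (hT : E.IsMorphism F T) (t : 𝕋.pts) (v : ((unit B).tensor (E.E t)).H) :
    (T t).op ((Hom.leftUnit (E.E t)).op v) = (Hom.leftUnit (F.E t)).op (((vacMap T).tens (T t)).op v) := by
  have h1 : Hom.IsCompression (F.vacUnit.tens (Hom.id (F.E t))) ((T 0).tens (T t))
      (E.vacUnit.tens (Hom.id (E.E t))) ((vacMap T).tens (T t)) :=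
    (isCompression_vacMap T).tens fun _ _ => rfl
  have h2 : Hom.IsCompression (Hom.leftUnit (F.E t)) (T t) (Hom.leftUnit (E.E t)) ((vacMap T).tens (T t)) := by
    intro y x
    rw [← hT.isCompression (zero_add t), ← h1, ← β_leftUnit, ← β_leftUnit]
    rfl
  exact h2.comm Hom.norm_leftUnit Hom.leftUnit_surjective v

/-- The map `T_0` acts trivially on the right of `T_t`. -/
theorem IsMorphism.tens_vacMap (hT : E.IsMorphism F T) (t : 𝕋.pts) : (T t).tens (vacMap T) = (T t).tens (Hom.id (unit B)) := by
  have h1 : Hom.IsCompression ((Hom.id (F.E t)).tens F.vacUnit) ((T t).tens (T 0))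
      ((Hom.id (E.E t)).tens E.vacUnit) ((T t).tens (vacMap T)) :=
    Hom.IsCompression.tens (fun _ _ => rfl) (isCompression_vacMap T)
  have h2 : Hom.IsCompression (Hom.rightUnit (F.E t)) ((T t).tens (vacMap T)) (Hom.rightUnit (E.E t)) (T t) := by
    intro y x
    rw [← hT.isCompression (add_zero t), ← h1, ← β_zero_right_op, ← β_zero_right_op]
  refine Hom.ext_op fun v => ?_
  obtain ⟨x, rfl⟩ := Hom.rightUnit_surjective v
  rw [h2.comm Hom.norm_rightUnit Hom.rightUnit_surjective, Hom.rightUnit_natural]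

theorem IsMorphism.tupleMapVac_cons (hT : E.IsMorphism F T) (s : 𝕋.pts) (l : List 𝕋.pts) :
    tupleMapVac T (s :: l) = tupleMap T (s :: l) := by
  induction l generalizing s with
  | nil => exact hT.tens_vacMap s
  | cons r l ih => exact congrArg (Hom.tens (T s)) (ih r)

/-- The map `T_0` is idempotent as an element of `B`: `c (a b) = c a · c b`. -/
theorem IsMorphism.vacMap_idem (hT : E.IsMorphism F T) (v : ((unit B).tensor (unit B)).H) :
    (vacMap T).op ((Hom.leftUnit (unit B)).op v) =
      (Hom.leftUnit (unit B)).op (((vacMap T).tens (vacMap T)).op v) := by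
  have h1 := Hom.op_congr (Hom.leftUnit_natural E.vacUnit) v
  have h2 := hT.leftUnit_vacMap 0 (((Hom.id (unit B)).tens E.vacUnit).op v)
  have h3 : ((vacMap T).tens (vacMap T)).op v = ((Hom.id (unit B)).tens F.vacHom).op
      (((vacMap T).tens (T 0)).op (((Hom.id (unit B)).tens E.vacUnit).op v)) := by
    rw [← Hom.tens_comp_apply, ← Hom.tens_comp_apply]; rfl
  rw [h3, Hom.op_congr (Hom.leftUnit_natural F.vacHom), ← h2, h1]
  rfl

end Morphism

end InclusionSystem

namespace VNBimodule.Hom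

variable {G : Type u} [NormedAddCommGroup G] [InnerProductSpace ℂ G] [CompleteSpace G]
  {B : VonNeumannAlgebra G} {X X' Y Y' Z Z' W W' : VNBimodule B}

/-- If `c` acts trivially on the left of `T`, then also on the left of `T ⊙ S`. -/
theorem leftUnit_tens_of_left (c : Hom (unit B) (unit B)) (T : Hom X X') (S : Hom Y Y')
    (h : ∀ v, T.op ((leftUnit X).op v) = (leftUnit X').op ((c.tens T).op v)) (v) :
    (T.tens S).op ((leftUnit (X.tensor Y)).op v) =
      (leftUnit (X'.tensor Y')).op ((c.tens (T.tens S)).op v) := by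
  obtain ⟨w, rfl⟩ := assoc_surjective (unit B) X Y v
  have h1 : ∀ w, (leftUnit (X.tensor Y)).op ((assoc (unit B) X Y).op w) =
      ((leftUnit X).tens (id Y)).op w := fun w => congrArg (fun T => T.op w) (leftUnit_assoc X Y)
  have h2 : ∀ w, (leftUnit (X'.tensor Y')).op ((assoc (unit B) X' Y').op w) =
      ((leftUnit X').tens (id Y')).op w := fun w => congrArg (fun T => T.op w) (leftUnit_assoc X' Y')
  have h3 : T.comp (leftUnit X) = (leftUnit X').comp (c.tens T) := ext_op h
  rw [h1, ← op_congr (assoc_natural c T S), h2, ← tens_comp_apply, ← tens_comp_apply, h3]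
  rfl

theorem tens_conc (P : Hom X X') (c : Hom (Y.tensor Z) W) (c' : Hom (Y'.tensor Z') W') (Q : Hom Y Y')
    (R : Hom Z Z') (S : Hom W W') (h : S.comp c = c'.comp (Q.tens R)) :
    (P.tens S).comp (((id X).tens c).comp (assoc X Y Z)) =
      (((id X').tens c').comp (assoc X' Y' Z')).comp ((P.tens Q).tens R) :=
  ext_op fun v => by
    change (P.tens S).op (((id X).tens c).op ((assoc X Y Z).op v)) =
      ((id X').tens c').op ((assoc X' Y' Z').op (((P.tens Q).tens R).op v))
    rw [op_congr (assoc_natural P Q R), ← tens_comp_apply, ← tens_comp_apply, h]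
    rfl

/-- The compression step for the splitting of the first factor of a tensor product by `β`. -/
theorem IsCompression.split {R R' S S' M M' N N' L L' : VNBimodule B} {β : Hom S (R.tensor N)}
    {β' : Hom S' (R'.tensor N')} {P : Hom R R'} {Q : Hom N N'} {A : Hom S S'} {D : Hom M M'}
    {g : Hom (N.tensor M) L} {g' : Hom (N'.tensor M') L'} {C : Hom L L'}
    (h₁ : IsCompression β' (P.tens Q) β A) (h₂ : IsCompression g' C g (Q.tens D)) :
    IsCompression (((id R').tens g').comp ((assoc R' N' M').comp (β'.tens (id M')))) (P.tens C)
      (((id R).tens g).comp ((assoc R N M).comp (β.tens (id M)))) (A.tens D) := by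
  have h3 : IsCompression ((id R').tens g') (P.tens C) ((id R).tens g) (P.tens (Q.tens D)) :=
    IsCompression.tens (fun _ _ => rfl) h₂
  have h4 : IsCompression (assoc R' N' M') (P.tens (Q.tens D)) (assoc R N M) ((P.tens Q).tens D) :=
    .of_comm (VNBimodule.assoc_norm _ _ _) fun v => (op_congr (assoc_natural P Q D) v).symm
  have h5 : IsCompression (β'.tens (id M')) ((P.tens Q).tens D) (β.tens (id M)) (A.tens D) :=
    IsCompression.tens h₁ fun _ _ => rfl
  exact h3.trans (h4.trans h5)

end VNBimodule.Hom

namespace InclusionSystem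

variable {G : Type u} [NormedAddCommGroup G] [InnerProductSpace ℂ G] [CompleteSpace G]
  {B : VonNeumannAlgebra G} {𝕋 : TimeSet}

open VNBimodule

variable {E F : InclusionSystem B 𝕋} {T : ∀ t, Hom (E.E t) (F.E t)}

theorem IsMorphism.tupleMapVac_conc (hT : E.IsMorphism F T) (l m : List 𝕋.pts) :
    (tupleMapVac T (l ++ m)).comp (E.conc l m) =
      (F.conc l m).comp ((tupleMapVac T l).tens (tupleMapVac T m)) := by
  induction l with
  | nil =>
    refine Hom.ext_op fun v => ?_
    cases m with
    | nil => exact hT.vacMap_idem v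
    | cons s m => exact Hom.leftUnit_tens_of_left _ (T s) (tupleMapVac T m) (hT.leftUnit_vacMap s) v
  | cons s l ih =>
    exact Hom.tens_conc (T s) (E.conc l m) (F.conc l m) (tupleMapVac T l) (tupleMapVac T m) _ ih

/-- Along the isometries of a refinement, `T_𝔱` is compressed to `T_𝔰`. -/
theorem IsMorphism.isCompression_refine (hT : E.IsMorphism F T) {m l : List 𝕋.pts} {f : Hom (E.tuple m) (E.tuple l)}
    {g : Hom (F.tuple m) (F.tuple l)} (hf : E.Refine m l f) (hg : F.Refine m l g) :
    Hom.IsCompression g (tupleMapVac T l) f (tupleMapVac T m) := by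
  induction hf with
  | nil => cases hg; exact fun _ _ => rfl
  | @keep m l s f h ih =>
    cases hg with
    | keep _ hg => exact Hom.IsCompression.tens (fun _ _ => rfl) (ih hg)
    | split hr hs he hf => exact absurd (add_eq_left.1 he) hs.ne'
  | @split m l r s' s hr hs he f hf ih =>
    cases hg with
    | keep _ hg => exact absurd (add_eq_left.1 he) hs.ne'
    | @split _ _ _ s'' _ hr' hs' he' g hg =>
      obtain rfl : s' = s'' := add_left_cancel (he.trans he'.symm)
      exact (hT.isCompression he).split (ih hg)

theorem IsMorphism.adjointable_tupleMapVac (hT : E.IsMorphism F T) (l : List 𝕋.pts) : (tupleMapVac T l).Adjointable := by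
  induction l with
  | nil =>
    refine Hom.Adjointable.comp ?_ (Hom.Adjointable.comp (hT.adjointable 0) ?_)
    · exact Hom.adjointable_of_adjoint_eq (S := F.vacUnit) (ContinuousLinearMap.adjoint_adjoint _).symm
    · exact Hom.adjointable_of_adjoint_eq (S := E.vacHom) rfl
  | cons s l ih => exact (hT.adjointable s).tens ih

theorem norm_tupleMapVac_le {k : ℝ} (hk : ∀ t : 𝕋.pts, ‖(T t).op‖ ≤ Real.exp (((t : ℝ≥0) : ℝ) * k))
    (l : List 𝕋.pts) : ‖(tupleMapVac T l).op‖ ≤ Real.exp (((l.sum : ℝ≥0) : ℝ) * k) := by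
  induction l with
  | nil =>
    have h1 : ‖(vacMap T).op‖ ≤ 1 * (‖(T 0).op‖ * 1) := by
      refine (ContinuousLinearMap.opNorm_comp_le _ _).trans ?_
      gcongr
      · exact norm_le_one_of_norm_map F.norm_vacHom
      refine (ContinuousLinearMap.opNorm_comp_le _ _).trans ?_
      gcongr
      exact norm_le_one_of_norm_map E.norm_vacUnit
    rw [one_mul, mul_one] at h1
    exact h1.trans (hk 0)
  | cons s l ih =>
    refine (Hom.norm_tens_le (T s) (tupleMapVac T l)).trans ?_
    rw [List.sum_cons, AddSubmonoid.coe_add, NNReal.coe_add, add_mul, Real.exp_add]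
    exact mul_le_mul (hk s) ih (norm_nonneg _) (Real.exp_nonneg _)

end InclusionSystem

/-! ### Bilinear maps of generated modules and their compressions -/

namespace VNBimodule.Hom

variable {G : Type u} [NormedAddCommGroup G] [InnerProductSpace ℂ G] [CompleteSpace G]
  {B : VonNeumannAlgebra G} {X X' Y Y' Z W : VNBimodule B}

/-- Compressions may be composed with an intertwining pair of unitaries. -/
theorem IsCompression.comp_iff {g : Hom Y Y'} {P : Hom X' Y'} {f : Hom X X'} {Q : Hom X Y} {g' : Hom W Y}
    {f' : Hom Z X} {R : Hom Z W} (hg : ∀ v, ‖g'.op v‖ = ‖v‖) (hgs : Function.Surjective g'.op)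
    (hfs : Function.Surjective f'.op) (h : ∀ v, Q.op (f'.op v) = g'.op (R.op v)) :
    IsCompression (g.comp g') P (f.comp f') R ↔ IsCompression g P f Q := by
  refine ⟨fun hc y x => ?_, fun hc => hc.trans (.of_comm hg h)⟩
  obtain ⟨y, rfl⟩ := hgs y
  obtain ⟨x, rfl⟩ := hfs x
  rw [h, inner_map_of_norm_map hg]
  exact hc y x

theorem IsCompression.adjoint_apply {g : Hom Y Y'} {P : Hom X' Y'} {f : Hom X X'} {Q : Hom X Y}
    (h : IsCompression g P f Q) (x : X.H) : ContinuousLinearMap.adjoint g.op (P.op (f.op x)) = Q.op x :=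
  ext_inner_left ℂ fun y => (ContinuousLinearMap.adjoint_inner_right _ _ _).trans (h y x)

end VNBimodule.Hom

namespace InclusionSystem

variable {G : Type u} [NormedAddCommGroup G] [InnerProductSpace ℂ G] [CompleteSpace G]
  {B : VonNeumannAlgebra G} {𝕋 : TimeSet}

open VNBimodule

variable {E F : InclusionSystem B 𝕋} {t : 𝕋.pts}

theorem Refine.refl (I : InclusionSystem B 𝕋) (l : List 𝕋.pts) : I.Refine l l (Hom.id _) := by
  induction l with
  | nil => exact .nil
  | cons s l ih => exact (ih.keep s).congr (Hom.id_tens_id _ _)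

/-- Two inclusion systems have the same notion of convergence along tuples. -/
theorem sys_tails_eq (E F : InclusionSystem B 𝕋) (t : 𝕋.pts) :
    ((E.sys t).tails : Filter (Tup t)) = (F.sys t).tails := by
  have key : ∀ E F : InclusionSystem B 𝕋, ((E.sys t).tails : Filter (Tup t)) ≤ (F.sys t).tails := by
    rintro E F s ⟨i, hi⟩
    refine ⟨i, fun j ⟨f, hf⟩ => hi j ?_⟩
    exact Refine.transfer (I := E) F hf
  exact le_antisymm (key E F) (key F E)

/-- Operators between generated modules are determined by their compressions to a cofinal set of tuples. -/
theorem gen_clm_ext {S T : (E.gen t).H →L[ℂ] (F.gen t).H}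
    (h : ∀ n : Tup t, ∃ (l : Tup t) (f : _), E.Refine n.1 l.1 f ∧ ∀ x y,
      ⟪(F.incTup l).op y, S ((E.incTup l).op x)⟫_ℂ = ⟪(F.incTup l).op y, T ((E.incTup l).op x)⟫_ℂ) :
    S = T := by
  refine clm_ext_inner (E.sys t).dense_incl (F.sys t).dense_incl ?_
  rintro ⟨i, v⟩ ⟨i', w⟩
  obtain ⟨n, a, b, ha, hb⟩ := E.exists_refine_pair i i'
  obtain ⟨l, f, hf, hl⟩ := h n
  have h1 := ha.trans hf
  obtain ⟨g, hg⟩ := (hb.trans hf).transfer F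
  have e1 := E.incTup_refine h1 v
  have e2 := F.incTup_refine hg w
  change ⟪(F.incTup i').op w, S ((E.incTup i).op v)⟫_ℂ = ⟪(F.incTup i').op w, T ((E.incTup i).op v)⟫_ℂ
  rw [← e1, ← e2]
  exact hl _ _

/-- An operator that is compressed to `P_𝔱` for every tuple `𝔱` is the strong limit of the net
`j_𝔱 P_𝔱 i_𝔱^*`, because the range projections of `i_𝔱` and `j_𝔱` converge strongly to the identity. -/
theorem tendsto_of_compression {P : ∀ l : Tup t, Hom (E.tuple l.1) (F.tuple l.1)}
    {A : (E.gen t).H →L[ℂ] (F.gen t).H}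
    (hA : ∀ l y x, ⟪(F.incTup l).op y, A ((E.incTup l).op x)⟫_ℂ = ⟪y, (P l).op x⟫_ℂ) (ξ : (E.gen t).H) :
    Tendsto (fun l : Tup t => (F.incTup l).op ((P l).op (ContinuousLinearMap.adjoint (E.incTup l).op ξ)))
      (E.sys t).tails (𝓝 (A ξ)) := by
  have hP : ∀ l x, (P l).op x = ContinuousLinearMap.adjoint (F.incTup l).op (A ((E.incTup l).op x)) :=
    fun l x => ext_inner_left ℂ fun y => by rw [ContinuousLinearMap.adjoint_inner_right, hA]
  let q : Tup t → (F.gen t).H →L[ℂ] (F.gen t).H := fun l =>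
    (F.incTup l).op ∘L ContinuousLinearMap.adjoint (F.incTup l).op
  let p : Tup t → (E.gen t).H := fun l => (E.incTup l).op (ContinuousLinearMap.adjoint (E.incTup l).op ξ)
  have hp : Tendsto p (E.sys t).tails (𝓝 ξ) := (E.sys t).tendsto_incl_adjoint ξ
  have hq : Tendsto (fun l => q l (A ξ)) (E.sys t).tails (𝓝 (A ξ)) := by
    have := (F.sys t).tendsto_incl_adjoint (A ξ)
    rw [← sys_tails_eq E F t] at this
    exact this
  have hqn : ∀ l v, ‖q l v‖ ≤ ‖v‖ := fun l v => by
    refine (F.norm_incTup l _).trans_le ?_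
    have h1 := (ContinuousLinearMap.adjoint (F.incTup l).op).le_opNorm v
    rw [LinearIsometryEquiv.norm_map] at h1
    refine h1.trans (mul_le_of_le_one_left (norm_nonneg _) (norm_le_one_of_norm_map (F.norm_incTup l)))
  have h2 : Tendsto (fun l => q l (A (p l - ξ))) (E.sys t).tails (𝓝 0) := by
    have h3 : Tendsto (fun l => ‖A (p l - ξ)‖) (E.sys t).tails (𝓝 0) := by
      have := (A.continuous.tendsto _).comp (hp.sub_const ξ)
      rw [sub_self, map_zero] at this
      exact tendsto_zero_iff_norm_tendsto_zero.1 this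
    exact squeeze_zero_norm (fun l => hqn l _) h3
  have h4 := h2.add hq
  rw [zero_add] at h4
  refine h4.congr fun l => ?_
  rw [hP, ← map_add, ← map_add, sub_add_cancel]
  rfl

/-- A bounded compatible family of bilinear maps on the tuples is compressed from a bilinear map on the
generated modules. -/
theorem exists_hom_of_compressions (P : ∀ l : Tup t, Hom (E.tuple l.1) (F.tuple l.1)) {r : ℝ} (hr : 0 ≤ r)
    (hP : ∀ l, ‖(P l).op‖ ≤ r)
    (hc : ∀ {m l : Tup t} {f g}, E.Refine m.1 l.1 f → F.Refine m.1 l.1 g → Hom.IsCompression g (P l) f (P m)) :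
    ∃ A : Hom (E.gen t) (F.gen t), ‖A.op‖ ≤ r ∧
      ∀ l, Hom.IsCompression (F.incTup l) A (E.incTup l) (P l) := by
  let Φ : Tup t → (E.gen t).H →L[ℂ] (F.gen t).H := fun l =>
    (F.incTup l).op ∘L (P l).op ∘L ContinuousLinearMap.adjoint (E.incTup l).op
  have hΦn : ∀ l, ‖Φ l‖ ≤ r := fun l => by
    have h1 : ‖Φ l‖ ≤ 1 * (r * 1) := by
      refine (ContinuousLinearMap.opNorm_comp_le _ _).trans ?_
      gcongr
      · exact norm_le_one_of_norm_map (F.norm_incTup l)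
      refine (ContinuousLinearMap.opNorm_comp_le _ _).trans ?_
      gcongr
      · exact hP l
      · rw [LinearIsometryEquiv.norm_map]
        exact norm_le_one_of_norm_map (E.norm_incTup l)
    rwa [one_mul, mul_one] at h1
  have hΦ : ∀ {m l : Tup t} {f}, E.Refine m.1 l.1 f → ∀ x,
      Φ l ((E.incTup m).op x) = (F.incTup l).op ((P l).op (f.op x)) := by
    intro m l f hf x
    rw [← E.incTup_refine hf]
    exact congrArg (fun v => (F.incTup l).op ((P l).op v)) (adjoint_apply_of_norm_map (E.norm_incTup l) _)
  have htails : ∀ {p : Tup t → Prop} (m : Tup t), (∀ l f, E.Refine m.1 l.1 f → p l) →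
      ∀ᶠ l in (E.sys t).tails, p l := fun m h => (E.sys t).eventually_tails.2 ⟨m, fun l ⟨f, hf⟩ => h l f hf⟩
  obtain ⟨A, hAr, hA⟩ := exists_weak_cluster (E.sys t).tails Φ hr hΦn
  have hAP : ∀ m y x, ⟪(F.incTup m).op y, A ((E.incTup m).op x)⟫_ℂ = ⟪y, (P m).op x⟫_ℂ := by
    intro m y x
    refine hA _ _ _ (htails m fun l f hf => ?_)
    obtain ⟨g, hg⟩ := hf.transfer F
    rw [hΦ hf, ← F.incTup_refine hg, inner_map_of_norm_map (F.norm_incTup l)]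
    exact hc hf hg y x
  -- left multiplication by `b` commutes with all compressions
  have hcomm : ∀ b, A ∘L (E.gen t).π b = (F.gen t).π b ∘L A := by
    intro b
    refine gen_clm_ext fun n => ⟨n, Hom.id _, Refine.refl E _, fun x y => ?_⟩
    have h1 : ∀ X : VNBimodule B, X.π b = ContinuousLinearMap.adjoint (X.π (star b)) := fun X => by
      rw [map_star, ContinuousLinearMap.star_eq_adjoint, ContinuousLinearMap.adjoint_adjoint]
    rw [ContinuousLinearMap.comp_apply, ContinuousLinearMap.comp_apply, ← (E.incTup n).comm, hAP, (P n).comm,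
      h1 (F.gen t), ContinuousLinearMap.adjoint_inner_right, ← (F.incTup n).comm, hAP,
      h1, ContinuousLinearMap.adjoint_inner_right]
  refine ⟨⟨A, fun z hz => ?_, fun b v => DFunLike.congr_fun (hcomm b) v⟩, hAr, hAP⟩
  -- on the vectors `i_𝔪 x g`, the net consists of vectors `y g` with `y` in the algebraic limit
  refine sotClosure_le_of_span (E' := (F.sys t).algLim) A (ContinuousLinearMap.id ℂ G) ?_ hz
  rintro _ ⟨m, x, rfl⟩
  change (E.tuple m.1).E at x
  rw [mem_sotClosure]
  have hlim : Tendsto (fun (l : Tup t) (g : G) => Φ l ((E.incTup m).op ((x : G →L[ℂ] (E.tuple m.1).H) g)))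
      (E.sys t).tails (𝓝 fun g => A ((E.incTup m).op ((x : G →L[ℂ] (E.tuple m.1).H) g))) :=
    tendsto_pi_nhds.2 fun g => tendsto_of_compression hAP _
  have hne := (E.sys t).tails_neBot
  refine @mem_closure_of_tendsto _ _ _ _ _ _ _ hne hlim (htails m fun l f hf => ?_)
  refine ⟨(F.incTup l).op ∘L ((P l).app (f.app x) : G →L[ℂ] (F.tuple l.1).H),
    Submodule.subset_span ⟨l, (P l).app (f.app x), rfl⟩, ?_⟩
  exact funext fun g => (hΦ hf _).symm

end InclusionSystem

namespace InclusionSystem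

variable {G : Type u} [NormedAddCommGroup G] [InnerProductSpace ℂ G] [CompleteSpace G]
  {B : VonNeumannAlgebra G} {𝕋 : TimeSet}

open VNBimodule

variable {E F : InclusionSystem B 𝕋} {s t u : 𝕋.pts}

/-- If `A` and `A'` compress to `P` and `P'`, then `C (A ⊙ A') B^*` compresses to `P ⊙ P'` on the concatenated
tuple. -/
theorem prod_tens_compression {A : Hom (E.gen s) (F.gen s)} {A' : Hom (E.gen t) (F.gen t)} {l : Tup s} {m : Tup t}
    {P : Hom (E.tuple l.1) (F.tuple l.1)} {P' : Hom (E.tuple m.1) (F.tuple m.1)} (h : s + t = u)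
    (h1 : Hom.IsCompression (F.incTup l) A (E.incTup l) P)
    (h2 : Hom.IsCompression (F.incTup m) A' (E.incTup m) P') (y x) :
    ⟪(F.incTup (l.append h m)).op ((F.conc l.1 m.1).op y), (F.prod h ∘L (A.tens A').op ∘L
      ContinuousLinearMap.adjoint (E.prod h)) ((E.incTup (l.append h m)).op ((E.conc l.1 m.1).op x))⟫_ℂ =
    ⟪y, (P.tens P').op x⟫_ℂ := by
  rw [← prod_tens, ← prod_tens]
  change ⟪F.prod h _, F.prod h ((A.tens A').op (ContinuousLinearMap.adjoint (E.prod h) (E.prod h _)))⟫_ℂ = _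
  rw [adjoint_apply_of_norm_map (E.norm_prod h), inner_map_of_norm_map (F.norm_prod h)]
  exact h1.tens h2 y x

variable {T : ∀ t, Hom (E.E t) (F.E t)}

/-- If two maps on generated modules compress to `T_𝔰` and `T_𝔱`, then their product compresses to
`T_{𝔰 ⌣ 𝔱}`. -/
theorem IsMorphism.prod_compression (hT : E.IsMorphism F T) {A : Hom (E.gen s) (F.gen s)}
    {A' : Hom (E.gen t) (F.gen t)} {l : Tup s} {m : Tup t} (h : s + t = u)
    (h1 : Hom.IsCompression (F.incTup l) A (E.incTup l) (tupleMapVac T l.1))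
    (h2 : Hom.IsCompression (F.incTup m) A' (E.incTup m) (tupleMapVac T m.1)) (y x) :
    ⟪(F.incTup (l.append h m)).op y, (F.prod h ∘L (A.tens A').op ∘L
      ContinuousLinearMap.adjoint (E.prod h)) ((E.incTup (l.append h m)).op x)⟫_ℂ =
    ⟪y, (tupleMapVac T (l.1 ++ m.1)).op x⟫_ℂ := by
  obtain ⟨y, rfl⟩ := conc_surjective l.1 m.1 y
  obtain ⟨x, rfl⟩ := conc_surjective l.1 m.1 x
  rw [prod_tens_compression h h1 h2, Hom.op_congr (hT.tupleMapVac_conc l.1 m.1)]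
  exact (inner_map_of_norm_map (norm_conc l.1 m.1) _ _).symm

theorem incl_zero (I : InclusionSystem B 𝕋) : I.incl 0 = (I.incTup Tup.empty).comp I.vacHom := by
  rw [incl, dif_pos rfl]

theorem incl_of_pos (I : InclusionSystem B 𝕋) (ht : 0 < t) :
    I.incl t = (I.incTup (Tup.single ht)).comp (Hom.rightUnit (I.E t)) := by
  rw [incl, dif_neg ht.ne]

/-- At time `0` the lifting condition is the compression condition for the empty tuple. -/
theorem compression_incl_zero {A : Hom (E.gen 0) (F.gen 0)} :
    Hom.IsCompression (F.incl 0) A (E.incl 0) (T 0) ↔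
      Hom.IsCompression (F.incTup Tup.empty) A (E.incTup Tup.empty) (tupleMapVac T []) := by
  rw [incl_zero, incl_zero]
  refine Hom.IsCompression.comp_iff F.norm_vacHom (fun g => ⟨_, F.vacHom_vacUnit g⟩)
    (fun g => ⟨_, E.vacHom_vacUnit g⟩) fun v => ?_
  change F.vacHom.op ((T 0).op (E.vacUnit.op (E.vacHom.op v))) = _
  rw [vacUnit_vacHom]
  rfl

/-- At times `t > 0` the lifting condition is the compression condition for the tuple `(t)`. -/
theorem IsMorphism.compression_incl (hT : E.IsMorphism F T) (ht : 0 < t) {A : Hom (E.gen t) (F.gen t)} :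
    Hom.IsCompression (F.incl t) A (E.incl t) (T t) ↔
      Hom.IsCompression (F.incTup (Tup.single ht)) A (E.incTup (Tup.single ht)) (tupleMapVac T [t]) := by
  rw [incl_of_pos _ ht, incl_of_pos _ ht]
  refine Hom.IsCompression.comp_iff Hom.norm_rightUnit Hom.rightUnit_surjective
    Hom.rightUnit_surjective fun v => ?_
  refine Eq.trans ?_ (Hom.rightUnit_natural (T t) v)
  rw [← hT.tens_vacMap]
  rfl

theorem isLift_iff {S : ∀ t, Hom (E.gen t) (F.gen t)} :
    E.IsLift F T S ↔ ∀ s, Hom.IsCompression (F.incl s) (S s) (E.incl s) (T s) := by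
  refine forall_congr' fun s => ⟨fun h y x => ?_, fun h => ContinuousLinearMap.ext fun x => ?_⟩
  · rw [h]; exact (ContinuousLinearMap.adjoint_inner_right _ _ _).symm
  · exact (h.adjoint_apply x).symm

/-- A morphism of product systems that lifts `T` compresses to `T_𝔱` for every tuple `𝔱`. -/
theorem IsProductMorphism.compression {S : ∀ t, Hom (E.gen t) (F.gen t)} (hS : E.IsProductMorphism F S)
    (hT : E.IsMorphism F T) (hL : E.IsLift F T S) : ∀ (l : List 𝕋.pts) {t : 𝕋.pts}
      (hl : (∀ s ∈ l, 0 < s) ∧ l.sum = t), Hom.IsCompression (F.incTup (⟨l, hl⟩ : Tup t)) (S t)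
        (E.incTup (⟨l, hl⟩ : Tup t)) (tupleMapVac T l)
  | [], t, hl => by
    obtain ⟨hl, rfl⟩ := hl
    exact compression_incl_zero.1 (isLift_iff.1 hL 0)
  | r :: l, t, hl => by
    have hr : 0 < r := hl.1 r (by simp)
    have hl' : (∀ s ∈ l, 0 < s) ∧ l.sum = l.sum := ⟨fun s hs => hl.1 s (List.mem_cons_of_mem _ hs), rfl⟩
    have h : r + l.sum = t := by rw [← List.sum_cons]; exact hl.2
    have h1 := (hT.compression_incl hr).1 (isLift_iff.1 hL r)
    have h2 := IsProductMorphism.compression hS hT hL l hl'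
    have h3 := hS.map_add h
    rw [ContinuousLinearMap.adjoint_adjoint] at h3
    intro y x
    rw [h3]
    exact hT.prod_compression h h1 h2 y x

end InclusionSystem

/-! ### Lifting of morphisms -/

open VNBimodule InclusionSystem in
/-- The lift at time `t`, obtained from the compatible family of the maps `T_𝔱`. -/
theorem InclusionSystem.IsMorphism.exists_compressed {G : Type u} [NormedAddCommGroup G] [InnerProductSpace ℂ G]
    [CompleteSpace G] {B : VonNeumannAlgebra G} {𝕋 : TimeSet} {E F : InclusionSystem B 𝕋}
    {T : ∀ t, Hom (E.E t) (F.E t)} (hT : E.IsMorphism F T) {k : ℝ}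
    (hk : ∀ t : 𝕋.pts, ‖(T t).op‖ ≤ Real.exp (((t : ℝ≥0) : ℝ) * k)) (t : 𝕋.pts) :
    ∃ A : Hom (E.gen t) (F.gen t), A.Adjointable ∧ ‖A.op‖ ≤ Real.exp (((t : ℝ≥0) : ℝ) * k) ∧
      ∀ l : Tup t, Hom.IsCompression (F.incTup l) A (E.incTup l) (tupleMapVac T l.1) := by
  have hn : ∀ l : Tup t, ‖(tupleMapVac T l.1).op‖ ≤ Real.exp (((t : ℝ≥0) : ℝ) * k) := fun l => by
    have := norm_tupleMapVac_le hk l.1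
    rwa [l.2.2] at this
  obtain ⟨A, hAn, hA⟩ := exists_hom_of_compressions (fun l : Tup t => tupleMapVac T l.1) (Real.exp_nonneg _) hn
    fun hf hg => hT.isCompression_refine hf hg
  -- the adjoints `T_𝔱^*` form a compatible family in the opposite direction, and it gives the adjoint of `A`
  obtain ⟨A', -, hA'⟩ := exists_hom_of_compressions (E := F) (F := E)
    (fun l : Tup t => (tupleMapVac T l.1).adj (hT.adjointable_tupleMapVac l.1)) (Real.exp_nonneg _)
    (fun l => (LinearIsometryEquiv.norm_map _ _).trans_le (hn l)) fun hf hg y x => by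
      rw [Hom.inner_adj, Hom.inner_adj, ← inner_conj_symm, hT.isCompression_refine hg hf, inner_conj_symm]
  refine ⟨A, Hom.adjointable_of_adjoint_eq (S := A') ?_, hAn, hA⟩
  refine gen_clm_ext fun n => ⟨n, Hom.id _, Refine.refl F _, fun x y => ?_⟩
  rw [hA' n, ContinuousLinearMap.adjoint_inner_right, Hom.inner_adj, ← inner_conj_symm, ← hA n, inner_conj_symm]

theorem theorem5p3 {G : Type u} [NormedAddCommGroup G] [InnerProductSpace ℂ G] [CompleteSpace G]
    (B : VonNeumannAlgebra G) (𝕋 : TimeSet) (E F : InclusionSystem B 𝕋)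
    (T : ∀ t, VNBimodule.Hom (E.E t) (F.E t)) (hT : E.IsMorphism F T) :
    ∃ T' : ∀ t, VNBimodule.Hom (E.gen t) (F.gen t), E.IsProductMorphism F T' ∧ E.IsLift F T T' ∧
      (∀ S : ∀ t, VNBimodule.Hom (E.gen t) (F.gen t), E.IsProductMorphism F S → E.IsLift F T S → S = T') ∧
      ∀ t : 𝕋.pts, 0 < t → ∀ ξ : (E.gen t).H, ∀ ε > 0, ∃ r : InclusionSystem.Tup t, ∀ l : InclusionSystem.Tup t,
        (∃ f, E.Refine r.1 l.1 f) → ‖InclusionSystem.tupleLift T l ξ - (T' t).op ξ‖ < ε := by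
  obtain ⟨k, hk⟩ := hT.bound
  choose A hAadj hAn hA using hT.exists_compressed hk
  refine ⟨A, ⟨hAadj, ⟨k, hAn⟩, fun h z hz => ?_, fun {s t u} h => ?_⟩, ?_, fun S hS hL => ?_,
    fun t ht ξ ε hε => ?_⟩
  · rw [ContinuousLinearMap.adjoint_adjoint]
    exact F.prod_mem h z hz
  · rw [ContinuousLinearMap.adjoint_adjoint]
    refine InclusionSystem.gen_clm_ext fun n => ?_
    -- concatenations are cofinal among the tuples with sum `s + t`
    obtain ⟨l, m, -, -, f, -, -, hf⟩ := E.exists_refine_append h n (E.sys s).nonempty.some (E.sys t).nonempty.some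
    refine ⟨l.append h m, f, hf, fun x y => ?_⟩
    exact (hA u (l.append h m) y x).trans (hT.prod_compression h (hA s l) (hA t m) y x).symm
  · refine InclusionSystem.isLift_iff.2 fun s => ?_
    rcases (TimeSet.zero_le s).eq_or_lt with h | h
    · subst h
      exact InclusionSystem.compression_incl_zero.2 (hA 0 InclusionSystem.Tup.empty)
    · exact (hT.compression_incl h).2 (hA s (InclusionSystem.Tup.single h))
  · refine funext fun t => VNBimodule.Hom.ext_op fun v => DFunLike.congr_fun ?_ v
    refine InclusionSystem.gen_clm_ext fun n => ⟨n, VNBimodule.Hom.id _, InclusionSystem.Refine.refl E _, fun x y => ?_⟩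
    exact (hS.compression hT hL n.1 n.2 y x).trans (hA t n y x).symm
  · have h1 := InclusionSystem.tendsto_of_compression (hA t) ξ
    obtain ⟨r, hr⟩ := (E.sys t).eventually_tails.1 ((Metric.tendsto_nhds.1 h1) ε hε)
    refine ⟨r, fun l hl => ?_⟩
    have h2 := hr l hl
    rw [dist_eq_norm] at h2
    have h3 : InclusionSystem.tupleMapVac T l.1 = InclusionSystem.tupleMap T l.1 := by
      obtain ⟨l, hl, hsum⟩ := l
      cases l with
      | nil => exact absurd hsum ht.ne
      | cons s l => exact hT.tupleMapVac_cons s l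
    rw [h3] at h2
    exact h2
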